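/- **Conventions.** Let $d\ge 1$. Cubes in $\mathbb R^d$ have edges parallel to the axes; $\ell(Q)$ is the side length of $Q$, $|Q|$ its volume, and $sQ$ the concentric cube of side length $s\,\ell(Q)$. $\mathcal P_n$ is the space of polynomials on $\mathbb R^d$ of degree at most $n$. Functions are real valued. *Lipschitz domains.* A bounded domain $D\subset\mathbb R^d$ is $(\delta,R)$-Lipschitz if for every $a\in\partial D$ there are a function $A:\mathbb R^{d-1}\to\mathbb R$ with Lipschitz constant at most $\delta$ and a cube $Q$ of side length $R>0$ centred at $a$ such that, after a suitable shift and rotation (or reflection), $D\cap Q=\{(x,y)\in Q: y>A(x)\}$. *Moduli of continuity.* A continuous increasing $\omega:[0,\infty)\to[0,\infty)$ with $\omega(0)=0$ is a modulus of continuity of order $n\in\mathbb N$ if $n$ is the smallest positive integer such that: for some $q\in[n,n+1)$ and some $C>0$, $\omega(st)<Cs^q\omega(t)$ for all $s>1$, $t>0$; and for some $r\in(n-1,n)$ and some $C>0$, $\omega(st)<Cs^r\omega(t)$ for all $0<s<1$, $t>0$. *Spaces.* For $f\in L^1_{loc}(D)$ put $$\|f\|_{\omega,D}=\sup_{Q\subset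 D}\inf_{P\in\mathcal P_n}\frac{1}{\omega(\ell(Q))}\frac1{|Q|}\int_Q|f-P|\,dx,\qquad \|f\|^{int}_{\omega,D}=\sup_{Q:\,2Q\subset D}\inf_{P\in\mathcal P_n}\frac{1}{\omega(\ell(Q))}\frac1{|Q|}\int_Q|f-P|\,dx,$$ and let $\mathcal C_\omega(D)$, $\mathcal C^{int}_\omega(D)$ be the sets of $f\in L^1_{loc}(D)$ for which the respective quantity is finite. For $f\in\mathcal C^{int}_\omega(D)$ and a cube $Q$ with $2Q\subset D$, $P_Q\in\mathcal P_n$ is a polynomial of near best approximation, with constant $C_0$, if $\frac1{|Q|}\int_Q|f-P_Q|\,dx\le C_0\,\omega(\ell(Q))\,\|f\|^{int}_{\omega,D}$. *Whitney coverings.* A Whitney covering of an open set $G$ is a family $\mathcal W$ of pairwise disjoint semi-open dyadic cubes with union $G$ such that $\operatorname{diam}Q\le\operatorname{dist}(Q,\partial G)\le4\operatorname{diam}Q$ for $Q\in\mathcal W$, $\ell(Q)\le4\ell(S)$ whenever $Q,S\in\mathcal W$ and $\overline Q\cap\overline S\ne\varnothing$, and $\sup_G\sum_{Q\in\mathcal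 W}\chi_{\frac65Q}<\infty$. *The extension.* Let $D$ be a bounded $(\delta,R)$-Lipschitz domain and $D'=\mathbb R^d\setminus\overline D$. Fix Whitney coverings $\mathcal W$ of $D$ and $\mathcal W'$ of $D'$ and a smooth partition of unity $\{\psi_Q\}_{Q\in\mathcal W'}$: each $\psi_Q$ is $C^\infty$ on $\mathbb R^d$, $\chi_{\frac45Q}\le\psi_Q\le\chi_{\frac54Q}$, $\sum_{Q\in\mathcal W'}\psi_Q=\chi_{D'}$, and for each $k\ge 0$ there is $C_k$ with $\|D^k\psi_Q(x)\|\le C_k\,\ell(Q)^{-k}$ for all $Q\in\mathcal W'$ and all $x$. For each $Q\in\mathcal W'$ with $\ell(Q)\le R$ fix a reflective cube $\widetilde Q\in\mathcal W$, that is, a cube of maximal size among the $S\in\mathcal W$ with $\operatorname{dist}(Q,S)\le2\operatorname{dist}(Q,\partial D)$. Fix a constant $C_0$. For $f\in\mathcal C^{int}_\omega(D)$ and polynomials $P_{\widetilde Q}$ of near best approximation for $f$ on $\widetilde Q$ with constant $C_0$, put $$\widetilde f=f\chi_D+\sum_{Q\in\mathcal W',\ \ell(Q)\le R}\psi_Q\,P_{\widetilde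 Q}.$$ **Proposition 3.** Let $\omega$ be a modulus of continuity of order $n\in\mathbb N$. There is a constant $C$, independent of $f$ and of the choice of the near best polynomials, such that for every $f\in\mathcal C^{int}_\omega(D)$ every such extension $\widetilde f$ has the following properties: (i) the support of $\widetilde f$ is compact; (ii) $\widetilde f$ is $C^\infty$-smooth in $D'=\mathbb R^d\setminus\overline D$; (iii) $\widetilde f\in L^1(\mathbb R^d,dx)\cap\mathcal C_\omega(\mathbb R^d)$ and $$\|\widetilde f\|_{\omega,\mathbb R^d}+\|\widetilde f\|_{L^1(\mathbb R^d,dx)}\le C\left(\|f\|^{int}_{\omega,D}+\|f\|_{L^1(D,dx)}\right).$$ -/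

import Mathlib

open MeasureTheory Set
open scoped ENNReal NNReal

noncomputable section

/-- The Euclidean space `ℝ^d`. -/
abbrev Euc (d : ℕ) : Type := EuclideanSpace ℝ (Fin d)

/-- A bounded domain `D ⊆ ℝ^d` is `(δ, R)`-Lipschitz if around each boundary point `a` there is a
(rotated) cube with centre `a` and side length `R` in which, in the rotated coordinates
`ρ (z - a) = (x, y) ∈ ℝ^(d-1) × ℝ`, the domain is the part lying above the graph of a
`δ`-Lipschitz function `A`. -/
def IsLipschitzDomain {d : ℕ} (δ : ℝ≥0) (R : ℝ) (D : Set (Euc d)) : Prop :=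
  IsOpen D ∧ IsConnected D ∧ Bornology.IsBounded D ∧ 0 < R ∧
  ∀ a ∈ frontier D, ∃ (ρ : Euc d ≃ₗᵢ[ℝ] WithLp 2 (Euc (d - 1) × ℝ)) (A : Euc (d - 1) → ℝ),
    LipschitzWith δ A ∧
    ∀ z : Euc d, (∀ i, |(ρ (z - a)).fst i| < R / 2) → |(ρ (z - a)).snd| < R / 2 →
      (z ∈ D ↔ A (ρ (z - a)).fst < (ρ (z - a)).snd)

/-- `ω(t) / t^q` is almost decreasing for some `q ∈ [n, n + 1)`, and `ω(t) / t^r` is almost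
increasing for some `r ∈ (n - 1, n)`. -/
def HasOrderRegularity (ω : ℝ → ℝ) (n : ℕ) : Prop :=
  (∃ q : ℝ, (n : ℝ) ≤ q ∧ q < n + 1 ∧ ∃ C : ℝ, 0 < C ∧
    ∀ s t : ℝ, 1 < s → 0 < t → ω (s * t) < C * s ^ q * ω t) ∧
  (∃ r : ℝ, (n : ℝ) - 1 < r ∧ r < n ∧ ∃ C : ℝ, 0 < C ∧
    ∀ s t : ℝ, 0 < s → s < 1 → 0 < t → ω (s * t) < C * s ^ r * ω t)

/-- Moduli of continuity of order `n`; only the values of `ω` on `[0, ∞)` matter. -/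
structure IsModulusOfOrder (ω : ℝ → ℝ) (n : ℕ) : Prop where
  continuousOn : ContinuousOn ω (Ici 0)
  monotoneOn : MonotoneOn ω (Ici 0)
  map_zero : ω 0 = 0
  isLeast : IsLeast {m : ℕ | 1 ≤ m ∧ HasOrderRegularity ω m} n

/-- A nondegenerate cube in `ℝ^d` with edges parallel to the axes. -/
structure AxisCube (d : ℕ) where
  center : Euc d
  side : ℝ
  side_pos : 0 < side

namespace AxisCube

variable {d : ℕ}

/-- The (semi-open) cube as a set of points. -/
def carrier (Q : AxisCube d) : Set (Euc d) :=
  {x | ∀ i, Q.center i - Q.side / 2 ≤ x i ∧ x i < Q.center i + Q.side / 2}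

/-- `s Q`: the same centre, side length `s ℓ(Q)`. -/
def scale (s : ℝ) (hs : 0 < s) (Q : AxisCube d) : AxisCube d where
  center := Q.center
  side := s * Q.side
  side_pos := mul_pos hs Q.side_pos

/-- The semi-open dyadic cubes `∏ᵢ [mᵢ 2^k, (mᵢ + 1) 2^k)`. -/
def IsDyadic (Q : AxisCube d) : Prop :=
  ∃ (k : ℤ) (m : Fin d → ℤ), Q.side = (2 : ℝ) ^ k ∧
    ∀ i, Q.center i = ((m i : ℝ) + 1 / 2) * (2 : ℝ) ^ k

end AxisCube

/-- The distance `inf {|x - y| : x ∈ A, y ∈ B}` between two sets. -/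
def setEDist {X : Type*} [PseudoEMetricSpace X] (A B : Set X) : ℝ≥0∞ :=
  ⨅ x ∈ A, ⨅ y ∈ B, edist x y

/-- The value of a polynomial at a point of `ℝ^d`. -/
def polyVal {d : ℕ} (P : MvPolynomial (Fin d) ℝ) (x : Euc d) : ℝ :=
  MvPolynomial.eval (fun i => x i) P

/-- `‖f - P‖_{L¹(Q, dx/|Q|)}`. -/
def meanDev {d : ℕ} (f : Euc d → ℝ) (P : MvPolynomial (Fin d) ℝ) (Q : AxisCube d) : ℝ≥0∞ :=
  (volume Q.carrier)⁻¹ * ∫⁻ x in Q.carrier, ‖f x - polyVal P x‖ₑ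

/-- `inf_P ω(ℓ)⁻¹ ‖f - P‖_{L¹(Q, dx/|Q|)}` over the polynomials `P` of degree at most `n`. -/
def cubeOsc {d : ℕ} (ω : ℝ → ℝ) (n : ℕ) (f : Euc d → ℝ) (Q : AxisCube d) : ℝ≥0∞ :=
  ⨅ (P : MvPolynomial (Fin d) ℝ) (_ : P.totalDegree ≤ n),
    (ENNReal.ofReal (ω Q.side))⁻¹ * meanDev f P Q

/-- The Campanato type seminorm `‖f‖_{ω,D}`: supremum over all cubes `Q ⊆ D`. -/
def zygSeminorm {d : ℕ} (ω : ℝ → ℝ) (n : ℕ) (D : Set (Euc d)) (f : Euc d → ℝ) : ℝ≥0∞ :=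
  ⨆ (Q : AxisCube d) (_ : Q.carrier ⊆ D), cubeOsc ω n f Q

/-- The interior seminorm `‖f‖^int_{ω,D}`: supremum over all cubes `Q` with `2Q ⊆ D`. -/
def zygIntSeminorm {d : ℕ} (ω : ℝ → ℝ) (n : ℕ) (D : Set (Euc d)) (f : Euc d → ℝ) : ℝ≥0∞ :=
  ⨆ (Q : AxisCube d) (_ : (Q.scale 2 two_pos).carrier ⊆ D), cubeOsc ω n f Q

/-- `f ∈ C_ω(D)`. -/
def MemZyg {d : ℕ} (ω : ℝ → ℝ) (n : ℕ) (D : Set (Euc d)) (f : Euc d → ℝ) : Prop :=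
  LocallyIntegrableOn f D ∧ zygSeminorm ω n D f < ∞

/-- `f ∈ C^int_ω(D)`. -/
def MemZygInt {d : ℕ} (ω : ℝ → ℝ) (n : ℕ) (D : Set (Euc d)) (f : Euc d → ℝ) : Prop :=
  LocallyIntegrableOn f D ∧ zygIntSeminorm ω n D f < ∞

/-- `P` is a polynomial of near best approximation, with constant `C₀`, for `f ∈ C^int_ω(D)` on
the cube `Q`. -/
def IsNearBest {d : ℕ} (ω : ℝ → ℝ) (n : ℕ) (D : Set (Euc d)) (C₀ : ℝ≥0) (f : Euc d → ℝ)
    (Q : AxisCube d) (P : MvPolynomial (Fin d) ℝ) : Prop :=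
  P.totalDegree ≤ n ∧
    meanDev f P Q ≤ C₀ * ENNReal.ofReal (ω Q.side) * zygIntSeminorm ω n D f

/-- Whitney coverings of `G` (used for a Lipschitz domain `D` and for `ℝ^d \ closure D`). -/
structure IsWhitneyCovering {d : ℕ} (G : Set (Euc d)) (W : Set (AxisCube d)) : Prop where
  dyadic : ∀ Q ∈ W, Q.IsDyadic
  disjoint : W.PairwiseDisjoint AxisCube.carrier
  covers : ⋃ Q ∈ W, Q.carrier = G
  diam_le : ∀ Q ∈ W, Metric.ediam Q.carrier ≤ setEDist Q.carrier (frontier G)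
  le_diam : ∀ Q ∈ W, setEDist Q.carrier (frontier G) ≤ 4 * Metric.ediam Q.carrier
  neighbor : ∀ Q ∈ W, ∀ S ∈ W, (closure Q.carrier ∩ closure S.carrier).Nonempty →
    Q.side ≤ 4 * S.side
  overlap : ∃ N : ℕ, ∀ x ∈ G,
    {Q ∈ W | x ∈ (Q.scale (6 / 5) (by norm_num)).carrier}.encard ≤ N

/-- Smooth partitions of unity associated with a Whitney covering `W` of `G`. -/
structure IsWhitneyPartition {d : ℕ} (G : Set (Euc d)) (W : Set (AxisCube d))
    (ψ : AxisCube d → Euc d → ℝ) : Prop where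
  smooth : ∀ Q ∈ W, ContDiff ℝ ((⊤ : ℕ∞) : WithTop ℕ∞) (ψ Q)
  lower : ∀ Q ∈ W, ∀ x,
    (Q.scale (4 / 5) (by norm_num)).carrier.indicator (fun _ => (1 : ℝ)) x ≤ ψ Q x
  upper : ∀ Q ∈ W, ∀ x,
    ψ Q x ≤ (Q.scale (5 / 4) (by norm_num)).carrier.indicator (fun _ => (1 : ℝ)) x
  sum_eq : ∀ x, ∑ᶠ Q ∈ W, ψ Q x = G.indicator (fun _ => (1 : ℝ)) x
  deriv_le : ∀ k : ℕ, ∃ C : ℝ, ∀ Q ∈ W, ∀ x, ‖iteratedFDeriv ℝ k (ψ Q) x‖ ≤ C / Q.side ^ k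

/-- `S ∈ W` is admissible for reflecting `Q`: `dist(Q, S) ≤ 2 dist(Q, ∂D)`. -/
def IsReflCandidate {d : ℕ} (D : Set (Euc d)) (W : Set (AxisCube d)) (Q S : AxisCube d) : Prop :=
  S ∈ W ∧ setEDist Q.carrier S.carrier ≤ 2 * setEDist Q.carrier (frontier D)

/-- `S` is reflective to `Q`: an admissible cube of maximal size. -/
def IsReflective {d : ℕ} (D : Set (Euc d)) (W : Set (AxisCube d)) (Q S : AxisCube d) : Prop :=
  IsReflCandidate D W Q S ∧ ∀ T, IsReflCandidate D W Q T → T.side ≤ S.side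

/-- The extension `f χ_D + ∑ ψ_Q P_{Q~}` over the cubes `Q ∈ W'` with `ℓ(Q) ≤ R`, where
`refl Q` is the cube `Q~` and `P S` the polynomial attached to the cube `S`. -/
def whitneyExt {d : ℕ} (D : Set (Euc d)) (R : ℝ) (W' : Set (AxisCube d))
    (ψ : AxisCube d → Euc d → ℝ) (refl : AxisCube d → AxisCube d)
    (P : AxisCube d → MvPolynomial (Fin d) ℝ) (f : Euc d → ℝ) (x : Euc d) : ℝ :=
  D.indicator f x + ∑ᶠ Q ∈ {Q ∈ W' | Q.side ≤ R}, ψ Q x * polyVal (P (refl Q)) x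

end

/-! The point is that near the boundary the extension looks like one polynomial at each scale. At a
boundary point `a` the Lipschitz condition provides a cone in `D` with vertex `a`, hence a cube of
size comparable to `h` at height `h` on its axis, well inside `D`. Let `p` be a near best polynomial
on this vertex cube. A Whitney cube of `D` much closer to `a` is joined to the vertex cube by a
chain of overlapping cubes whose sizes grow geometrically along the cone. Neighbouring near best
polynomials differ by a multiple of `ω` at the current size. Since `ω` is dominated by a positive
power when going down in scale, these errors sum to `O(ω h)` (`ModulusBounds.exists_sum_le`,
`exists_chain_bound`). Reflective cubes have size and distance comparable to the original ones
(`IsReflective.upper_bounds`, `IsReflective.lower_bound`), so `p` is close both to `f` in `D` near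
`a`, in mean, and to all polynomials used by the extension near `a`
(`ExtensionSetup.exists_local_poly`).

The seminorm is then bounded case by case. On a small cube whose distance to the boundary is
comparable to its side or less, `p` itself approximates (`exists_near_approx`). On a small exterior
cube of side `ℓ` at a larger distance `ρ` from the boundary, the extension minus `p` is a bounded
sum of cut-offs at scale `ρ` times polynomials of size `O(ω ρ)`. Taylor expansion to degree `n`
leaves an error `(ℓ/ρ)^(n+1) ω(ρ)`, which the growth bound of `ω` turns into `O(ω ℓ)`
(`exists_far_approx`). Small cubes deep in `D` see only `f`. Large cubes, and cut-offs at a fixed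
distance from `D`, are controlled through the `L¹` norm. -/

section EuclideanCoordinates

variable {d : ℕ}

lemma Euc.abs_apply_le_norm (v : Euc d) (i : Fin d) : |v i| ≤ ‖v‖ := by
  simpa using PiLp.norm_apply_le v i

lemma Euc.norm_le_of_abs_le {v : Euc d} {r : ℝ} (hr : 0 ≤ r) (h : ∀ i, |v i| ≤ r) :
    ‖v‖ ≤ d * r := by
  rw [EuclideanSpace.norm_eq]
  apply Real.sqrt_le_iff.mpr
  refine ⟨by positivity, ?_⟩
  calc ∑ i, ‖v i‖ ^ 2 ≤ ∑ _i : Fin d, r ^ 2 := by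
        apply Finset.sum_le_sum
        intro i _
        exact pow_le_pow_left₀ (norm_nonneg _) (h i) 2
    _ = d * r ^ 2 := by simp
    _ ≤ (d * r) ^ 2 := by
        rw [mul_pow]
        apply mul_le_mul_of_nonneg_right _ (by positivity)
        rcases Nat.eq_zero_or_pos d with h0 | h0
        · simp [h0]
        · have : (1 : ℝ) ≤ d := by exact_mod_cast h0
          nlinarith

end EuclideanCoordinates

/-! ### Axis-parallel cubes: volume and inclusions. -/

namespace AxisCube

variable {d : ℕ}

lemma center_mem (Q : AxisCube d) : Q.center ∈ Q.carrier := by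
  intro i
  have := Q.side_pos
  constructor <;> linarith

lemma abs_sub_center_le {Q : AxisCube d} {x : Euc d} (hx : x ∈ Q.carrier) (i : Fin d) :
    |(x - Q.center) i| ≤ Q.side / 2 := by
  have := hx i
  rw [abs_le]
  simp only [PiLp.sub_apply]
  constructor <;> linarith

lemma norm_sub_center_le {Q : AxisCube d} {x : Euc d} (hx : x ∈ Q.carrier) :
    ‖x - Q.center‖ ≤ d * (Q.side / 2) :=
  Euc.norm_le_of_abs_le (by linarith [Q.side_pos]) (abs_sub_center_le hx)

lemma mem_carrier_of_norm_lt {Q : AxisCube d} {x : Euc d} (hx : ‖x - Q.center‖ < Q.side / 2) :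
    x ∈ Q.carrier := by
  intro i
  have := (Euc.abs_apply_le_norm (x - Q.center) i).trans_lt hx
  rw [abs_lt] at this
  simp only [PiLp.sub_apply] at this
  constructor <;> linarith

lemma carrier_eq_preimage (Q : AxisCube d) :
    Q.carrier = (WithLp.ofLp : Euc d → Fin d → ℝ) ⁻¹' (Set.pi univ
      (fun i => Ico (Q.center i - Q.side / 2) (Q.center i + Q.side / 2))) := by
  ext x
  simp [carrier, Set.mem_pi]

lemma measurableSet_carrier (Q : AxisCube d) : MeasurableSet Q.carrier := by
  rw [carrier_eq_preimage]
  exact (PiLp.volume_preserving_ofLp (Fin d)).measurable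
    (MeasurableSet.pi countable_univ fun i _ => measurableSet_Ico)

lemma volume_carrier (Q : AxisCube d) : volume Q.carrier = ENNReal.ofReal (Q.side ^ d) := by
  rw [carrier_eq_preimage, (PiLp.volume_preserving_ofLp (Fin d)).measure_preimage
    (MeasurableSet.pi countable_univ fun i _ => measurableSet_Ico).nullMeasurableSet,
    Real.volume_pi_Ico]
  have : ∀ i : Fin d, Q.center i + Q.side / 2 - (Q.center i - Q.side / 2) = Q.side :=
    fun i => by ring
  simp only [this]
  rw [Finset.prod_const, Finset.card_univ, Fintype.card_fin, ENNReal.ofReal_pow Q.side_pos.le]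

lemma volume_carrier_ne_zero (Q : AxisCube d) : volume Q.carrier ≠ 0 := by
  rw [volume_carrier]
  simpa using pow_pos Q.side_pos d

lemma volume_carrier_ne_top (Q : AxisCube d) : volume Q.carrier ≠ ∞ := by
  rw [volume_carrier]
  simp

lemma isBounded_carrier (Q : AxisCube d) : Bornology.IsBounded Q.carrier := by
  refine (Metric.isBounded_closedBall (x := Q.center) (r := d * (Q.side / 2))).subset ?_
  intro x hx
  rw [Metric.mem_closedBall, dist_eq_norm]
  exact norm_sub_center_le hx

lemma carrier_subset_of_abs_le {E Q : AxisCube d}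
    (h : ∀ i, |E.center i - Q.center i| + E.side / 2 ≤ Q.side / 2) : E.carrier ⊆ Q.carrier := by
  intro x hx i
  have h1 := hx i
  have h2 := h i
  have h3 := abs_le.mp (le_refl |E.center i - Q.center i|)
  constructor <;> linarith

lemma carrier_subset_of_norm_le {E Q : AxisCube d}
    (h : ‖E.center - Q.center‖ + E.side / 2 ≤ Q.side / 2) : E.carrier ⊆ Q.carrier := by
  apply carrier_subset_of_abs_le
  intro i
  have := Euc.abs_apply_le_norm (E.center - Q.center) i
  simp only [PiLp.sub_apply] at this
  linarith

end AxisCube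

/-! ### Polynomials as functions: algebra, growth, affine substitution. -/

section PolyVal

variable {d : ℕ}

lemma polyVal_sub (P Q : MvPolynomial (Fin d) ℝ) (x : Euc d) :
    polyVal (P - Q) x = polyVal P x - polyVal Q x := by simp [polyVal]

lemma polyVal_zero (x : Euc d) : polyVal 0 x = 0 := by simp [polyVal]

lemma polyVal_add (P Q : MvPolynomial (Fin d) ℝ) (x : Euc d) :
    polyVal (P + Q) x = polyVal P x + polyVal Q x := by simp [polyVal]

lemma polyVal_smul (c : ℝ) (P : MvPolynomial (Fin d) ℝ) (x : Euc d) :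
    polyVal (c • P) x = c * polyVal P x := by simp [polyVal]

lemma polyVal_sum {ι : Type*} (s : Finset ι) (P : ι → MvPolynomial (Fin d) ℝ) (x : Euc d) :
    polyVal (∑ i ∈ s, P i) x = ∑ i ∈ s, polyVal (P i) x := by simp [polyVal]

lemma contDiff_polyVal (P : MvPolynomial (Fin d) ℝ) {m : WithTop ℕ∞} :
    ContDiff ℝ m (polyVal P) := by
  unfold polyVal
  simp only [MvPolynomial.eval_eq]
  fun_prop

lemma continuous_polyVal (P : MvPolynomial (Fin d) ℝ) : Continuous (polyVal P) :=
  (contDiff_polyVal P (m := 0)).continuous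

lemma totalDegree_sub_le_of_le {P Q : MvPolynomial (Fin d) ℝ} {n : ℕ} (hP : P.totalDegree ≤ n)
    (hQ : Q.totalDegree ≤ n) : (P - Q).totalDegree ≤ n :=
  (MvPolynomial.totalDegree_sub P Q).trans (max_le hP hQ)

/-- A polynomial of degree at most `n` grows at most like `(1 + ‖y‖) ^ n`. -/
lemma exists_polyVal_growth {n : ℕ} (P : MvPolynomial (Fin d) ℝ) (hP : P.totalDegree ≤ n) :
    ∃ C : ℝ, 0 ≤ C ∧ ∀ y : Euc d, |polyVal P y| ≤ C * (1 + ‖y‖) ^ n := by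
  refine ⟨∑ m ∈ P.support, |P.coeff m|, Finset.sum_nonneg fun _ _ => abs_nonneg _, fun y => ?_⟩
  unfold polyVal
  rw [MvPolynomial.eval_eq, Finset.sum_mul]
  refine (Finset.abs_sum_le_sum_abs _ _).trans (Finset.sum_le_sum fun m hm => ?_)
  rw [abs_mul, Finset.abs_prod]
  refine mul_le_mul_of_nonneg_left ?_ (abs_nonneg _)
  calc ∏ i ∈ m.support, |y i ^ m i| ≤ ∏ i ∈ m.support, (1 + ‖y‖) ^ m i := by
        refine Finset.prod_le_prod (fun _ _ => abs_nonneg _) fun i _ => ?_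
        rw [abs_pow]
        exact pow_le_pow_left₀ (abs_nonneg _)
          ((Euc.abs_apply_le_norm y i).trans (by linarith)) _
    _ = (1 + ‖y‖) ^ (m.sum fun _ e => e) := by
        rw [Finset.prod_pow_eq_pow_sum]
        rfl
    _ ≤ (1 + ‖y‖) ^ n := pow_le_pow_right₀ (by linarith [norm_nonneg y])
        ((MvPolynomial.le_totalDegree hm).trans hP)

/-- Composition with an affine map does not raise the degree. -/
lemma exists_poly_comp_affine {n : ℕ} (P : MvPolynomial (Fin d) ℝ) (hP : P.totalDegree ≤ n)
    (z : Euc d) (h : ℝ) :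
    ∃ P' : MvPolynomial (Fin d) ℝ, P'.totalDegree ≤ n ∧
      ∀ y, polyVal P' y = polyVal P (z + h • y) := by
  refine ⟨MvPolynomial.bind₁
    (fun i => MvPolynomial.C (z i) + h • MvPolynomial.X i) P, ?_, fun y => ?_⟩
  · conv_lhs => rw [MvPolynomial.as_sum P, map_sum]
    apply MvPolynomial.totalDegree_finsetSum_le
    intro m hm
    rw [MvPolynomial.bind₁_monomial]
    refine (MvPolynomial.totalDegree_mul _ _).trans ?_
    rw [MvPolynomial.totalDegree_C, zero_add]
    refine (MvPolynomial.totalDegree_finsetProd _ _).trans ?_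
    refine le_trans ?_ ((MvPolynomial.le_totalDegree hm).trans hP)
    refine Finset.sum_le_sum fun i _ => ?_
    refine (MvPolynomial.totalDegree_pow _ _).trans ?_
    refine (Nat.mul_le_mul_left _ (?_ : _ ≤ 1)).trans (by simp)
    refine (MvPolynomial.totalDegree_add _ _).trans (max_le (by simp) ?_)
    exact (MvPolynomial.totalDegree_smul_le _ _).trans (by simp)
  · unfold polyVal
    rw [← MvPolynomial.coe_aeval_eq_eval, RingHom.coe_coe, MvPolynomial.aeval_bind₁,
      ← MvPolynomial.coe_aeval_eq_eval, RingHom.coe_coe]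
    congr 1
    ext i
    simp

end PolyVal

/-! ### Equivalence of norms on polynomials of bounded degree. -/

section PolynomialNorms

variable {d : ℕ}

/-- The cube `[-1/2, 1/2)^d`. -/
def unitCube (d : ℕ) : AxisCube d := ⟨0, 1, one_pos⟩

/-- Change of variables that normalizes any cube to the unit cube. Dilation and translation are
homeomorphisms, so `F` need not be measurable. -/
lemma lintegral_unitCube_comp_affine (Q : AxisCube d) (F : Euc d → ℝ≥0∞) :
    ∫⁻ y in (unitCube d).carrier, F (Q.center + Q.side • y) =
      (volume Q.carrier)⁻¹ * ∫⁻ x in Q.carrier, F x := by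
  have hpos := Q.side_pos
  have hmem : ∀ y, y ∈ (unitCube d).carrier ↔ Q.center + Q.side • y ∈ Q.carrier := by
    intro y
    refine forall_congr' fun i => ?_
    simp only [unitCube, PiLp.zero_apply, PiLp.add_apply, PiLp.smul_apply, smul_eq_mul]
    constructor
    · rintro ⟨h1, h2⟩
      constructor <;> nlinarith
    · rintro ⟨h1, h2⟩
      constructor
      · by_contra! h
        nlinarith
      · by_contra! h
        nlinarith
  rw [← lintegral_indicator (unitCube d).measurableSet_carrier,
    ← lintegral_indicator Q.measurableSet_carrier]
  have heq : (fun y => (unitCube d).carrier.indicator (fun y => F (Q.center + Q.side • y)) y) =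
      fun y => (fun x => Q.carrier.indicator F (Q.center + x)) (Q.side • y) := by
    ext y
    by_cases hy : y ∈ (unitCube d).carrier
    · simp [hy, (hmem y).1 hy]
    · simp only [indicator_of_notMem hy, indicator_of_notMem (mt (hmem y).2 hy)]
  rw [heq]
  have hemb : MeasurableEmbedding (fun y : Euc d => Q.side • y) :=
    (Homeomorph.smulOfNeZero Q.side hpos.ne').measurableEmbedding
  rw [← hemb.lintegral_map (μ := volume) (fun x => Q.carrier.indicator F (Q.center + x)),
    Measure.map_addHaar_smul _ hpos.ne', lintegral_smul_measure,
    lintegral_add_left_eq_self (μ := (volume : Measure (Euc d)))]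
  rw [Q.volume_carrier, finrank_euclideanSpace_fin, abs_of_pos (by positivity), smul_eq_mul,
    ENNReal.ofReal_inv_of_pos (by positivity)]

/-- Polynomials of degree at most `n` have a finite basis in which the coordinates are controlled
by the mean on the unit cube. -/
lemma exists_poly_basis (d n : ℕ) :
    ∃ (m : ℕ) (b : Fin m → MvPolynomial (Fin d) ℝ) (C : ℝ), 0 ≤ C ∧
      (∀ k, (b k).totalDegree ≤ n) ∧
      ∀ P : MvPolynomial (Fin d) ℝ, P.totalDegree ≤ n → ∃ c : Fin m → ℝ,
        P = ∑ k, c k • b k ∧ ∀ k, ∀ B : ℝ, 0 ≤ B →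
          ∫⁻ x in (unitCube d).carrier, ‖polyVal P x‖ₑ ≤ ENNReal.ofReal B → |c k| ≤ C * B := by
  classical
  let V := MvPolynomial.restrictTotalDegree (Fin d) ℝ n
  let β := Module.finBasis ℝ V
  let μ : Measure (Euc d) := volume.restrict (unitCube d).carrier
  have hmem : ∀ P : MvPolynomial (Fin d) ℝ, MemLp (polyVal P) 1 μ := by
    intro P
    rw [memLp_one_iff_integrable]
    exact ((continuous_polyVal P).locallyIntegrable.integrableOn_isCompact
      (unitCube d).isBounded_carrier.isCompact_closure).mono_set subset_closure
  let L : (Fin (Module.finrank ℝ V) → ℝ) →ₗ[ℝ] Lp ℝ 1 μ :=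
    Fintype.linearCombination ℝ (fun k => (hmem (β k : MvPolynomial (Fin d) ℝ)).toLp)
  have hL : ∀ c, (L c : Euc d → ℝ) =ᵐ[μ]
      polyVal (∑ k, c k • (β k : MvPolynomial (Fin d) ℝ)) := by
    intro c
    have h1 : L c = (hmem (∑ k, c k • (β k : MvPolynomial (Fin d) ℝ))).toLp := by
      rw [show L c = ∑ k, c k • (hmem (β k : MvPolynomial (Fin d) ℝ)).toLp from
        Fintype.linearCombination_apply ..]
      have : ∀ s : Finset (Fin (Module.finrank ℝ V)),
          ∑ k ∈ s, c k • (hmem (β k : MvPolynomial (Fin d) ℝ)).toLp =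
          (hmem (∑ k ∈ s, c k • (β k : MvPolynomial (Fin d) ℝ))).toLp := by
        intro s
        induction s using Finset.induction_on with
        | empty =>
          have h0 : polyVal (0 : MvPolynomial (Fin d) ℝ) = (0 : Euc d → ℝ) := by
            ext x; exact polyVal_zero x
          simp only [Finset.sum_empty, h0]
          exact (MemLp.toLp_zero (by simp)).symm
        | insert a s ha ih =>
          rw [Finset.sum_insert ha, ih, ← MemLp.toLp_const_smul, ← MemLp.toLp_add]
          apply MemLp.toLp_congr
          refine Filter.Eventually.of_forall fun x => ?_
          simp only [Finset.sum_insert ha, Pi.add_apply, Pi.smul_apply, polyVal_add, polyVal_smul,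
            smul_eq_mul]
      exact this _
    rw [h1]
    exact MemLp.coeFn_toLp _
  -- A polynomial that vanishes almost everywhere on the cube vanishes on a ball by continuity,
  -- hence identically.
  have hinj : LinearMap.ker L = ⊥ := by
    rw [LinearMap.ker_eq_bot']
    intro c hc
    have h0 : polyVal (∑ k, c k • (β k : MvPolynomial (Fin d) ℝ)) =ᵐ[μ] fun _ => (0 : ℝ) := by
      refine (hL c).symm.trans ?_
      rw [hc]
      exact Lp.coeFn_zero ..
    have hball : Metric.ball (0 : Euc d) (1 / 2) ⊆ (unitCube d).carrier := by
      intro x hx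
      apply AxisCube.mem_carrier_of_norm_lt
      simpa [unitCube] using hx
    have h1 := Measure.eqOn_open_of_ae_eq (μ := (volume : Measure (Euc d)))
      (ae_restrict_of_ae_restrict_of_subset hball h0) Metric.isOpen_ball
      (continuous_polyVal _).continuousOn continuousOn_const
    -- Vanishing on a product of infinite sets forces a polynomial to be zero. The edge `1 / (2 (d +
    -- 1))` keeps the box inside the ball of radius `1 / 2`.
    have h2 : ∑ k, c k • (β k : MvPolynomial (Fin d) ℝ) = 0 := by
      apply MvPolynomial.funext_set (fun _ => Ioo (0 : ℝ) (1 / (2 * (d + 1))))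
        (fun _ => Ioo_infinite (by positivity))
      intro x hx
      have hx' : ∀ i, x i ∈ Ioo (0 : ℝ) (1 / (2 * (d + 1))) := fun i => hx i (mem_univ i)
      have hn : ‖(WithLp.toLp 2 x : Euc d)‖ ≤ d * (1 / (2 * (d + 1))) := by
        apply Euc.norm_le_of_abs_le (by positivity)
        intro i
        rw [abs_le]
        constructor
        · have := (hx' i).1
          have h3 : (0 : ℝ) < 1 / (2 * (d + 1)) := by positivity
          simp only
          linarith
        · exact (hx' i).2.le
      have := h1 (x := (WithLp.toLp 2 x : Euc d)) (by
        rw [mem_ball_zero_iff]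
        refine hn.trans_lt ?_
        rw [mul_one_div, div_lt_div_iff₀ (by positivity) (by positivity)]
        linarith)
      simpa [polyVal] using this
    have h3 : ∑ k, c k • β k = 0 := by
      apply Subtype.ext
      simpa using h2
    funext k
    exact Fintype.linearIndependent_iff.1 β.linearIndependent c h3 k
  -- An injective linear map on a finite-dimensional space is bounded below, so the coordinates are
  -- controlled by the `L¹` norm.
  obtain ⟨K, -, hK⟩ := L.exists_antilipschitzWith hinj
  refine ⟨_, fun k => (β k : MvPolynomial (Fin d) ℝ), K, K.2,
    fun k => (MvPolynomial.mem_restrictTotalDegree _ _ _).1 (β k).2, fun P hP => ?_⟩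
  let p : V := ⟨P, (MvPolynomial.mem_restrictTotalDegree _ _ _).2 hP⟩
  have hsum : P = ∑ k, (β.repr p) k • (β k : MvPolynomial (Fin d) ℝ) := by
    have h1 : P = ((∑ k, β.repr p k • β k : V) : MvPolynomial (Fin d) ℝ) := by
      rw [β.sum_repr]
    simpa only [Submodule.coe_sum, Submodule.coe_smul] using h1
  refine ⟨fun k => β.repr p k, hsum, fun k B hB hI => ?_⟩
  have h1 : ‖(fun k => β.repr p k)‖ ≤ K * ‖L (fun k => β.repr p k)‖ := by
    have := hK.le_mul_dist (fun k => β.repr p k) 0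
    simpa using this
  have h2 : ‖L (fun k => β.repr p k)‖ ≤ B := by
    rw [Lp.norm_def, eLpNorm_congr_ae (hL _), ← hsum, eLpNorm_one_eq_lintegral_enorm]
    exact ENNReal.toReal_le_of_le_ofReal hB hI
  calc |β.repr p k| ≤ ‖(fun k => β.repr p k)‖ := by
        simpa using norm_le_pi_norm (fun k => β.repr p k) k
    _ ≤ K * ‖L (fun k => β.repr p k)‖ := h1
    _ ≤ K * B := mul_le_mul_of_nonneg_left h2 K.2

/-- The values of a polynomial of degree at most `n` are controlled by its mean on a cube. -/
lemma exists_polyVal_le_mean (d n : ℕ) :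
    ∃ C : ℝ, 0 < C ∧ ∀ P : MvPolynomial (Fin d) ℝ, P.totalDegree ≤ n → ∀ (Q : AxisCube d) (B : ℝ),
      0 ≤ B → (volume Q.carrier)⁻¹ * ∫⁻ x in Q.carrier, ‖polyVal P x‖ₑ ≤ ENNReal.ofReal B →
      ∀ x, |polyVal P x| ≤ C * B * (1 + ‖x - Q.center‖ / Q.side) ^ n := by
  obtain ⟨m, b, C, hC, hb, h⟩ := exists_poly_basis d n
  choose G hG0 hG using fun k => exists_polyVal_growth (b k) (hb k)
  have hS : 0 ≤ ∑ k, G k := Finset.sum_nonneg fun k _ => hG0 k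
  -- The summand `1` only makes the constant strictly positive.
  refine ⟨C * (∑ k, G k) + 1, by positivity, fun P hP Q B hB hI x => ?_⟩
  obtain ⟨P', hP', hval⟩ := exists_poly_comp_affine P hP Q.center Q.side
  obtain ⟨c, hc, hcb⟩ := h P' hP'
  have hI' : ∫⁻ y in (unitCube d).carrier, ‖polyVal P' y‖ₑ ≤ ENNReal.ofReal B := by
    simp only [hval]
    rw [lintegral_unitCube_comp_affine Q (fun x => ‖polyVal P x‖ₑ)]
    exact hI
  have hs := Q.side_pos
  set y : Euc d := Q.side⁻¹ • (x - Q.center) with hy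
  have hxy : x = Q.center + Q.side • y := by
    rw [hy, smul_smul, mul_inv_cancel₀ hs.ne', one_smul, add_sub_cancel]
  have hny : ‖y‖ = ‖x - Q.center‖ / Q.side := by
    rw [hy, norm_smul, norm_inv, Real.norm_of_nonneg hs.le]
    ring
  rw [← hny]
  calc |polyVal P x| = |∑ k, c k * polyVal (b k) y| := by
        rw [hxy, ← hval, hc, polyVal_sum]
        simp only [polyVal_smul]
    _ ≤ ∑ k, |c k| * |polyVal (b k) y| := by
        refine (Finset.abs_sum_le_sum_abs _ _).trans_eq ?_
        simp only [abs_mul]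
    _ ≤ ∑ k, (C * B) * (G k * (1 + ‖y‖) ^ n) := by
        refine Finset.sum_le_sum fun k _ => ?_
        exact mul_le_mul (hcb k B hB hI') (hG k y) (abs_nonneg _) (by positivity)
    _ = C * (∑ k, G k) * B * (1 + ‖y‖) ^ n := by
        rw [Finset.mul_sum, Finset.sum_mul, Finset.sum_mul]
        exact Finset.sum_congr rfl fun k _ => by ring
    _ ≤ (C * (∑ k, G k) + 1) * B * (1 + ‖y‖) ^ n := by
        have : 0 ≤ B * (1 + ‖y‖) ^ n := by positivity
        nlinarith

end PolynomialNorms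

/-! ### Taylor approximation of cut-offs times polynomials. -/

section TaylorPolynomials

variable {d : ℕ}

/-- A homogeneous polynomial attached to a multilinear map. -/
lemma exists_poly_diagonal {k : ℕ} (A : ContinuousMultilinearMap ℝ (fun _ : Fin k => Euc d) ℝ) :
    ∃ P : MvPolynomial (Fin d) ℝ, P.totalDegree ≤ k ∧ ∀ y, polyVal P y = A (fun _ => y) := by
  classical
  refine ⟨∑ r : Fin k → Fin d, MvPolynomial.C (A fun j => EuclideanSpace.single (r j) 1) *
    ∏ j, MvPolynomial.X (r j), ?_, fun y => ?_⟩
  · apply MvPolynomial.totalDegree_finsetSum_le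
    intro r _
    refine (MvPolynomial.totalDegree_mul _ _).trans ?_
    rw [MvPolynomial.totalDegree_C, zero_add]
    refine (MvPolynomial.totalDegree_finsetProd _ _).trans ?_
    simp
  · have hy : y = ∑ i, y i • (EuclideanSpace.single i (1 : ℝ) : Euc d) := by
      ext j
      simp [Pi.single_apply]
    conv_rhs => rw [hy]
    rw [ContinuousMultilinearMap.map_sum]
    simp only [ContinuousMultilinearMap.map_smul_univ, smul_eq_mul]
    simp [polyVal, mul_comm]

/-- Taylor's formula at the origin with integral remainder. The factors `1 / n!` and `(1 - t) ^ n`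
are both estimated by `1`, since the sharp constant plays no role. -/
lemma exists_taylor_poly {n : ℕ} {φ : Euc d → ℝ} (hφ : ContDiff ℝ ((⊤ : ℕ∞) : WithTop ℕ∞) φ)
    {B : ℝ} (hB : ∀ y, ‖y‖ ≤ 1 → ‖iteratedFDeriv ℝ (n + 1) φ y‖ ≤ B) :
    ∃ P : MvPolynomial (Fin d) ℝ, P.totalDegree ≤ n ∧
      ∀ y, ‖y‖ ≤ 1 → |φ y - polyVal P y| ≤ B * ‖y‖ ^ (n + 1) := by
  have hB0 : 0 ≤ B := (norm_nonneg _).trans (hB 0 (by simp))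
  choose p hp hpv using fun k => exists_poly_diagonal (iteratedFDeriv ℝ k φ 0)
  refine ⟨∑ k ∈ Finset.range (n + 1), (k.factorial : ℝ)⁻¹ • p k, ?_, fun y hy => ?_⟩
  · apply MvPolynomial.totalDegree_finsetSum_le
    intro k hk
    refine (MvPolynomial.totalDegree_smul_le _ _).trans ((hp k).trans ?_)
    have := Finset.mem_range.1 hk
    omega
  · have hT := map_add_eq_sum_add_integral_iteratedFDeriv (f := φ) (x := 0) (y := y) (n := n)
      (fun t _ => (hφ.of_le (by exact_mod_cast le_top)).contDiffAt)
    rw [zero_add] at hT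
    rw [hT, polyVal_sum]
    simp only [polyVal_smul, hpv, smul_eq_mul, add_sub_cancel_left, zero_add]
    rw [abs_mul]
    have h1 : |((n.factorial : ℝ))⁻¹| ≤ 1 := by
      rw [abs_of_nonneg (by positivity)]
      apply inv_le_one_of_one_le₀
      exact_mod_cast Nat.factorial_pos n
    have h2 : |∫ t in (0 : ℝ)..1, (1 - t) ^ n * iteratedFDeriv ℝ (n + 1) φ (t • y) fun _ => y| ≤
        B * ‖y‖ ^ (n + 1) := by
      have := intervalIntegral.norm_integral_le_of_norm_le_const (a := (0 : ℝ)) (b := 1)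
        (f := fun t => (1 - t) ^ n * iteratedFDeriv ℝ (n + 1) φ (t • y) fun _ => y)
        (C := B * ‖y‖ ^ (n + 1)) (fun t ht => by
          rw [uIoc_of_le zero_le_one] at ht
          rw [norm_mul]
          have h3 : ‖(1 - t) ^ n‖ ≤ 1 := by
            rw [norm_pow, Real.norm_of_nonneg (by linarith [ht.2])]
            exact pow_le_one₀ (by linarith [ht.2]) (by linarith [ht.1])
          have h4 : ‖iteratedFDeriv ℝ (n + 1) φ (t • y) fun _ => y‖ ≤ B * ‖y‖ ^ (n + 1) := by
            refine (ContinuousMultilinearMap.le_opNorm _ _).trans ?_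
            rw [Finset.prod_const, Finset.card_univ, Fintype.card_fin]
            refine mul_le_mul_of_nonneg_right (hB _ ?_) (by positivity)
            rw [norm_smul, Real.norm_of_nonneg ht.1.le]
            exact mul_le_one₀ ht.2 (norm_nonneg _) hy
          calc _ ≤ 1 * (B * ‖y‖ ^ (n + 1)) := mul_le_mul h3 h4 (norm_nonneg _) zero_le_one
            _ = _ := one_mul _)
      simpa using this
    calc _ ≤ 1 * (B * ‖y‖ ^ (n + 1)) := mul_le_mul h1 h2 (abs_nonneg _) zero_le_one
      _ = _ := one_mul _

/-- On the unit ball the derivatives of a polynomial of degree at most `n` are controlled by its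
values on the unit cube. -/
lemma exists_norm_iteratedFDeriv_polyVal_le (d n : ℕ) :
    ∃ C : ℝ, 0 ≤ C ∧ ∀ P : MvPolynomial (Fin d) ℝ, P.totalDegree ≤ n → ∀ B : ℝ,
      (∀ y ∈ (unitCube d).carrier, |polyVal P y| ≤ B) →
      ∀ j ≤ n + 1, ∀ y, ‖y‖ ≤ 1 → ‖iteratedFDeriv ℝ j (polyVal P) y‖ ≤ C * B := by
  obtain ⟨m, b, C, hC, hb, h⟩ := exists_poly_basis d n
  have hcpt : ∀ k j, ∃ G : ℝ, 0 ≤ G ∧ ∀ y : Euc d, ‖y‖ ≤ 1 →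
      ‖iteratedFDeriv ℝ j (polyVal (b k)) y‖ ≤ G := by
    intro k j
    have hcont : Continuous (iteratedFDeriv ℝ j (polyVal (b k))) :=
      (contDiff_polyVal (b k) (m := ((⊤ : ℕ∞) : WithTop ℕ∞))).continuous_iteratedFDeriv
        (by exact_mod_cast le_top)
    obtain ⟨G, hG⟩ := (isCompact_closedBall (0 : Euc d) 1).exists_bound_of_continuousOn
      hcont.continuousOn
    exact ⟨max G 0, le_max_right _ _, fun y hy =>
      (hG y (by simpa using hy)).trans (le_max_left _ _)⟩
  choose G hG0 hG using hcpt
  refine ⟨C * ∑ k, ∑ j ∈ Finset.range (n + 2), G k j, by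
    have : 0 ≤ ∑ k, ∑ j ∈ Finset.range (n + 2), G k j :=
      Finset.sum_nonneg fun k _ => Finset.sum_nonneg fun j _ => hG0 k j
    positivity, fun P hP B hPB j hj y hy => ?_⟩
  have hB : 0 ≤ B := (abs_nonneg _).trans (hPB _ (unitCube d).center_mem)
  obtain ⟨c, hc, hcb⟩ := h P hP
  have hI : ∫⁻ y in (unitCube d).carrier, ‖polyVal P y‖ₑ ≤ ENNReal.ofReal B := by
    calc ∫⁻ y in (unitCube d).carrier, ‖polyVal P y‖ₑ
        ≤ ∫⁻ _ in (unitCube d).carrier, ENNReal.ofReal B := by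
          refine setLIntegral_mono measurable_const fun y hy => ?_
          rw [Real.enorm_eq_ofReal_abs]
          exact ENNReal.ofReal_le_ofReal (hPB y hy)
      _ = ENNReal.ofReal B := by
          rw [setLIntegral_const, AxisCube.volume_carrier]
          simp [unitCube]
  have hfun : polyVal P = fun x => ∑ k, c k • polyVal (b k) x := by
    ext x
    rw [hc, polyVal_sum]
    simp [polyVal_smul]
  rw [hfun]
  have hs : iteratedFDeriv ℝ j (fun x => ∑ k, c k • polyVal (b k) x) y =
      ∑ k, c k • iteratedFDeriv ℝ j (polyVal (b k)) y := by
    rw [iteratedFDeriv_fun_sum_apply (f := fun k x => c k • polyVal (b k) x) fun k _ =>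
      (contDiff_const.mul (contDiff_polyVal (b k))).contDiffAt]
    refine Finset.sum_congr rfl fun k _ => ?_
    exact iteratedFDeriv_const_smul_apply (𝕜 := ℝ) (a := c k) (f := polyVal (b k))
      (contDiff_polyVal (b k)).contDiffAt
  rw [hs]
  calc ‖∑ k, c k • iteratedFDeriv ℝ j (polyVal (b k)) y‖
      ≤ ∑ k, |c k| * ‖iteratedFDeriv ℝ j (polyVal (b k)) y‖ := by
        refine (norm_sum_le _ _).trans_eq ?_
        simp only [norm_smul, Real.norm_eq_abs]
    _ ≤ ∑ k, (C * B) * ∑ j ∈ Finset.range (n + 2), G k j := by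
        refine Finset.sum_le_sum fun k _ => ?_
        refine mul_le_mul (hcb k B hB hI) ((hG k j y hy).trans ?_) (norm_nonneg _) (by positivity)
        exact Finset.single_le_sum (f := fun j => G k j) (fun j _ => hG0 k j)
          (Finset.mem_range.2 (by omega))
    _ = C * (∑ k, ∑ j ∈ Finset.range (n + 2), G k j) * B := by
        rw [← Finset.mul_sum]
        ring

/-- Approximation by polynomials of degree at most `n` of the product of a cut-off function living
at scale `ρ` and a polynomial of degree at most `n`. -/
lemma exists_poly_approx_cutoff_mul (d n : ℕ) :
    ∃ C : ℝ, 0 ≤ C ∧ ∀ (A B ρ : ℝ) (hρ : 0 < ρ) (x₀ : Euc d) (ψ : Euc d → ℝ)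
      (g : MvPolynomial (Fin d) ℝ), ContDiff ℝ ((⊤ : ℕ∞) : WithTop ℕ∞) ψ →
      (∀ k ≤ n + 1, ∀ x, ‖iteratedFDeriv ℝ k ψ x‖ ≤ A / ρ ^ k) → g.totalDegree ≤ n →
      (∀ x ∈ (AxisCube.mk x₀ ρ hρ).carrier, |polyVal g x| ≤ B) →
      ∃ P : MvPolynomial (Fin d) ℝ, P.totalDegree ≤ n ∧ ∀ x, ‖x - x₀‖ ≤ ρ →
        |ψ x * polyVal g x - polyVal P x| ≤ C * A * B * (‖x - x₀‖ / ρ) ^ (n + 1) := by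
  obtain ⟨C, hC, h⟩ := exists_norm_iteratedFDeriv_polyVal_le d n
  -- After rescaling to `ρ = 1`, Leibniz' rule bounds the derivative of order `n + 1` of the
  -- product. The power of two is the sum of the binomial coefficients.
  refine ⟨2 ^ (n + 1) * C, by positivity, fun A B ρ hρ x₀ ψ g hψ hA hg hB => ?_⟩
  obtain ⟨g', hg', hgv⟩ := exists_poly_comp_affine g hg x₀ ρ
  have hA0 : 0 ≤ A := by
    have := (norm_nonneg _).trans (hA 0 (by omega) 0)
    simpa using this
  have hB0 : 0 ≤ B := (abs_nonneg _).trans (hB _ (AxisCube.center_mem _))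
  have hD := h g' hg' B (fun y hy => by
    rw [hgv]
    apply hB
    intro i
    have := hy i
    simp only [unitCube, PiLp.zero_apply] at this
    simp only [PiLp.add_apply, PiLp.smul_apply, smul_eq_mul]
    constructor <;> nlinarith)
  set χ : Euc d → ℝ := fun y => ψ (x₀ + ρ • y) with hχ
  have hχs : ContDiff ℝ ((⊤ : ℕ∞) : WithTop ℕ∞) χ := by
    rw [hχ]
    fun_prop
  have hχb : ∀ k ≤ n + 1, ∀ y, ‖iteratedFDeriv ℝ k χ y‖ ≤ A := by
    intro k hk y
    have h1 : iteratedFDeriv ℝ k χ y =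
        ρ ^ k • iteratedFDeriv ℝ k (fun z => ψ (x₀ + z)) (ρ • y) := by
      have := congrFun (iteratedFDeriv_comp_const_smul (i := k) (f := fun z => ψ (x₀ + z)) ρ
        ((hψ.comp (contDiff_const.add contDiff_id)).of_le (by exact_mod_cast le_top))) y
      simpa using this
    rw [h1, iteratedFDeriv_comp_add_left, norm_smul, norm_pow, Real.norm_of_nonneg hρ.le]
    calc ρ ^ k * ‖iteratedFDeriv ℝ k ψ (x₀ + ρ • y)‖ ≤ ρ ^ k * (A / ρ ^ k) :=
          mul_le_mul_of_nonneg_left (hA k hk _) (by positivity)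
      _ = A := by field_simp
  obtain ⟨P, hP, hPv⟩ := exists_taylor_poly (n := n) (φ := fun y => χ y * polyVal g' y)
    (hχs.mul (contDiff_polyVal g')) (B := 2 ^ (n + 1) * C * A * B) (fun y hy => by
      refine (norm_iteratedFDeriv_mul_le (N := ((⊤ : ℕ∞) : WithTop ℕ∞)) hχs (contDiff_polyVal g') y
        (n := n + 1) (by exact_mod_cast le_top)).trans ?_
      calc ∑ i ∈ Finset.range (n + 1 + 1), ((n + 1).choose i : ℝ) * ‖iteratedFDeriv ℝ i χ y‖ *
            ‖iteratedFDeriv ℝ (n + 1 - i) (polyVal g') y‖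
          ≤ ∑ i ∈ Finset.range (n + 1 + 1), ((n + 1).choose i : ℝ) * (A * (C * B)) := by
            refine Finset.sum_le_sum fun i hi => ?_
            rw [mul_assoc]
            refine mul_le_mul_of_nonneg_left ?_ (by positivity)
            exact mul_le_mul (hχb i (by have := Finset.mem_range.1 hi; omega) y)
              (hD _ (by omega) y hy) (norm_nonneg _) hA0
        _ = 2 ^ (n + 1) * C * A * B := by
            rw [← Finset.sum_mul]
            have := Nat.sum_range_choose (n + 1)
            rw [← Nat.cast_sum, this]
            push_cast
            ring)
  obtain ⟨P', hP', hPv'⟩ := exists_poly_comp_affine P hP (-(ρ⁻¹ • x₀)) ρ⁻¹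
  refine ⟨P', hP', fun x hx => ?_⟩
  set y : Euc d := ρ⁻¹ • (x - x₀) with hy
  have hxy : x₀ + ρ • y = x := by
    rw [hy, smul_smul, mul_inv_cancel₀ hρ.ne', one_smul, add_sub_cancel]
  have hny : ‖y‖ = ‖x - x₀‖ / ρ := by
    rw [hy, norm_smul, norm_inv, Real.norm_of_nonneg hρ.le]
    ring
  have h1 : polyVal P' x = polyVal P y := by
    rw [hPv', hy, smul_sub]
    congr 1
    abel
  have h2 := hPv y (by rw [hny, div_le_one hρ]; exact hx)
  rw [hgv, hχ] at h2
  simp only [hxy] at h2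
  rw [h1, ← hny]
  exact h2

end TaylorPolynomials

/-! ### Quantitative properties of the modulus of continuity. -/

section Moduli

/-- The growth bounds of a modulus of continuity of order `n` that are used below. -/
structure ModulusBounds (ω : ℝ → ℝ) (n : ℕ) (C r : ℝ) : Prop where
  one_le : 1 ≤ C
  r_pos : 0 < r
  pos : ∀ t, 0 < t → 0 < ω t
  mono : ∀ s t, 0 ≤ s → s ≤ t → ω s ≤ ω t
  growth : ∀ s t, 1 ≤ s → 0 < t → ω (s * t) ≤ C * s ^ (n + 1) * ω t
  decay : ∀ s t, 0 < s → s ≤ 1 → 0 < t → ω (s * t) ≤ C * s ^ r * ω t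

/-- Only `q ≤ n + 1` and `r > n - 1 ≥ 0` survive: the first matches a Taylor remainder of order `n +
1`, the second makes geometric sums converge. -/
lemma IsModulusOfOrder.exists_bounds {ω : ℝ → ℝ} {n : ℕ} (h : IsModulusOfOrder ω n) :
    ∃ C r : ℝ, ModulusBounds ω n C r := by
  obtain ⟨hn, ⟨q, hq1, hq2, C₁, hC₁, h₁⟩, r, hr1, hr2, C₂, hC₂, h₂⟩ := h.isLeast.1
  have hmono : ∀ s t, 0 ≤ s → s ≤ t → ω s ≤ ω t := fun s t hs hst =>
    h.monotoneOn hs (hs.trans hst) hst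
  have hpos : ∀ t, 0 < t → 0 < ω t := by
    -- Positivity comes from the strict growth inequality at `s = 2`: `0 ≤ ω (2 t) < C₁ 2 ^ q ω t`.
    intro t ht
    have h0 : 0 ≤ ω (2 * t) := by
      rw [← h.map_zero]
      exact hmono _ _ le_rfl (by positivity)
    have h1 := h0.trans_lt (h₁ 2 t one_lt_two ht)
    have h2 : 0 < C₁ * (2 : ℝ) ^ q := by positivity
    exact (mul_pos_iff_of_pos_left h2).1 h1
  have hn' : (1 : ℝ) ≤ n := by exact_mod_cast hn
  refine ⟨max 1 (max C₁ C₂), r, le_max_left _ _, by linarith, hpos, hmono, ?_, ?_⟩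
  · intro s t hs ht
    have hω := hpos t ht
    rcases hs.eq_or_lt with rfl | hs
    · simp only [one_mul, one_pow, mul_one]
      nlinarith [le_max_left 1 (max C₁ C₂)]
    · refine (h₁ s t hs ht).le.trans ?_
      refine mul_le_mul_of_nonneg_right ?_ hω.le
      refine mul_le_mul ((le_max_left _ _).trans (le_max_right _ _)) ?_ (by positivity)
        (by positivity)
      rw [← Real.rpow_natCast]
      exact Real.rpow_le_rpow_of_exponent_le hs.le (by push_cast; linarith)
  · intro s t hs0 hs ht
    have hω := hpos t ht
    rcases hs.eq_or_lt with rfl | hs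
    · simp only [one_mul, Real.one_rpow, mul_one]
      nlinarith [le_max_left 1 (max C₁ C₂)]
    · refine (h₂ s t hs0 hs ht).le.trans ?_
      refine mul_le_mul_of_nonneg_right ?_ hω.le
      exact mul_le_mul_of_nonneg_right ((le_max_right _ _).trans (le_max_right _ _))
        (by positivity)

namespace ModulusBounds

variable {ω : ℝ → ℝ} {n : ℕ} {C r : ℝ}

/-- Going down from the largest scale, the terms decay at least like powers of `θ = l ^ (-r) < 1`.
The sum is therefore dominated by its last term, uniformly in the number of scales. -/
lemma exists_sum_le (h : ModulusBounds ω n C r) {l : ℝ} (hl : 1 < l) :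
    ∃ A : ℝ, 0 ≤ A ∧ ∀ (J : ℕ) (t : ℝ), 0 < t →
      ∑ i ∈ Finset.range (J + 1), ω (l ^ i * t) ≤ A * ω (l ^ J * t) := by
  have hl0 : 0 < l := by linarith
  set θ : ℝ := (l⁻¹) ^ r with hθ
  have hθ0 : 0 ≤ θ := by positivity
  have hθ1 : θ < 1 := Real.rpow_lt_one (by positivity) (inv_lt_one_of_one_lt₀ hl) h.r_pos
  have hC := h.one_le
  refine ⟨C * (1 - θ)⁻¹, mul_nonneg (by linarith) (inv_nonneg.2 (by linarith)),
    fun J t ht => ?_⟩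
  have hωJ := h.pos (l ^ J * t) (by positivity)
  calc ∑ i ∈ Finset.range (J + 1), ω (l ^ i * t)
      ≤ ∑ i ∈ Finset.range (J + 1), C * ω (l ^ J * t) * θ ^ (J - i) := by
        refine Finset.sum_le_sum fun i hi => ?_
        have hi' : i ≤ J := by have := Finset.mem_range.1 hi; omega
        have h1 := h.decay ((l⁻¹) ^ (J - i)) (l ^ J * t) (by positivity)
          (pow_le_one₀ (by positivity) (inv_lt_one_of_one_lt₀ hl).le) (by positivity)
        have h2 : (l⁻¹) ^ (J - i) * (l ^ J * t) = l ^ i * t := by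
          rw [← mul_assoc, inv_pow, pow_sub₀ _ hl0.ne' hi']
          field_simp
        have h3 : ((l⁻¹) ^ (J - i)) ^ r = θ ^ (J - i) := by
          rw [hθ, ← Real.rpow_natCast, ← Real.rpow_natCast, ← Real.rpow_mul (by positivity),
            ← Real.rpow_mul (by positivity), mul_comm]
        rw [h2, h3] at h1
        linarith
    _ = C * ω (l ^ J * t) * ∑ i ∈ Finset.range (J + 1), θ ^ i := by
        rw [← Finset.mul_sum]
        congr 1
        rw [← Finset.sum_range_reflect]
        refine Finset.sum_congr rfl fun i hi => ?_
        have := Finset.mem_range.1 hi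
        congr 1
        omega
    _ ≤ C * ω (l ^ J * t) * (1 - θ)⁻¹ := by
        refine mul_le_mul_of_nonneg_left ?_ (by positivity)
        rw [← tsum_geometric_of_lt_one hθ0 hθ1]
        exact (summable_geometric_of_lt_one hθ0 hθ1).sum_le_tsum _ fun i _ => by positivity
    _ = C * (1 - θ)⁻¹ * ω (l ^ J * t) := by ring

end ModulusBounds

end Moduli

/-! ### Interior cones of Lipschitz domains and their consequences for the boundary. -/

section Cones

variable {d : ℕ}

/-- At every boundary point `a` the set `D` contains upward cones of aperture `c` and height `r₀`,
with a common axis for all vertices in the `r₀`-neighbourhood of `a`. -/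
def HasInteriorCones (D : Set (Euc d)) (c r₀ : ℝ) : Prop :=
  ∀ a ∈ frontier D, ∃ e : Euc d, ‖e‖ = 1 ∧ ∀ z ∈ closure D, ‖z - a‖ ≤ r₀ →
    ∀ t, 0 < t → t ≤ r₀ → ∀ v, ‖v‖ ≤ c * t → z + t • e + v ∈ D

/-- Moving up by `t` and sideways by at most `2 c t` keeps a point above a `δ`-Lipschitz graph as
soon as `2 c (1 + δ) < 1`. Here this product is `1 / 2`. -/
lemma IsLipschitzDomain.exists_cones {δ : ℝ≥0} {R : ℝ} {D : Set (Euc d)}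
    (hD : IsLipschitzDomain δ R D) :
    ∃ c r₀ : ℝ, 0 < c ∧ c ≤ 1 ∧ 0 < r₀ ∧ HasInteriorCones D c r₀ := by
  obtain ⟨-, -, -, hR, hloc⟩ := hD
  have hδ : (0 : ℝ) ≤ δ := δ.2
  set c : ℝ := 1 / (4 * (1 + δ)) with hc
  have hc0 : 0 < c := by positivity
  have hcδ : c * (1 + δ) = 1 / 4 := by
    rw [hc]
    field_simp
  have hc1 : c ≤ 1 / 4 := by nlinarith
  refine ⟨c, R / 16, hc0, by linarith, by linarith, fun a ha => ?_⟩
  obtain ⟨ρ, A, hA, hiff⟩ := hloc a ha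
  set e₀ : WithLp 2 (Euc (d - 1) × ℝ) := WithLp.toLp 2 (0, 1) with he₀
  have hfst : ∀ w : WithLp 2 (Euc (d - 1) × ℝ), ‖w.fst‖ ≤ ‖w‖ := fun w =>
    WithLp.norm_fst_le _ w
  have hsnd : ∀ w : WithLp 2 (Euc (d - 1) × ℝ), |w.snd| ≤ ‖w‖ := fun w =>
    WithLp.norm_snd_le _ w
  have hnear : ∀ z : Euc d, ‖z - a‖ < R / 2 →
      (z ∈ D ↔ A (ρ (z - a)).fst < (ρ (z - a)).snd) := by
    intro z hz
    refine hiff z (fun i => ?_) ?_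
    · refine ((Euc.abs_apply_le_norm _ i).trans (hfst _)).trans_lt ?_
      rwa [ρ.norm_map]
    · refine (hsnd _).trans_lt ?_
      rwa [ρ.norm_map]
  have he : ‖ρ.symm e₀‖ = 1 := by
    rw [ρ.symm.norm_map, he₀]
    simp
  -- The doubled aperture leaves room to replace a vertex in the closure by a nearby vertex in `D`,
  -- the displacement being absorbed into `v`.
  have key : ∀ z ∈ D, ‖z - a‖ ≤ R / 8 → ∀ t, 0 < t → t ≤ R / 16 → ∀ v, ‖v‖ ≤ 2 * c * t →
      z + t • ρ.symm e₀ + v ∈ D := by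
    intro z hz hza t ht htR v hv
    have hzD := (hnear z (by linarith)).1 hz
    have hdec : z + t • ρ.symm e₀ + v - a = (z - a) + t • ρ.symm e₀ + v := by abel
    have hvt : ‖v‖ ≤ t := by nlinarith
    rw [hnear]
    · rw [hdec]
      simp only [map_add, map_smul, LinearIsometryEquiv.apply_symm_apply, WithLp.add_fst,
        WithLp.smul_fst, WithLp.add_snd, WithLp.smul_snd]
      have e1 : e₀.fst = 0 := rfl
      have e2 : e₀.snd = 1 := rfl
      rw [e1, e2, smul_zero, add_zero, smul_eq_mul, mul_one]
      have h1 := hA.dist_le_mul ((ρ (z - a)).fst + (ρ v).fst) (ρ (z - a)).fst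
      rw [Real.dist_eq, dist_eq_norm, add_sub_cancel_left] at h1
      have h2 := (abs_le.1 h1).2
      have h3 := (hfst (ρ v))
      have h4 := (abs_le.1 (hsnd (ρ v))).1
      rw [ρ.norm_map] at h3 h4
      have h5 : (δ : ℝ) * ‖(ρ v).fst‖ ≤ δ * (2 * c * t) :=
        mul_le_mul_of_nonneg_left (h3.trans hv) hδ
      nlinarith
    · rw [hdec]
      have h1 := norm_add_le (z - a + t • ρ.symm e₀) v
      have h2 := norm_add_le (z - a) (t • ρ.symm e₀)
      rw [norm_smul, he, Real.norm_of_nonneg ht.le] at h2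
      linarith
  refine ⟨ρ.symm e₀, he, fun z hz hza t ht htR v hv => ?_⟩
  obtain ⟨z', hz', hzz'⟩ := Metric.mem_closure_iff.1 hz (min (c * t) (R / 16)) (by positivity)
  rw [dist_eq_norm] at hzz'
  have h1 : ‖z - z'‖ < c * t := hzz'.trans_le (min_le_left _ _)
  have h2 : ‖z - z'‖ < R / 16 := hzz'.trans_le (min_le_right _ _)
  have h3 : ‖z' - a‖ ≤ R / 8 := by
    have : z' - a = (z - a) - (z - z') := by abel
    rw [this]
    refine (norm_sub_le _ _).trans ?_
    linarith
  have := key z' hz' h3 t ht htR (v + (z - z')) ((norm_add_le _ _).trans (by linarith))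
  convert this using 1
  abel

variable {D : Set (Euc d)} {c r₀ : ℝ}

lemma frontier_notMem_of_isOpen (hD : IsOpen D) {a : Euc d} (ha : a ∈ frontier D) : a ∉ D := by
  rw [hD.frontier_eq] at ha
  exact ha.2

/-- If a boundary point `a` were interior to the closure, then `a - t e` would lie in the closure
for small `t`, and the cone at that vertex would put `a` into `D`. Hence `D` and the exterior have
the same boundary. -/
lemma HasInteriorCones.frontier_closure_eq (h : HasInteriorCones D c r₀) (hD : IsOpen D)
    (hc : 0 < c) (hr : 0 < r₀) : frontier (closure D) = frontier D := by
  refine subset_antisymm frontier_closure_subset fun a ha => ?_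
  obtain ⟨e, he, hcone⟩ := h a ha
  rw [frontier, closure_closure]
  refine ⟨frontier_subset_closure ha, fun hbd => ?_⟩
  obtain ⟨ε, hε, hball⟩ := Metric.isOpen_iff.1 isOpen_interior a hbd
  set t := min (ε / 2) r₀ with ht
  have ht0 : 0 < t := by positivity
  have hnorm : ‖t • e‖ = t := by rw [norm_smul, he, Real.norm_of_nonneg ht0.le, mul_one]
  have h1 : a - t • e ∈ closure D := by
    apply interior_subset
    apply hball
    rw [Metric.mem_ball, dist_eq_norm, sub_sub_cancel_left, norm_neg, hnorm]
    exact (min_le_left _ _).trans_lt (by linarith)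
  have h2 := hcone _ h1 (by rw [sub_sub_cancel_left, norm_neg, hnorm]; exact min_le_right _ _) t ht0
    (min_le_right _ _) 0 (by simp; positivity)
  rw [sub_add_cancel, add_zero] at h2
  exact frontier_notMem_of_isOpen hD ha h2

open scoped Pointwise in
-- Two boundary points near `a` cannot differ by a small positive multiple of the axis, since one of
-- them would lie in the cone of the other. So the piece of the boundary near `a` has infinitely
-- many disjoint translates within a bounded set, and its measure vanishes.
lemma HasInteriorCones.volume_frontier (h : HasInteriorCones D c r₀) (hD : IsOpen D)
    (hc : 0 < c) (hr : 0 < r₀) : volume (frontier D) = 0 := by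
  refine measure_null_of_locally_null _ fun a ha => ?_
  obtain ⟨e, he, hcone⟩ := h a ha
  refine ⟨frontier D ∩ Metric.closedBall a r₀,
    Filter.inter_mem self_mem_nhdsWithin (mem_nhdsWithin_of_mem_nhds (Metric.closedBall_mem_nhds a hr)), ?_⟩
  have hnorm : ∀ t : ℝ, 0 ≤ t → ‖t • e‖ = t := fun t ht => by
    rw [norm_smul, he, Real.norm_of_nonneg ht, mul_one]
  refine Measure.addHaar_eq_zero_of_disjoint_translates volume
    (fun k : ℕ => (r₀ / (k + 1)) • e) ?_ ?_ (isClosed_frontier.measurableSet.inter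
      Metric.isClosed_closedBall.measurableSet)
  · refine (Metric.isBounded_closedBall (x := (0 : Euc d)) (r := r₀)).subset ?_
    rintro _ ⟨k, rfl⟩
    rw [mem_closedBall_zero_iff, hnorm _ (by positivity)]
    exact div_le_self hr.le (by linarith [Nat.cast_nonneg (α := ℝ) k])
  · have main : ∀ k l : ℕ, k < l → Disjoint
        (({(r₀ / ((k : ℝ) + 1)) • e} : Set (Euc d)) + (frontier D ∩ Metric.closedBall a r₀))
        (({(r₀ / ((l : ℝ) + 1)) • e} : Set (Euc d)) + (frontier D ∩ Metric.closedBall a r₀)) := by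
      intro k l hkl
      rw [Set.disjoint_left]
      simp only [singleton_add, image_add_left, mem_preimage]
      intro x hx hx'
      have hkl' : (k : ℝ) < l := by exact_mod_cast hkl
      have hlt : r₀ / ((l : ℝ) + 1) < r₀ / ((k : ℝ) + 1) :=
        div_lt_div_of_pos_left hr (by positivity) (by linarith)
      have hle : r₀ / ((k : ℝ) + 1) ≤ r₀ := div_le_self hr.le (by
        linarith [Nat.cast_nonneg (α := ℝ) k])
      have hpos : 0 < r₀ / ((l : ℝ) + 1) := by positivity
      have h1 := hcone _ (frontier_subset_closure hx.1)
        (by rw [← dist_eq_norm]; exact Metric.mem_closedBall.1 hx.2)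
        (r₀ / ((k : ℝ) + 1) - r₀ / ((l : ℝ) + 1)) (by linarith) (by linarith) 0 (by
          rw [norm_zero]
          exact mul_nonneg hc.le (by linarith))
      refine frontier_notMem_of_isOpen hD hx'.1 ?_
      convert h1 using 1
      rw [sub_smul]
      abel
    intro k l hkl
    rcases lt_or_gt_of_ne hkl with h1 | h1
    · exact main k l h1
    · exact (main l k h1).symm

end Cones

/-! ### Diameters of cubes and distances between sets. -/

section Diameters

variable {d : ℕ}

namespace AxisCube

lemma diam_carrier_le (Q : AxisCube d) : Metric.diam Q.carrier ≤ d * Q.side := by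
  have hs := Q.side_pos
  refine Metric.diam_le_of_forall_dist_le (by positivity) fun x hx y hy => ?_
  rw [dist_eq_norm]
  refine Euc.norm_le_of_abs_le hs.le fun i => ?_
  have h1 := hx i
  have h2 := hy i
  rw [PiLp.sub_apply, abs_le]
  constructor <;> linarith

lemma half_side_le_diam (hd : 0 < d) (Q : AxisCube d) : Q.side / 2 ≤ Metric.diam Q.carrier := by
  have hs := Q.side_pos
  have hmem : Q.center - EuclideanSpace.single (⟨0, hd⟩ : Fin d) (Q.side / 2) ∈ Q.carrier := by
    intro i
    by_cases hi : i = ⟨0, hd⟩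
    · subst hi
      simp
      linarith
    · simp [hi]
      constructor <;> linarith
  have := Metric.dist_le_diam_of_mem Q.isBounded_carrier Q.center_mem hmem
  rw [dist_eq_norm, sub_sub_cancel, PiLp.norm_single, Real.norm_of_nonneg (by linarith)]
    at this
  exact this

/-- The factor `2` is natural, but the reflection of `x` in the centre may be missing from a
semi-open cube. Contracting by `3 / 4` first gives `3 / 2`; any factor above `1` suffices for
`IsWhitneyCovering.scale_two_subset`. -/
lemma norm_sub_center_le_diam {Q : AxisCube d} {x : Euc d} (hx : x ∈ Q.carrier) :
    3 / 2 * ‖x - Q.center‖ ≤ Metric.diam Q.carrier := by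
  have hs := Q.side_pos
  have hmem : ∀ t : ℝ, |t| ≤ 3 / 4 → Q.center + t • (x - Q.center) ∈ Q.carrier := by
    intro t ht i
    have h1 := abs_sub_center_le hx i
    have h2 : |t * (x - Q.center) i| ≤ 3 / 4 * (Q.side / 2) := by
      rw [abs_mul]
      exact mul_le_mul ht h1 (abs_nonneg _) (by norm_num)
    rw [abs_le] at h2
    rw [PiLp.add_apply, PiLp.smul_apply, smul_eq_mul]
    constructor <;> linarith
  have := Metric.dist_le_diam_of_mem Q.isBounded_carrier (hmem (3 / 4) (by norm_num [abs_of_pos]))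
    (hmem (-(3 / 4)) (by norm_num [abs_of_pos]))
  rw [dist_eq_norm, add_sub_add_left_eq_sub, ← sub_smul, norm_smul] at this
  norm_num at this
  exact this

lemma ediam_carrier (Q : AxisCube d) :
    Metric.ediam Q.carrier = ENNReal.ofReal (Metric.diam Q.carrier) := by
  rw [Metric.diam, ENNReal.ofReal_toReal (Metric.isBounded_iff_ediam_ne_top.1 Q.isBounded_carrier)]

lemma shrink_mem {Q : AxisCube d} {s : ℝ} (hs : 0 < s) {x : Euc d}
    (hx : x ∈ (Q.scale s hs).carrier) : Q.center + s⁻¹ • (x - Q.center) ∈ Q.carrier := by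
  intro i
  have h := hx i
  simp only [scale] at h
  rw [PiLp.add_apply, PiLp.smul_apply, PiLp.sub_apply, smul_eq_mul, inv_mul_eq_div]
  constructor
  · have : -(Q.side / 2) ≤ (x i - Q.center i) / s := by
      rw [le_div_iff₀ hs]
      linarith
    linarith
  · have : (x i - Q.center i) / s < Q.side / 2 := by
      rw [div_lt_iff₀ hs]
      linarith
    linarith

lemma carrier_subset_scale {s : ℝ} (hs : 0 < s) (hs1 : 1 ≤ s) (Q : AxisCube d) :
    Q.carrier ⊆ (Q.scale s hs).carrier := by
  apply carrier_subset_of_abs_le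
  intro i
  simp only [scale, sub_self, abs_zero]
  nlinarith [Q.side_pos]

end AxisCube

lemma setEDist_le {X : Type*} [PseudoEMetricSpace X] {A B : Set X} {x y : X} (hx : x ∈ A)
    (hy : y ∈ B) : setEDist A B ≤ edist x y :=
  (iInf₂_le x hx).trans (iInf₂_le y hy)

lemma exists_edist_lt {X : Type*} [PseudoEMetricSpace X] {A B : Set X} {r : ℝ≥0∞}
    (h : setEDist A B < r) : ∃ x ∈ A, ∃ y ∈ B, edist x y < r := by
  simp only [setEDist, iInf_lt_iff] at h
  obtain ⟨x, hx, y, hy, h⟩ := h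
  exact ⟨x, hx, y, hy, h⟩

lemma dist_le_of_edist_lt {X : Type*} [PseudoMetricSpace X] {x y : X} {r : ℝ} (hr : 0 ≤ r)
    (h : edist x y < ENNReal.ofReal r) : dist x y ≤ r := by
  rw [edist_dist] at h
  exact (ENNReal.ofReal_le_ofReal_iff hr).1 h.le

end Diameters

/-! ### Geometry and counting for Whitney coverings. -/

section Whitney

variable {d : ℕ} {G : Set (Euc d)} {W : Set (AxisCube d)}

namespace IsWhitneyCovering

lemma carrier_subset (hW : IsWhitneyCovering G W) {Q : AxisCube d} (hQ : Q ∈ W) :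
    Q.carrier ⊆ G := by
  rw [← hW.covers]
  exact subset_biUnion_of_mem (u := AxisCube.carrier) hQ

lemma exists_mem (hW : IsWhitneyCovering G W) {x : Euc d} (hx : x ∈ G) :
    ∃ Q ∈ W, x ∈ Q.carrier := by
  rw [← hW.covers] at hx
  simpa using hx

lemma diam_le_dist (hW : IsWhitneyCovering G W) {Q : AxisCube d} (hQ : Q ∈ W) {x a : Euc d}
    (hx : x ∈ Q.carrier) (ha : a ∈ frontier G) : Metric.diam Q.carrier ≤ dist x a := by
  have h := (hW.diam_le Q hQ).trans (setEDist_le hx ha)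
  rw [Q.ediam_carrier, edist_dist] at h
  exact (ENNReal.ofReal_le_ofReal_iff dist_nonneg).1 h

lemma setEDist_lt (hW : IsWhitneyCovering G W) (hd : 0 < d) {Q : AxisCube d} (hQ : Q ∈ W) :
    setEDist Q.carrier (frontier G) < ENNReal.ofReal (5 * Metric.diam Q.carrier) := by
  have h0 := Q.half_side_le_diam hd
  have hs := Q.side_pos
  refine (hW.le_diam Q hQ).trans_lt ?_
  rw [Q.ediam_carrier, show (4 : ℝ≥0∞) = ENNReal.ofReal 4 by simp,
    ← ENNReal.ofReal_mul (by norm_num)]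
  exact (ENNReal.ofReal_lt_ofReal_iff (by linarith)).2 (by linarith)

lemma exists_dist_le (hW : IsWhitneyCovering G W) (hd : 0 < d) {Q : AxisCube d} (hQ : Q ∈ W) :
    ∃ x ∈ Q.carrier, ∃ a ∈ frontier G, dist x a ≤ 5 * Metric.diam Q.carrier := by
  obtain ⟨x, hx, a, ha, h⟩ := exists_edist_lt (hW.setEDist_lt hd hQ)
  exact ⟨x, hx, a, ha, dist_le_of_edist_lt (by have := Metric.diam_nonneg (s := Q.carrier); linarith)
    h⟩

/-- Makes Whitney cubes admissible in the interior seminorm. A point `y` of the doubled cube lies at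
distance at most `2 / 3` of the diameter from the midpoint `x ∈ Q` of `y` and the centre, while the
boundary is at least a full diameter away from `x`. -/
lemma scale_two_subset (hW : IsWhitneyCovering G W) (hG : IsOpen G) (hd : 0 < d)
    {Q : AxisCube d} (hQ : Q ∈ W) :
    (Q.scale 2 two_pos).carrier ⊆ G := by
  intro y hy
  set x := Q.center + (2 : ℝ)⁻¹ • (y - Q.center) with hx
  have hxQ : x ∈ Q.carrier := AxisCube.shrink_mem two_pos hy
  have hd1 := AxisCube.norm_sub_center_le_diam hxQ
  have hs := Q.half_side_le_diam hd
  have hs' := Q.side_pos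
  have hyx : y - x = x - Q.center := by
    rw [hx]
    ext i
    simp
    ring
  have hsub : segment ℝ x y ⊆ G := by
    refine (convex_segment x y).isPreconnected.subset_of_closure_inter_subset hG
      ⟨x, left_mem_segment ℝ x y, hW.carrier_subset hQ hxQ⟩ ?_
    rintro w ⟨hwc, hw⟩
    by_contra hwG
    have hwf : w ∈ frontier G := by
      rw [hG.frontier_eq]
      exact ⟨hwc, hwG⟩
    have h1 := hW.diam_le_dist hQ hxQ hwf
    have h2 : dist x w ≤ dist x y := by
      obtain ⟨u, v, hu, hv, huv, rfl⟩ := hw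
      have : x - (u • x + v • y) = v • (x - y) := by
        rw [smul_sub, show u = 1 - v by linarith, sub_smul, one_smul]
        abel
      rw [dist_eq_norm, dist_eq_norm, this, norm_smul, Real.norm_of_nonneg hv]
      exact mul_le_of_le_one_left (norm_nonneg _) (by linarith)
    rw [dist_comm x y, dist_eq_norm y x, hyx] at h2
    linarith [norm_nonneg (x - Q.center)]
  exact hsub (right_mem_segment ℝ x y)

/-- On the set where `ψ Q` can be nonzero, the distance to the boundary is comparable to the side.
-/
lemma infDist_bounds (hW : IsWhitneyCovering G W) (hd : 0 < d) {Q : AxisCube d} (hQ : Q ∈ W)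
    {y : Euc d} (hy : y ∈ (Q.scale (5 / 4) (by norm_num)).carrier) :
    Q.side / 4 ≤ Metric.infDist y (frontier G) ∧
      Metric.infDist y (frontier G) ≤ 7 * d * Q.side := by
  set x := Q.center + (5 / 4 : ℝ)⁻¹ • (y - Q.center) with hx
  have hxQ : x ∈ Q.carrier := AxisCube.shrink_mem (by norm_num) hy
  have hd1 := AxisCube.norm_sub_center_le_diam hxQ
  have hs := Q.half_side_le_diam hd
  have hs' := Q.side_pos
  have hd2 := Q.diam_carrier_le
  have hyx : dist y x = 1 / 4 * ‖x - Q.center‖ := by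
    have : y - x = (1 / 4 : ℝ) • (x - Q.center) := by
      rw [hx]
      ext i
      simp
      ring
    rw [dist_eq_norm, this, norm_smul]
    norm_num
  obtain ⟨x', hx', a, ha, hxa⟩ := hW.exists_dist_le hd hQ
  constructor
  · rw [Metric.le_infDist ⟨a, ha⟩]
    intro b hb
    have h1 := hW.diam_le_dist hQ hxQ hb
    have h2 := dist_triangle x y b
    rw [dist_comm x y] at h2
    linarith
  · refine (Metric.infDist_le_dist_of_mem ha).trans ?_
    have h1 := dist_triangle4 y x x' a
    have h2 := Metric.dist_le_diam_of_mem Q.isBounded_carrier hxQ hx'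
    have h3 : 0 ≤ (d : ℝ) * Q.side := by positivity
    nlinarith

lemma countable (hW : IsWhitneyCovering G W) : W.Countable := by
  refine hW.disjoint.countable_of_nonempty_interior fun Q _ => ⟨Q.center, ?_⟩
  rw [mem_interior]
  refine ⟨Metric.ball Q.center (Q.side / 2), fun x hx => ?_, Metric.isOpen_ball,
    Metric.mem_ball_self (by linarith [Q.side_pos])⟩
  apply AxisCube.mem_carrier_of_norm_lt
  rwa [← dist_eq_norm]

end IsWhitneyCovering

/-- A disjoint family of cubes, not too small, in a given cube is finite. -/
lemma finite_of_pairwiseDisjoint_cubes {F : Set (AxisCube d)}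
    (hF : F.PairwiseDisjoint AxisCube.carrier) {s : ℝ} (hs : 0 < s) (B : AxisCube d)
    (h : ∀ Q ∈ F, s ≤ Q.side ∧ Q.carrier ⊆ B.carrier) :
    F.Finite ∧ (F.ncard : ℝ) ≤ (B.side / s) ^ d := by
  have key : ∀ T : Finset (AxisCube d), (T : Set (AxisCube d)) ⊆ F →
      (T.card : ℝ) ≤ (B.side / s) ^ d := by
    intro T hT
    have h1 : (T.card : ℝ≥0∞) * ENNReal.ofReal (s ^ d) ≤ ENNReal.ofReal (B.side ^ d) := by
      calc (T.card : ℝ≥0∞) * ENNReal.ofReal (s ^ d)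
          = ∑ _Q ∈ T, ENNReal.ofReal (s ^ d) := by rw [Finset.sum_const, nsmul_eq_mul]
        _ ≤ ∑ Q ∈ T, volume Q.carrier := by
            refine Finset.sum_le_sum fun Q hQ => ?_
            rw [Q.volume_carrier]
            exact ENNReal.ofReal_le_ofReal (pow_le_pow_left₀ hs.le (h Q (hT hQ)).1 d)
        _ = volume (⋃ Q ∈ T, Q.carrier) :=
            (measure_biUnion_finset (hF.subset hT) fun Q _ => Q.measurableSet_carrier).symm
        _ ≤ volume B.carrier := measure_mono (iUnion₂_subset fun Q hQ => (h Q (hT hQ)).2)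
        _ = _ := B.volume_carrier
    rw [div_pow, le_div_iff₀ (by positivity)]
    rw [← ENNReal.ofReal_natCast, ← ENNReal.ofReal_mul (by positivity)] at h1
    exact (ENNReal.ofReal_le_ofReal_iff (pow_nonneg B.side_pos.le d)).1 h1
  have hfin : F.Finite := by
    by_contra hinf
    obtain ⟨N, hN⟩ := exists_nat_gt ((B.side / s) ^ d)
    obtain ⟨T, hT, hcard⟩ := Set.Infinite.exists_subset_card_eq hinf N
    have := key T hT
    rw [hcard] at this
    linarith
  refine ⟨hfin, ?_⟩
  rw [Set.ncard_eq_toFinset_card F hfin]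
  exact key _ (by simp)

/-- The cubes of a Whitney covering close to a point `x₀`: comparable sizes and bounded number. -/
lemma IsWhitneyCovering.finite_near (hW : IsWhitneyCovering G W) (hd : 0 < d) {x₀ : Euc d}
    {ρ : ℝ} (hρ : 0 < ρ) (h₀ : Metric.infDist x₀ (frontier G) = ρ) {F : Set (AxisCube d)}
    (hFW : F ⊆ W) (hF : ∀ Q ∈ F, ∃ y ∈ (Q.scale (5 / 4) (by norm_num)).carrier,
      dist y x₀ ≤ ρ / 2) :
    (∀ Q ∈ F, Q.side ≤ 6 * ρ ∧ ρ ≤ 14 * d * Q.side ∧ ‖Q.center - x₀‖ ≤ 5 * d * ρ) ∧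
      F.Finite ∧ (F.ncard : ℝ) ≤ (14 * d * (16 * d)) ^ d := by
  have hd' : (1 : ℝ) ≤ d := by exact_mod_cast hd
  have hsize : ∀ Q ∈ F, Q.side ≤ 6 * ρ ∧ ρ ≤ 14 * d * Q.side ∧ ‖Q.center - x₀‖ ≤ 5 * d * ρ := by
    intro Q hQ
    obtain ⟨y, hy, hyx⟩ := hF Q hQ
    obtain ⟨h1, h2⟩ := hW.infDist_bounds hd (hFW hQ) hy
    have h3 := Metric.infDist_le_infDist_add_dist (s := frontier G) (x := y) (y := x₀)
    have h4 := Metric.infDist_le_infDist_add_dist (s := frontier G) (x := x₀) (y := y)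
    rw [dist_comm x₀ y] at h4
    have h5 := AxisCube.norm_sub_center_le hy
    simp only [AxisCube.scale] at h5
    have h6 : Q.side ≤ 6 * ρ := by linarith
    refine ⟨h6, by linarith, ?_⟩
    have h7 : Q.center - x₀ = (y - x₀) - (y - Q.center) := by abel
    rw [h7]
    refine (norm_sub_le _ _).trans ?_
    rw [← dist_eq_norm y x₀]
    have h8 : (d : ℝ) * (5 / 4 * Q.side / 2) ≤ d * (5 / 4 * (6 * ρ) / 2) := by gcongr
    nlinarith
  -- Disjoint cubes of side at least `ρ / (14 d)` all lie in one cube of side `16 d ρ`, because `5 d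
  -- ρ + 3 ρ ≤ 8 d ρ`. Comparing volumes bounds their number.
  refine ⟨hsize, ?_⟩
  have hfin := finite_of_pairwiseDisjoint_cubes (hW.disjoint.subset hFW)
    (s := ρ / (14 * d)) (by positivity) ⟨x₀, 16 * d * ρ, by positivity⟩ (fun Q hQ => by
      obtain ⟨h1, h2, h3⟩ := hsize Q hQ
      refine ⟨?_, ?_⟩
      · rw [div_le_iff₀ (by positivity)]
        linarith
      · apply AxisCube.carrier_subset_of_norm_le
        simp only
        nlinarith)
  refine ⟨hfin.1, hfin.2.trans_eq ?_⟩
  congr 1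
  field_simp

end Whitney

/-! ### Comparability of a cube and its reflective cube. -/

section Reflection

variable {d : ℕ} {D : Set (Euc d)} {W W' : Set (AxisCube d)}

/-- A reflective cube is close to the original one and not much larger. -/
lemma IsReflective.upper_bounds (hd : 0 < d) (hW : IsWhitneyCovering D W)
    (hW' : IsWhitneyCovering (closure D)ᶜ W') (hfr : frontier (closure D)ᶜ = frontier D)
    {Q S : AxisCube d} (hQ : Q ∈ W') (hS : IsReflective D W Q S) :
    S.side ≤ 32 * d * Q.side ∧ ‖S.center - Q.center‖ ≤ 27 * (d : ℝ) ^ 2 * Q.side := by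
  have hd' : (1 : ℝ) ≤ d := by exact_mod_cast hd
  have hlt : setEDist Q.carrier S.carrier < ENNReal.ofReal (10 * Metric.diam Q.carrier) := by
    refine hS.1.2.trans_lt ?_
    have h1 := hW'.setEDist_lt hd hQ
    rw [hfr] at h1
    rw [show (10 : ℝ) = 2 * 5 by norm_num, mul_assoc, ENNReal.ofReal_mul (by norm_num)]
    simp only [ENNReal.ofReal_ofNat]
    exact ENNReal.mul_lt_mul_right two_ne_zero ENNReal.ofNat_ne_top h1
  obtain ⟨x, hx, y, hy, hxy⟩ := exists_edist_lt hlt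
  have hdiam0 := Metric.diam_nonneg (s := Q.carrier)
  replace hxy := dist_le_of_edist_lt (by linarith) hxy
  obtain ⟨x', hx', a, ha, hxa⟩ := hW'.exists_dist_le hd hQ
  rw [hfr] at ha
  have h1 := hW.diam_le_dist hS.1.1 hy ha
  have h2 := dist_triangle4 y x x' a
  have h3 := Metric.dist_le_diam_of_mem Q.isBounded_carrier hx hx'
  have h4 := Q.diam_carrier_le
  have h5 := S.half_side_le_diam hd
  rw [dist_comm y x] at h2
  -- A point of `S` is within `10 + 1 + 5 = 16` diameters of `Q` from the boundary, which bounds the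
  -- diameter of the Whitney cube `S`.
  have hside : S.side ≤ 32 * d * Q.side := by nlinarith
  refine ⟨hside, ?_⟩
  have h6 := AxisCube.norm_sub_center_le hx
  have h7 := AxisCube.norm_sub_center_le hy
  rw [← dist_eq_norm] at h6 h7 ⊢
  have h8 := dist_triangle4 S.center y x Q.center
  rw [dist_comm S.center y, dist_comm y x] at h8
  have h9 : (d : ℝ) * (S.side / 2) ≤ d * (32 * d * Q.side / 2) := by gcongr
  have h10 : (d : ℝ) * Q.side ≤ d ^ 2 * Q.side := by
    rw [sq]
    nlinarith [mul_pos (show (0 : ℝ) < d by linarith) Q.side_pos]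
  nlinarith

/-- A reflective cube is not much smaller than the original one. -/
lemma IsReflective.lower_bound {c r₀ : ℝ} (hd : 0 < d) (hD : IsOpen D) (hc : 0 < c) (hr₀ : 0 < r₀)
    (hcone : HasInteriorCones D c r₀) (hW : IsWhitneyCovering D W)
    (hW' : IsWhitneyCovering (closure D)ᶜ W') (hfr : frontier (closure D)ᶜ = frontier D)
    {Q S : AxisCube d} (hQ : Q ∈ W') (hS : IsReflective D W Q S) :
    c * min (Q.side / 4) r₀ ≤ 6 * d * S.side := by
  have hd' : (1 : ℝ) ≤ d := by exact_mod_cast hd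
  have hsQ := Q.side_pos
  have hdiam := Q.half_side_le_diam hd
  have hdiam' := Q.diam_carrier_le
  have hlt := hW'.setEDist_lt hd hQ
  have hge := hW'.diam_le Q hQ
  rw [hfr] at hlt hge
  rw [Q.ediam_carrier] at hge
  obtain ⟨r, hr⟩ : ∃ r : ℝ, r = (setEDist Q.carrier (frontier D)).toReal := ⟨_, rfl⟩
  have hrE : setEDist Q.carrier (frontier D) = ENNReal.ofReal r := by
    rw [hr, ENNReal.ofReal_toReal hlt.ne_top]
  have hr0 : 0 ≤ r := by rw [hr]; exact ENNReal.toReal_nonneg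
  rw [hrE] at hlt hge
  have hr1 : Metric.diam Q.carrier ≤ r := (ENNReal.ofReal_le_ofReal_iff hr0).1 hge
  have hr2 : r < 5 * Metric.diam Q.carrier := (ENNReal.ofReal_lt_ofReal_iff (by linarith)).1 hlt
  have hrpos : 0 < r := by linarith
  obtain ⟨x, hx, a, ha, hxa⟩ := exists_edist_lt (A := Q.carrier) (B := frontier D)
    (r := ENNReal.ofReal (3 / 2 * r)) (by
      rw [hrE]
      exact (ENNReal.ofReal_lt_ofReal_iff (by linarith)).2 (by linarith))
  replace hxa := dist_le_of_edist_lt (by linarith) hxa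
  obtain ⟨e, he, hcone⟩ := hcone a ha
  -- The allowance `2 r` for candidates is split into `3 r / 2` from `x` to `a` and at most `r / 2`
  -- from `a` up the axis. Thus the Whitney cube containing `a + t e` is a candidate.
  set t := min (r / 2) r₀ with ht
  have ht0 : 0 < t := by positivity
  have ht1 : t ≤ r / 2 := min_le_left _ _
  have ht2 : t ≤ r₀ := min_le_right _ _
  have hcone' := hcone a (frontier_subset_closure ha) (by rw [sub_self, norm_zero]; linarith) t
    ht0 ht2
  have hz : a + t • e ∈ D := by
    have := hcone' 0 (by rw [norm_zero]; positivity)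
    rwa [add_zero] at this
  obtain ⟨T, hT, hzT⟩ := hW.exists_mem hz
  have hcand : IsReflCandidate D W Q T := by
    refine ⟨hT, (setEDist_le hx hzT).trans ?_⟩
    have h2r : (2 : ℝ≥0∞) * ENNReal.ofReal r = ENNReal.ofReal (2 * r) := by
      rw [ENNReal.ofReal_mul (by norm_num), ENNReal.ofReal_ofNat]
    rw [hrE, edist_dist, h2r]
    apply ENNReal.ofReal_le_ofReal
    refine (dist_triangle x a _).trans ?_
    rw [dist_self_add_right, norm_smul, he, Real.norm_of_nonneg ht0.le]
    linarith
  have hTS := hS.2 T hcand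
  obtain ⟨x₂, hx₂, b, hb, hxb⟩ := hW.exists_dist_le hd hT
  have h1 := Metric.dist_le_diam_of_mem T.isBounded_carrier hzT hx₂
  have h2 := T.diam_carrier_le
  -- The cone contains the ball of radius `c t` around `a + t e`, so the boundary stays outside it
  -- and the cube `T` cannot be small.
  have h3 : c * t < dist (a + t • e) b := by
    by_contra! h
    refine frontier_notMem_of_isOpen hD hb ?_
    have := hcone' (b - (a + t • e)) (by rwa [← dist_eq_norm, dist_comm])
    rwa [add_sub_cancel] at this
  have h4 := dist_triangle (a + t • e) x₂ b
  have h5 : c * min (Q.side / 4) r₀ ≤ c * t :=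
    mul_le_mul_of_nonneg_left (min_le_min_right _ (by linarith)) hc.le
  have h6 : (d : ℝ) * T.side ≤ d * S.side := by gcongr
  linarith

end Reflection

/-! ### Mean deviations and comparison of approximating polynomials. -/

section MeanDeviation

variable {d : ℕ} {f : Euc d → ℝ}

lemma setLIntegral_le_of_meanDev_le {P : MvPolynomial (Fin d) ℝ} {Q : AxisCube d} {B : ℝ}
    (h : meanDev f P Q ≤ ENNReal.ofReal B) :
    ∫⁻ x in Q.carrier, ‖f x - polyVal P x‖ₑ ≤ ENNReal.ofReal (Q.side ^ d * B) := by
  have h1 : ∫⁻ x in Q.carrier, ‖f x - polyVal P x‖ₑ = volume Q.carrier * meanDev f P Q := by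
    rw [meanDev, ← mul_assoc, ENNReal.mul_inv_cancel Q.volume_carrier_ne_zero
      Q.volume_carrier_ne_top, one_mul]
  rw [h1, ENNReal.ofReal_mul (pow_nonneg Q.side_pos.le d), Q.volume_carrier]
  gcongr

lemma meanDev_le_of_setLIntegral_le {P : MvPolynomial (Fin d) ℝ} {Q : AxisCube d} {B : ℝ}
    (h : ∫⁻ x in Q.carrier, ‖f x - polyVal P x‖ₑ ≤ ENNReal.ofReal (Q.side ^ d * B)) :
    meanDev f P Q ≤ ENNReal.ofReal B := by
  rw [ENNReal.ofReal_mul (pow_nonneg Q.side_pos.le d), ← Q.volume_carrier] at h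
  rw [meanDev]
  calc _ ≤ (volume Q.carrier)⁻¹ * (volume Q.carrier * ENNReal.ofReal B) := by gcongr
    _ = _ := by
      rw [← mul_assoc, ENNReal.inv_mul_cancel Q.volume_carrier_ne_zero Q.volume_carrier_ne_top,
        one_mul]

/-- Strictness of `hM` yields a polynomial below the bound without showing that the infimum is
attained. -/
lemma exists_meanDev_le {ω : ℝ → ℝ} {n : ℕ} {D : Set (Euc d)} {M : ℝ}
    (hpos : ∀ t, 0 < t → 0 < ω t) (hM : zygIntSeminorm ω n D f < ENNReal.ofReal M)
    {Q : AxisCube d} (hQ : (Q.scale 2 two_pos).carrier ⊆ D) :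
    ∃ P : MvPolynomial (Fin d) ℝ, P.totalDegree ≤ n ∧
      meanDev f P Q ≤ ENNReal.ofReal (M * ω Q.side) := by
  have h : cubeOsc ω n f Q < ENNReal.ofReal M :=
    (le_iSup₂ (f := fun (Q : AxisCube d) (_ : (Q.scale 2 two_pos).carrier ⊆ D) =>
      cubeOsc ω n f Q) Q hQ).trans_lt hM
  simp only [cubeOsc, iInf_lt_iff] at h
  obtain ⟨P, hP, h⟩ := h
  refine ⟨P, hP, ?_⟩
  have hω := hpos Q.side Q.side_pos
  have hω0 : ENNReal.ofReal (ω Q.side) ≠ 0 := by simpa using hω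
  rw [ENNReal.ofReal_mul' hω.le]
  calc meanDev f P Q = (ENNReal.ofReal (ω Q.side))⁻¹ * meanDev f P Q * ENNReal.ofReal (ω Q.side) := by
        rw [mul_comm, ← mul_assoc, ENNReal.mul_inv_cancel hω0 ENNReal.ofReal_ne_top, one_mul]
    _ ≤ _ := by gcongr

/-- Two polynomials that approximate `f` on cubes with a large common part are close. -/
lemma exists_polyVal_sub_le (d n : ℕ) :
    ∃ C : ℝ, 0 < C ∧ ∀ (f : Euc d → ℝ) (E Q₁ Q₂ : AxisCube d) (P₁ P₂ : MvPolynomial (Fin d) ℝ)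
      (K B₁ B₂ : ℝ), AEStronglyMeasurable f (volume.restrict E.carrier) →
      E.carrier ⊆ Q₁.carrier → E.carrier ⊆ Q₂.carrier → Q₁.side ≤ K * E.side →
      Q₂.side ≤ K * E.side → P₁.totalDegree ≤ n → P₂.totalDegree ≤ n → 0 ≤ B₁ → 0 ≤ B₂ →
      meanDev f P₁ Q₁ ≤ ENNReal.ofReal B₁ → meanDev f P₂ Q₂ ≤ ENNReal.ofReal B₂ →
      ∀ x, |polyVal P₁ x - polyVal P₂ x| ≤
        C * (K ^ d * (B₁ + B₂)) * (1 + ‖x - E.center‖ / E.side) ^ n := by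
  obtain ⟨C, hC, h⟩ := exists_polyVal_le_mean d n
  refine ⟨C, hC, fun f E Q₁ Q₂ P₁ P₂ K B₁ B₂ hf hE₁ hE₂ hK₁ hK₂ hP₁ hP₂ hB₁ hB₂ h₁ h₂ x => ?_⟩
  have hEs := E.side_pos
  have hK : 0 ≤ K := by
    by_contra! hneg
    nlinarith [Q₁.side_pos]
  have hbd : ∀ (Q : AxisCube d) (P : MvPolynomial (Fin d) ℝ) (B : ℝ), 0 ≤ B →
      E.carrier ⊆ Q.carrier → Q.side ≤ K * E.side → meanDev f P Q ≤ ENNReal.ofReal B →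
      ∫⁻ x in E.carrier, ‖f x - polyVal P x‖ₑ ≤ ENNReal.ofReal (E.side ^ d * (K ^ d * B)) := by
    intro Q P B hB hE hKQ hQ
    refine (lintegral_mono_set hE).trans ((setLIntegral_le_of_meanDev_le hQ).trans ?_)
    apply ENNReal.ofReal_le_ofReal
    have : Q.side ^ d ≤ (K * E.side) ^ d := pow_le_pow_left₀ Q.side_pos.le hKQ d
    rw [mul_pow] at this
    nlinarith
  rw [← polyVal_sub]
  refine h (P₁ - P₂) (totalDegree_sub_le_of_le hP₁ hP₂) E _ (by positivity) ?_ x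
  have hmain : ∫⁻ x in E.carrier, ‖polyVal (P₁ - P₂) x‖ₑ ≤
      ENNReal.ofReal (E.side ^ d * (K ^ d * (B₁ + B₂))) := by
    calc ∫⁻ x in E.carrier, ‖polyVal (P₁ - P₂) x‖ₑ
        ≤ ∫⁻ x in E.carrier, (‖f x - polyVal P₁ x‖ₑ + ‖f x - polyVal P₂ x‖ₑ) := by
          refine lintegral_mono fun x => ?_
          have : polyVal (P₁ - P₂) x = (f x - polyVal P₂ x) - (f x - polyVal P₁ x) := by
            rw [polyVal_sub]
            ring
          rw [this, add_comm]
          exact enorm_sub_le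
      _ = (∫⁻ x in E.carrier, ‖f x - polyVal P₁ x‖ₑ) +
            ∫⁻ x in E.carrier, ‖f x - polyVal P₂ x‖ₑ := by
          refine lintegral_add_left' ?_ _
          exact (hf.sub (continuous_polyVal P₁).aestronglyMeasurable).enorm
      _ ≤ ENNReal.ofReal (E.side ^ d * (K ^ d * B₁)) + ENNReal.ofReal (E.side ^ d * (K ^ d * B₂)) :=
          add_le_add (hbd Q₁ P₁ B₁ hB₁ hE₁ hK₁ h₁) (hbd Q₂ P₂ B₂ hB₂ hE₂ hK₂ h₂)
      _ = _ := by
          rw [← ENNReal.ofReal_add (by positivity) (by positivity)]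
          congr 1
          ring
  have := meanDev_le_of_setLIntegral_le (f := polyVal (P₁ - P₂)) (P := 0) (Q := E)
    (B := K ^ d * (B₁ + B₂)) (by simpa only [polyVal_zero, sub_zero] using hmain)
  simpa only [meanDev, polyVal_zero, sub_zero] using this

end MeanDeviation

/-! ### Chains of cubes in an interior cone. -/

section Chains

variable {d n : ℕ} {D : Set (Euc d)} {ω : ℝ → ℝ} {Cω r c r₀ : ℝ}

/-- `e` is the axis of interior cones of `D` with vertices in the `r₀`-neighbourhood of `a`. -/
def IsConeAxis (D : Set (Euc d)) (c r₀ : ℝ) (a e : Euc d) : Prop :=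
  ‖e‖ = 1 ∧ ∀ z ∈ closure D, ‖z - a‖ ≤ r₀ →
    ∀ t, 0 < t → t ≤ r₀ → ∀ v, ‖v‖ ≤ c * t → z + t • e + v ∈ D

lemma AxisCube.ball_subset_of_scale_two {T : AxisCube d} (hT : (T.scale 2 two_pos).carrier ⊆ D)
    {y : Euc d} (hy : ‖y - T.center‖ < T.side) : y ∈ D := by
  apply hT
  apply AxisCube.mem_carrier_of_norm_lt
  simp only [AxisCube.scale]
  linarith

lemma AxisCube.center_mem_of_scale_two {T : AxisCube d}
    (hT : (T.scale 2 two_pos).carrier ⊆ D) : T.center ∈ D :=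
  AxisCube.ball_subset_of_scale_two hT (by simpa using T.side_pos)

lemma AxisCube.exists_vec_of_mem_scale_two {z : Euc d} {s : ℝ} (hs : 0 < s) {y : Euc d}
    (hy : y ∈ ((AxisCube.mk z s hs).scale 2 two_pos).carrier) : ‖y - z‖ ≤ d * s := by
  have := AxisCube.norm_sub_center_le hy
  simp only [AxisCube.scale] at this
  linarith

/-- The cubes along the axis of the cone stay well inside of `D`. -/
lemma scale_two_axis_cube_subset (hd : 0 < d) (hc : 0 < c) (hc1 : c ≤ 1) {a e : Euc d}
    (hcone : IsConeAxis D c r₀ a e) {T : AxisCube d} (hT : (T.scale 2 two_pos).carrier ⊆ D)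
    (hTa : ‖T.center - a‖ ≤ r₀) {s : ℝ} (hs : T.side ≤ s) (hsr : s ≤ r₀)
    (hs0 : 0 < c / (4 * d) * s) :
    ((AxisCube.mk (T.center + (s - T.side) • e) (c / (4 * d) * s) hs0).scale 2
      two_pos).carrier ⊆ D := by
  have hd' : (1 : ℝ) ≤ d := by exact_mod_cast hd
  have hℓ := T.side_pos
  intro y hy
  have hv := AxisCube.exists_vec_of_mem_scale_two hs0 hy
  have hv' : ‖y - (T.center + (s - T.side) • e)‖ ≤ c * s / 4 := by
    refine hv.trans_eq ?_
    field_simp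
  set t := s - T.side with ht
  have hst : s = t + T.side := by rw [ht]; ring
  have ht0 : 0 ≤ t := by linarith
  -- For a small shift the cube remains in the ball of radius `T.side` about the centre of `T`.
  -- Otherwise `s < 3 t`, so its points deviate from the axis by less than `c t` and the cone
  -- applies.
  rcases le_or_gt t (T.side / 2) with htl | htl
  · apply AxisCube.ball_subset_of_scale_two hT
    have h1 : y - T.center = t • e + (y - (T.center + t • e)) := by abel
    rw [h1]
    refine (norm_add_le _ _).trans_lt ?_
    rw [norm_smul, hcone.1, Real.norm_of_nonneg ht0]
    nlinarith
  · have := hcone.2 T.center (subset_closure (AxisCube.center_mem_of_scale_two hT)) hTa t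
      (by linarith) (by linarith) (y - (T.center + t • e)) (by nlinarith)
    rwa [add_sub_cancel] at this

lemma scale_two_vertex_cube_subset (hd : 0 < d) (hc : 0 < c) {a e : Euc d}
    (ha : a ∈ frontier D) (hcone : IsConeAxis D c r₀ a e) {h : ℝ} (hh : 0 < h) (hr : h ≤ r₀)
    (hs0 : 0 < c / (4 * d) * h) :
    ((AxisCube.mk (a + h • e) (c / (4 * d) * h) hs0).scale 2 two_pos).carrier ⊆ D := by
  have hd' : (1 : ℝ) ≤ d := by exact_mod_cast hd
  intro y hy
  have hv := AxisCube.exists_vec_of_mem_scale_two hs0 hy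
  have hv' : ‖y - (a + h • e)‖ ≤ c * h / 4 := by
    refine hv.trans_eq ?_
    field_simp
  have := hcone.2 a (frontier_subset_closure ha) (by rw [sub_self, norm_zero]; linarith) h hh hr
    (y - (a + h • e)) (by nlinarith [mul_pos hc hh])
  rwa [add_sub_cancel] at this

set_option maxHeartbeats 1000000 in
/-- Along a chain of cubes in an interior cone, the near best polynomials at scale `T.side` and at
the scale `h` of the vertex cube differ by `O(ω(h))` near `T`. -/
lemma exists_chain_bound (hd : 0 < d) (hω : ModulusBounds ω n Cω r) (hc : 0 < c) (hc1 : c ≤ 1)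
    {K C₁ : ℝ} (hK : 1 ≤ K) (hC₁ : 0 ≤ C₁) :
    ∃ C : ℝ, 0 ≤ C ∧ ∀ (f : Euc d → ℝ) (M : ℝ), 0 ≤ M →
      AEStronglyMeasurable f (volume.restrict D) → zygIntSeminorm ω n D f < ENNReal.ofReal M →
      ∀ a e, a ∈ frontier D → IsConeAxis D c r₀ a e → ∀ (h : ℝ) (_ : 0 < h)
        (hκh : 0 < c / (4 * d) * h), h ≤ r₀ →
      ∀ pS : MvPolynomial (Fin d) ℝ, pS.totalDegree ≤ n →
        meanDev f pS ⟨a + h • e, c / (4 * d) * h, hκh⟩ ≤ ENNReal.ofReal (M * ω h) →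
      ∀ T : AxisCube d, (T.scale 2 two_pos).carrier ⊆ D →
        ‖T.center - a‖ + T.side ≤ c / (4 * d) * h / 16 →
      ∀ pT : MvPolynomial (Fin d) ℝ, pT.totalDegree ≤ n →
        meanDev f pT T ≤ ENNReal.ofReal (C₁ * M * ω T.side) →
      ∀ x, ‖x - T.center‖ ≤ K * T.side → |polyVal pT x - polyVal pS x| ≤ C * M * ω h := by
  have hd' : (1 : ℝ) ≤ d := by exact_mod_cast hd
  set κ : ℝ := c / (4 * d) with hκ
  have hκ0 : 0 < κ := by positivity
  have hκ1 : κ ≤ 1 := by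
    rw [hκ, div_le_one (by positivity)]
    linarith
  -- The ratio is so close to `1` that consecutive centres, `(κ / 16) s j` apart, are close compared
  -- with the sides `κ s j`.
  set l : ℝ := 1 + κ / 16 with hl
  have hl1 : 1 < l := by linarith
  have hl2 : l ≤ 2 := by linarith
  have hκl : κ * l ≤ 2 := by nlinarith
  obtain ⟨Cp, hCp, hcmp⟩ := exists_polyVal_sub_le d n
  obtain ⟨A₂, hA₂, hsum⟩ := hω.exists_sum_le hl1
  set A₁ : ℝ := Cp * (4 / κ) ^ d * (1 + 4 * K / κ) ^ n with hA₁
  have hA₁0 : 0 ≤ A₁ := by positivity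
  refine ⟨A₁ * (C₁ + 1) + 2 * A₁ * A₂ + 2 * A₁, by positivity, ?_⟩
  intro f M hM hf hfM a e ha hcone h hh hκh hhr pS hpS hpSd T hT hTa pT hpT hpTd x hx
  have hℓ := T.side_pos
  set z := T.center with hz
  set ℓ := T.side with hℓdef
  have hκhh : κ * h ≤ h := by nlinarith
  have hnza := norm_nonneg (z - a)
  have hℓh : ℓ ≤ h := by linarith
  have hTr : ‖z - a‖ ≤ r₀ := by linarith
  have cmp : ∀ (E Q₁ Q₂ : AxisCube d) (P₁ P₂ : MvPolynomial (Fin d) ℝ) (B₁ B₂ : ℝ),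
      (Q₁.scale 2 two_pos).carrier ⊆ D →
      E.carrier ⊆ Q₁.carrier → E.carrier ⊆ Q₂.carrier → Q₁.side ≤ 4 / κ * E.side →
      Q₂.side ≤ 4 / κ * E.side → P₁.totalDegree ≤ n → P₂.totalDegree ≤ n → 0 ≤ B₁ → 0 ≤ B₂ →
      meanDev f P₁ Q₁ ≤ ENNReal.ofReal B₁ → meanDev f P₂ Q₂ ≤ ENNReal.ofReal B₂ →
      ‖x - E.center‖ ≤ 4 * K / κ * E.side →
      |polyVal P₁ x - polyVal P₂ x| ≤ A₁ * (B₁ + B₂) := by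
    intro E Q₁ Q₂ P₁ P₂ B₁ B₂ hQ₁ hE₁ hE₂ hK₁ hK₂ hP₁ hP₂ hB₁ hB₂ h₁ h₂ hxE
    have hED : E.carrier ⊆ D :=
      hE₁.trans ((Q₁.carrier_subset_scale two_pos one_le_two).trans hQ₁)
    refine (hcmp f E Q₁ Q₂ P₁ P₂ (4 / κ) B₁ B₂ (hf.mono_set hED) hE₁ hE₂ hK₁ hK₂ hP₁ hP₂ hB₁ hB₂
      h₁ h₂ x).trans ?_
    have h3 : (1 + ‖x - E.center‖ / E.side) ^ n ≤ (1 + 4 * K / κ) ^ n := by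
      have : 0 ≤ ‖x - E.center‖ / E.side := div_nonneg (norm_nonneg _) E.side_pos.le
      refine pow_le_pow_left₀ (by linarith) ?_ n
      have : ‖x - E.center‖ / E.side ≤ 4 * K / κ := by
        rwa [div_le_iff₀ E.side_pos]
      linarith
    calc _ ≤ Cp * ((4 / κ) ^ d * (B₁ + B₂)) * (1 + 4 * K / κ) ^ n := by gcongr
      _ = A₁ * (B₁ + B₂) := by rw [hA₁]; ring
  have hone : (1 : ℝ) ≤ 4 / κ := by
    rw [le_div_iff₀ hκ0]
    linarith
  -- the chain
  obtain ⟨J, hJ1, hJ2⟩ := exists_nat_pow_near (x := h / ℓ) ((one_le_div hℓ).2 hℓh) hl1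
  rw [le_div_iff₀ hℓ] at hJ1
  rw [div_lt_iff₀ hℓ] at hJ2
  set s : ℕ → ℝ := fun j => l ^ j * ℓ with hs
  have hs0 : ∀ j, 0 < s j := fun j => by positivity
  have hsℓ : ∀ j, ℓ ≤ s j := fun j => le_mul_of_one_le_left hℓ.le (one_le_pow₀ hl1.le)
  have hss : ∀ j, s (j + 1) = l * s j := fun j => by simp only [hs, pow_succ]; ring
  have hsJ : ∀ j ≤ J, s j ≤ s J := fun j hj =>
    mul_le_mul_of_nonneg_right (pow_le_pow_right₀ hl1.le hj) hℓ.le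
  have hsh : ∀ j ≤ J, s j ≤ h := fun j hj => (hsJ j hj).trans hJ1
  have hJ2' : h < l * s J := by rw [← hss]; exact hJ2
  have hκs : ∀ j, 0 < κ * s j := fun j => mul_pos hκ0 (hs0 j)
  set Qc : ℕ → AxisCube d := fun j => ⟨z + (s j - ℓ) • e, κ * s j, hκs j⟩ with hQc
  have hQD : ∀ j ≤ J, ((Qc j).scale 2 two_pos).carrier ⊆ D := fun j hj =>
    scale_two_axis_cube_subset hd hc hc1 hcone hT hTr (hsℓ j) ((hsh j hj).trans hhr) (hκs j)
  have hexP : ∀ j, ∃ P : MvPolynomial (Fin d) ℝ, P.totalDegree ≤ n ∧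
      (j ≤ J → meanDev f P (Qc j) ≤ ENNReal.ofReal (M * ω (s j))) := by
    intro j
    by_cases hj : j ≤ J
    · obtain ⟨P, hP, hPd⟩ := exists_meanDev_le hω.pos hfM (hQD j hj)
      refine ⟨P, hP, fun _ => hPd.trans (ENNReal.ofReal_le_ofReal ?_)⟩
      refine mul_le_mul_of_nonneg_left (hω.mono _ _ (hκs j).le ?_) hM
      simp only [hQc]
      nlinarith [hs0 j]
    · exact ⟨0, by simp, fun h => absurd h hj⟩
  choose p hp hpd using hexP
  -- The point `x` stays within a bounded multiple of the current size, so each comparison of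
  -- polynomials at `x` costs the same factor `A₁`.
  have hxc : ∀ j, ‖x - (z + (s j - ℓ) • e)‖ ≤ K * s j := by
    intro j
    have h1 : x - (z + (s j - ℓ) • e) = (x - z) - (s j - ℓ) • e := by abel
    rw [h1]
    refine (norm_sub_le _ _).trans ?_
    rw [norm_smul, hcone.1, Real.norm_of_nonneg (by linarith [hsℓ j])]
    nlinarith [hsℓ j]
  have hMω : ∀ j, 0 ≤ M * ω (s j) := fun j => mul_nonneg hM (hω.pos _ (hs0 j)).le
  have hωh := hω.pos h hh
  have hωs : ∀ j ≤ J, ω (s j) ≤ ω h := fun j hj => hω.mono _ _ (hs0 j).le (hsh j hj)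
  -- the first link
  have hs00 : s 0 = ℓ := by simp [hs]
  have b1 : |polyVal pT x - polyVal (p 0) x| ≤ A₁ * ((C₁ * M * ω ℓ) + M * ω (s 0)) := by
    refine cmp (Qc 0) T (Qc 0) pT (p 0) _ _ hT ?_ subset_rfl ?_ ?_ hpT (hp 0)
      (mul_nonneg (mul_nonneg hC₁ hM) (hω.pos _ hℓ).le) (hMω 0) hpTd (hpd 0 (Nat.zero_le _)) ?_
    · apply AxisCube.carrier_subset_of_norm_le
      simp only [hQc, hs00, sub_self, zero_smul, add_zero, ← hz, norm_zero, zero_add, ← hℓdef]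
      nlinarith
    · simp only [hQc, hs00, ← hℓdef]
      rw [show 4 / κ * (κ * ℓ) = 4 * ℓ by field_simp]
      linarith
    · exact le_mul_of_one_le_left (Qc 0).side_pos.le hone
    · refine (hxc 0).trans ?_
      simp only [hQc]
      rw [show 4 * K / κ * (κ * s 0) = 4 * (K * s 0) by field_simp]
      nlinarith [hs0 0]
  -- the intermediate links
  have b2 : ∀ j < J, |polyVal (p (j + 1)) x - polyVal (p j) x| ≤ 2 * A₁ * M * ω (s (j + 1)) := by
    intro j hj
    have hjs := hs0 j
    have h1 : |polyVal (p (j + 1)) x - polyVal (p j) x| ≤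
        A₁ * (M * ω (s (j + 1)) + M * ω (s j)) := by
      refine cmp ⟨z + (s j - ℓ) • e, κ * s j / 2, by positivity⟩ (Qc (j + 1)) (Qc j) _ _ _ _
        (hQD (j + 1) hj) ?_ ?_ ?_ ?_ (hp _) (hp _) (hMω _) (hMω _) (hpd (j + 1) hj)
        (hpd j hj.le) ?_
      · apply AxisCube.carrier_subset_of_norm_le
        simp only [hQc]
        have h2 : z + (s j - ℓ) • e - (z + (s (j + 1) - ℓ) • e) = -((s (j + 1) - s j) • e) := by
          rw [sub_smul, sub_smul, sub_smul]
          abel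
        rw [h2, norm_neg, norm_smul, hcone.1, hss, Real.norm_of_nonneg (by nlinarith), hl]
        nlinarith [mul_pos hκ0 hjs, mul_pos hκ0 (mul_pos hκ0 hjs)]
      · apply AxisCube.carrier_subset_of_norm_le
        simp only [hQc, sub_self, norm_zero]
        nlinarith [mul_pos hκ0 hjs]
      · simp only [hQc, hss]
        rw [show 4 / κ * (κ * s j / 2) = 2 * s j by field_simp; ring, ← mul_assoc]
        exact mul_le_mul_of_nonneg_right hκl hjs.le
      · simp only [hQc]
        rw [show 4 / κ * (κ * s j / 2) = 2 * s j by field_simp; ring]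
        nlinarith
      · refine (hxc j).trans ?_
        simp only
        rw [show 4 * K / κ * (κ * s j / 2) = 2 * (K * s j) by field_simp; ring]
        nlinarith
    have h2 : ω (s j) ≤ ω (s (j + 1)) := hω.mono _ _ hjs.le (by rw [hss]; nlinarith)
    have h3 : M * ω (s j) ≤ M * ω (s (j + 1)) := mul_le_mul_of_nonneg_left h2 hM
    nlinarith
  have b3 : |polyVal (p J) x - polyVal (p 0) x| ≤ 2 * A₁ * A₂ * M * ω h := by
    rw [← Finset.sum_range_sub (fun j => polyVal (p j) x)]
    refine (Finset.abs_sum_le_sum_abs _ _).trans ?_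
    calc ∑ j ∈ Finset.range J, |polyVal (p (j + 1)) x - polyVal (p j) x|
        ≤ ∑ j ∈ Finset.range J, 2 * A₁ * M * ω (s (j + 1)) :=
          Finset.sum_le_sum fun j hj => b2 j (Finset.mem_range.1 hj)
      _ = 2 * A₁ * M * ∑ j ∈ Finset.range J, ω (s (j + 1)) := by rw [Finset.mul_sum]
      _ ≤ 2 * A₁ * M * ∑ j ∈ Finset.range (J + 1), ω (s j) := by
          refine mul_le_mul_of_nonneg_left ?_ (by positivity)
          rw [Finset.sum_range_succ']
          linarith [hω.pos _ (hs0 0)]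
      _ ≤ 2 * A₁ * M * (A₂ * ω (s J)) :=
          mul_le_mul_of_nonneg_left (hsum J ℓ hℓ) (by positivity)
      _ ≤ 2 * A₁ * M * (A₂ * ω h) := by
          have := hωs J le_rfl
          gcongr
      _ = _ := by ring
  -- the last link
  have b4 : |polyVal (p J) x - polyVal pS x| ≤ A₁ * (M * ω (s J) + M * ω h) := by
    -- The centres of the last chain cube and the vertex cube are at most `κ h / 8` apart: `κ h /
    -- 16` comes from `T` and `κ h / 16` from `h - s J`. A cube of side `κ h / 4` about the former
    -- therefore fits into both.
    have hsJh : h ≤ 2 * s J := by nlinarith [hs0 J]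
    refine cmp ⟨z + (s J - ℓ) • e, κ * h / 4, by positivity⟩ (Qc J) ⟨a + h • e, κ * h, hκh⟩ _ _ _ _
        (hQD J le_rfl) ?_ ?_ ?_ ?_ (hp _) hpS (hMω _) (by positivity) (hpd J le_rfl) hpSd ?_
    · apply AxisCube.carrier_subset_of_norm_le
      simp only [hQc, sub_self, norm_zero]
      nlinarith
    · apply AxisCube.carrier_subset_of_norm_le
      simp only
      have h2 : z + (s J - ℓ) • e - (a + h • e) = (z - a) - (ℓ + (h - s J)) • e := by
        rw [sub_smul, add_smul, sub_smul]
        abel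
      have h3 : h - s J ≤ κ / 16 * h := by
        have := hsh J le_rfl
        nlinarith
      have h4 : 0 ≤ h - s J := by linarith [hsh J le_rfl]
      rw [h2]
      have h5 := norm_sub_le (z - a) ((ℓ + (h - s J)) • e)
      rw [norm_smul, hcone.1, Real.norm_of_nonneg (by linarith)] at h5
      linarith
    · simp only [hQc]
      rw [show 4 / κ * (κ * h / 4) = h by field_simp]
      nlinarith [hsh J le_rfl, hs0 J]
    · simp only
      rw [show 4 / κ * (κ * h / 4) = h by field_simp]
      linarith
    · refine (hxc J).trans ?_
      simp only
      rw [show 4 * K / κ * (κ * h / 4) = K * h by field_simp]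
      nlinarith [hsh J le_rfl]
  have hωℓ : ω ℓ ≤ ω h := hω.mono _ _ hℓ.le hℓh
  have h0 := hωs 0 (Nat.zero_le _)
  have hJ' := hωs J le_rfl
  calc |polyVal pT x - polyVal pS x|
      = |(polyVal pT x - polyVal (p 0) x) - (polyVal (p J) x - polyVal (p 0) x)
          + (polyVal (p J) x - polyVal pS x)| := by congr 1; ring
    _ ≤ |polyVal pT x - polyVal (p 0) x| + |polyVal (p J) x - polyVal (p 0) x|
          + |polyVal (p J) x - polyVal pS x| :=
        (abs_add_le _ _).trans (by gcongr; exact abs_sub _ _)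
    _ ≤ A₁ * ((C₁ * M * ω h) + M * ω h) + 2 * A₁ * A₂ * M * ω h + A₁ * (M * ω h + M * ω h) := by
        refine add_le_add (add_le_add (b1.trans ?_) b3) (b4.trans ?_)
        · gcongr
        · gcongr
    _ = _ := by ring

end Chains

/-! ### One polynomial near a boundary point at each scale. -/

section Setup

/-- The geometric data of the Whitney extension, with the constants of the interior cones and of
the modulus of continuity. -/
structure ExtensionSetup {d : ℕ} (D : Set (Euc d)) (W W' : Set (AxisCube d))
    (ψ : AxisCube d → Euc d → ℝ) (refl : AxisCube d → AxisCube d) (ω : ℝ → ℝ) (n : ℕ)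
    (R c r₀ Cω r : ℝ) : Prop where
  hd : 0 < d
  isOpen : IsOpen D
  bounded : Bornology.IsBounded D
  R_pos : 0 < R
  c_pos : 0 < c
  c_le : c ≤ 1
  r₀_pos : 0 < r₀
  cones : HasInteriorCones D c r₀
  frontier_nonempty : (frontier D).Nonempty
  frontier_eq : frontier (closure D)ᶜ = frontier D
  volume_frontier : volume (frontier D) = 0
  modulus : ModulusBounds ω n Cω r
  whitney : IsWhitneyCovering D W
  whitney' : IsWhitneyCovering (closure D)ᶜ W'
  partition : IsWhitneyPartition (closure D)ᶜ W' ψ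
  reflective : ∀ Q ∈ W', Q.side ≤ R → IsReflective D W Q (refl Q)

/-- A function in the interior space, with interior seminorm less than `M`, and near best
polynomials on the reflective cubes. -/
structure ExtensionData {d : ℕ} (D : Set (Euc d)) (W' : Set (AxisCube d))
    (refl : AxisCube d → AxisCube d) (ω : ℝ → ℝ) (n : ℕ) (R : ℝ) (C₀ : ℝ≥0) (f : Euc d → ℝ)
    (P : AxisCube d → MvPolynomial (Fin d) ℝ) (M : ℝ) : Prop where
  nonneg : 0 ≤ M
  meas : AEStronglyMeasurable f (volume.restrict D)
  seminorm_lt : zygIntSeminorm ω n D f < ENNReal.ofReal M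
  degree : ∀ Q ∈ W', Q.side ≤ R → (P (refl Q)).totalDegree ≤ n
  near : ∀ Q ∈ W', Q.side ≤ R →
    meanDev f (P (refl Q)) (refl Q) ≤ ENNReal.ofReal (C₀ * M * ω (refl Q).side)

variable {d n : ℕ} {D : Set (Euc d)} {W W' : Set (AxisCube d)}
  {ψ : AxisCube d → Euc d → ℝ} {refl : AxisCube d → AxisCube d} {ω : ℝ → ℝ}
  {R c r₀ Cω r : ℝ} {C₀ : ℝ≥0} {f : Euc d → ℝ} {P : AxisCube d → MvPolynomial (Fin d) ℝ} {M : ℝ}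

lemma IsNearBest.meanDev_le_ofReal {Q : AxisCube d} {p : MvPolynomial (Fin d) ℝ}
    (h : IsNearBest ω n D C₀ f Q p) (hM : zygIntSeminorm ω n D f ≤ ENNReal.ofReal M)
    (hω : 0 ≤ ω Q.side) :
    meanDev f p Q ≤ ENNReal.ofReal (C₀ * M * ω Q.side) := by
  refine h.2.trans ?_
  calc (C₀ : ℝ≥0∞) * ENNReal.ofReal (ω Q.side) * zygIntSeminorm ω n D f
      ≤ C₀ * ENNReal.ofReal (ω Q.side) * ENNReal.ofReal M := by gcongr
    _ = ENNReal.ofReal (C₀ * M * ω Q.side) := by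
      rw [ENNReal.ofReal_mul' hω, ENNReal.ofReal_mul C₀.coe_nonneg, ENNReal.ofReal_coe_nnreal]
      ring

/-- Summation over the cubes of a Whitney covering close to a point. -/
lemma setLIntegral_le_of_forall_cube (hW : IsWhitneyCovering D W) {F : Set (AxisCube d)}
    (hF : F ⊆ W) {U : Set (Euc d)} (hU : U ⊆ ⋃ Q ∈ F, Q.carrier) {B : AxisCube d}
    (hB : ∀ Q ∈ F, Q.carrier ⊆ B.carrier) {g : Euc d → ℝ≥0∞} {b : ℝ≥0∞}
    (hg : ∀ Q ∈ F, ∫⁻ x in Q.carrier, g x ≤ b * volume Q.carrier) :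
    ∫⁻ x in U, g x ≤ b * volume B.carrier := by
  have hcount : F.Countable := hW.countable.mono hF
  have hdisj : F.PairwiseDisjoint AxisCube.carrier := hW.disjoint.subset hF
  calc ∫⁻ x in U, g x ≤ ∫⁻ x in ⋃ Q ∈ F, Q.carrier, g x := lintegral_mono_set hU
    _ = ∑' Q : F, ∫⁻ x in (Q : AxisCube d).carrier, g x :=
        lintegral_biUnion hcount (fun Q _ => Q.measurableSet_carrier) hdisj _
    _ ≤ ∑' Q : F, b * volume (Q : AxisCube d).carrier :=
        ENNReal.tsum_le_tsum fun Q => hg Q Q.2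
    _ = b * volume (⋃ Q ∈ F, Q.carrier) := by
        rw [ENNReal.tsum_mul_left, measure_biUnion hcount hdisj fun Q _ => Q.measurableSet_carrier]
    _ ≤ b * volume B.carrier := by
        gcongr
        exact iUnion₂_subset hB

set_option maxHeartbeats 1600000 in
/-- Near a boundary point, at every small scale `h`, one polynomial approximates `f` inside of `D`
and all the polynomials of the reflective cubes. -/
lemma ExtensionSetup.exists_local_poly (S : ExtensionSetup D W W' ψ refl ω n R c r₀ Cω r)
    (C₀ : ℝ≥0) :
    ∃ η ε C : ℝ, 0 < η ∧ η ≤ 1 ∧ 0 < ε ∧ 0 ≤ C ∧ ∀ f P M,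
      ExtensionData D W' refl ω n R C₀ f P M → ∀ a ∈ frontier D, ∀ h, 0 < h → h ≤ ε →
      ∃ p : MvPolynomial (Fin d) ℝ, p.totalDegree ≤ n ∧
        ∫⁻ x in D ∩ Metric.closedBall a (η * h), ‖f x - polyVal p x‖ₑ ≤
          ENNReal.ofReal (C * M * ω h * h ^ d) ∧
        (∀ Q ∈ W', ∀ y₀ ∈ (Q.scale (5 / 4) (by norm_num)).carrier, dist y₀ a ≤ η * h →
          Q.side ≤ R ∧ ∀ y, ‖y - Q.center‖ ≤ 100 * (d : ℝ) ^ 2 * Q.side →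
            |polyVal (P (refl Q)) y - polyVal p y| ≤ C * M * ω h) ∧
        (∀ L : ℝ, 0 ≤ L → ∫⁻ x in D, ‖f x‖ₑ ≤ ENNReal.ofReal L → ∀ x, dist x a ≤ h →
          |polyVal p x| ≤ C * (L / h ^ d + M * ω h)) := by
  have hd' : (1 : ℝ) ≤ d := by exact_mod_cast S.hd
  have hd2 : (d : ℝ) ≤ (d : ℝ) ^ 2 := by nlinarith
  have hc := S.c_pos
  have hr₀ := S.r₀_pos
  have hR := S.R_pos
  set κ : ℝ := c / (4 * d) with hκ
  have hκ0 : 0 < κ := by positivity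
  have hκ1 : κ ≤ 1 := by
    rw [hκ, div_le_one (by positivity)]
    linarith [S.c_le]
  -- Chosen so that `240 d² η = κ / 16`, the smallness required by `exists_chain_bound`. A
  -- reflective cube satisfies `‖center - a‖ + side ≤ (108 d² + 4 d + 128 d) η h ≤ 240 d² η h`.
  set η : ℝ := κ / (3840 * (d : ℝ) ^ 2) with hη
  have hη0 : 0 < η := by positivity
  have hηκ : 240 * (d : ℝ) ^ 2 * η = κ / 16 := by
    rw [hη]
    field_simp
    norm_num
  have hη1 : η ≤ 1 / 3840 := by
    rw [hη]
    apply div_le_div₀ zero_le_one hκ1 (by norm_num)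
    nlinarith
  set ε : ℝ := min r₀ R with hε
  have hε0 : 0 < ε := by positivity
  -- The first factor bounds the distance from `y` to the reflective centre in units of the side of
  -- `Q`. The second bounds the side of `Q` by that of its reflective cube.
  set K : ℝ := (100 * (d : ℝ) ^ 2 + 27 * d ^ 2) * (24 * d / c) with hK
  have hK1 : 1 ≤ K := by
    have h1 : (1 : ℝ) ≤ 24 * d / c := by
      rw [le_div_iff₀ hc]
      linarith [S.c_le]
    have h2 : (1 : ℝ) ≤ 100 * (d : ℝ) ^ 2 + 27 * d ^ 2 := by nlinarith
    exact one_le_mul_of_one_le_of_one_le h2 h1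
  obtain ⟨C₁, hC₁, hch₁⟩ := exists_chain_bound (D := D) (r₀ := r₀) (n := n) S.hd S.modulus hc S.c_le
    (K := d) (C₁ := 1) hd' zero_le_one
  obtain ⟨C₂, hC₂, hch₂⟩ := exists_chain_bound (D := D) (r₀ := r₀) (n := n) S.hd S.modulus hc S.c_le
    (K := K) (C₁ := C₀) hK1 C₀.2
  obtain ⟨C₃, hC₃, hmean⟩ := exists_polyVal_le_mean d n
  set C₄ : ℝ := C₃ * (1 / κ) ^ d * (1 + 2 / κ) ^ n with hC₄
  have hC₄0 : 0 ≤ C₄ := by positivity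
  refine ⟨η, ε, (1 + C₁) + C₂ + C₄ , hη0, by linarith, hε0, by positivity, ?_⟩
  intro f P M hf a ha h hh hhε
  have hM := hf.nonneg
  obtain ⟨e, hcone⟩ := S.cones a ha
  have hcone : IsConeAxis D c r₀ a e := hcone
  have hhr : h ≤ r₀ := hhε.trans (min_le_left _ _)
  have hhR : h ≤ R := hhε.trans (min_le_right _ _)
  have hκh : 0 < κ * h := by positivity
  have hωh := S.modulus.pos h hh
  have hSD := scale_two_vertex_cube_subset S.hd hc ha hcone hh hhr hκh
  obtain ⟨p, hp, hpd⟩ := exists_meanDev_le S.modulus.pos hf.seminorm_lt hSD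
  have hpd' : meanDev f p ⟨a + h • e, κ * h, hκh⟩ ≤ ENNReal.ofReal (M * ω h) := by
    refine hpd.trans (ENNReal.ofReal_le_ofReal ?_)
    refine mul_le_mul_of_nonneg_left (S.modulus.mono _ _ hκh.le ?_) hM
    exact mul_le_of_le_one_left hh.le hκ1
  have hηh : 0 < η * h := by positivity
  have hκh16 : κ * h / 16 = 240 * (d : ℝ) ^ 2 * (η * h) := by
    rw [show 240 * (d : ℝ) ^ 2 * (η * h) = 240 * (d : ℝ) ^ 2 * η * h by ring, hηκ]
    ring
  have hdη : (d : ℝ) * (η * h) ≤ d ^ 2 * (η * h) := mul_le_mul_of_nonneg_right hd2 hηh.le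
  have h1η : η * h ≤ d * (η * h) := le_mul_of_one_le_left hηh.le hd'
  refine ⟨p, hp, ?_, ?_, ?_⟩
  -- Inside `D`: on each Whitney cube near `a`, `f` is compared with its own near best polynomial,
  -- and this one with `p` by a chain. The disjoint cubes all fit into the cube of side `h` about
  -- `a`.
  · set F : Set (AxisCube d) := {Q ∈ W | (Q.carrier ∩ Metric.closedBall a (η * h)).Nonempty}
      with hF
    have hgeo : ∀ Q ∈ F, Q.side ≤ 2 * (η * h) ∧ ‖Q.center - a‖ ≤ 2 * d * (η * h) := by
      rintro Q ⟨hQ, x, hxQ, hxa⟩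
      rw [Metric.mem_closedBall] at hxa
      have h1 := S.whitney.diam_le_dist hQ hxQ ha
      have h2 := Q.half_side_le_diam S.hd
      have h3 : Q.side ≤ 2 * (η * h) := by linarith
      refine ⟨h3, ?_⟩
      have h4 := AxisCube.norm_sub_center_le hxQ
      rw [← dist_eq_norm] at h4 ⊢
      have h5 := dist_triangle_left Q.center a x
      have h6 : (d : ℝ) * (Q.side / 2) ≤ d * (η * h) := by
        gcongr
        linarith
      linarith
    have hbd := setLIntegral_le_of_forall_cube S.whitney (F := F) (fun Q hQ => hQ.1)
      (U := D ∩ Metric.closedBall a (η * h)) (B := ⟨a, h, hh⟩)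
      (g := fun x => ‖f x - polyVal p x‖ₑ) (b := ENNReal.ofReal ((1 + C₁) * (M * ω h))) ?_ ?_ ?_
    · refine hbd.trans ?_
      rw [AxisCube.volume_carrier, ← ENNReal.ofReal_mul (by positivity)]
      apply ENNReal.ofReal_le_ofReal
      have h1 : 0 ≤ (C₂ + C₄) * (M * ω h * h ^ d) := by positivity
      nlinarith
    · rintro x ⟨hxD, hxa⟩
      obtain ⟨Q, hQ, hxQ⟩ := S.whitney.exists_mem hxD
      exact mem_biUnion (show Q ∈ F from ⟨hQ, x, hxQ, hxa⟩) hxQ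
    · intro Q hQ
      obtain ⟨h1, h2⟩ := hgeo Q hQ
      apply AxisCube.carrier_subset_of_norm_le
      simp only
      have : 240 * (d : ℝ) ^ 2 * (η * h) ≤ h / 16 := by
        rw [← hκh16]
        gcongr
        exact mul_le_of_le_one_left hh.le hκ1
      linarith
    · intro Q hQ
      obtain ⟨h1, h2⟩ := hgeo Q hQ
      have h2Q := S.whitney.scale_two_subset S.isOpen S.hd hQ.1
      obtain ⟨pQ, hpQ, hpQd⟩ := exists_meanDev_le S.modulus.pos hf.seminorm_lt h2Q
      have hbd := hch₁ f M hM hf.meas hf.seminorm_lt a e ha hcone h hh hκh hhr p hp hpd' Q h2Q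
        (by rw [hκh16]; linarith) pQ hpQ (by rwa [one_mul])
      have hωQ : ω Q.side ≤ ω h := S.modulus.mono _ _ Q.side_pos.le (by nlinarith)
      calc ∫⁻ x in Q.carrier, ‖f x - polyVal p x‖ₑ
          ≤ ∫⁻ x in Q.carrier, (‖f x - polyVal pQ x‖ₑ + ENNReal.ofReal (C₁ * M * ω h)) := by
            refine setLIntegral_mono' Q.measurableSet_carrier fun x hx => ?_
            have h3 : f x - polyVal p x = (f x - polyVal pQ x) + (polyVal pQ x - polyVal p x) := by
              ring
            rw [h3]
            refine (enorm_add_le _ _).trans ?_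
            gcongr
            rw [Real.enorm_eq_ofReal_abs]
            apply ENNReal.ofReal_le_ofReal
            apply hbd
            refine (AxisCube.norm_sub_center_le hx).trans ?_
            gcongr
            linarith [Q.side_pos]
        _ = (∫⁻ x in Q.carrier, ‖f x - polyVal pQ x‖ₑ) +
              ENNReal.ofReal (C₁ * M * ω h) * volume Q.carrier := by
            rw [lintegral_add_right _ measurable_const, setLIntegral_const]
        _ ≤ ENNReal.ofReal (M * ω h) * volume Q.carrier +
              ENNReal.ofReal (C₁ * M * ω h) * volume Q.carrier := by
            gcongr
            refine (setLIntegral_le_of_meanDev_le hpQd).trans ?_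
            rw [mul_comm, ENNReal.ofReal_mul' (pow_nonneg Q.side_pos.le d), Q.volume_carrier]
            gcongr
        _ = ENNReal.ofReal ((1 + C₁) * (M * ω h)) * volume Q.carrier := by
            rw [← add_mul, ← ENNReal.ofReal_add (by positivity) (by positivity)]
            congr 2
            ring
  -- Outside: exterior cubes near `a` have side at most `4 η h ≤ R`, so none of them is omitted from
  -- the extension, and the chain bound applies to their reflective cubes.
  · intro Q hQ y₀ hy₀ hy₀a
    have h1 := (S.whitney'.infDist_bounds S.hd hQ hy₀).1
    rw [S.frontier_eq] at h1
    have h2 := Metric.infDist_le_dist_of_mem (x := y₀) ha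
    have hside : Q.side ≤ 4 * (η * h) := by linarith
    have hQR : Q.side ≤ R := by nlinarith
    refine ⟨hQR, fun y hy => ?_⟩
    have hrefl := S.reflective Q hQ hQR
    obtain ⟨h3, h4⟩ := hrefl.upper_bounds S.hd S.whitney S.whitney' S.frontier_eq hQ
    have h5 := hrefl.lower_bound S.hd S.isOpen hc hr₀ S.cones S.whitney S.whitney' S.frontier_eq hQ
    rw [min_eq_left (by nlinarith)] at h5
    have h6 : Q.side ≤ 24 * d / c * (refl Q).side := by
      rw [div_mul_eq_mul_div, le_div_iff₀ hc]
      linarith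
    have h7 : ‖Q.center - a‖ ≤ 4 * d * (η * h) := by
      have h8 := AxisCube.norm_sub_center_le hy₀
      simp only [AxisCube.scale] at h8
      rw [← dist_eq_norm] at h8 ⊢
      have h9 := dist_triangle_left Q.center a y₀
      have h10 : (d : ℝ) * (5 / 4 * Q.side / 2) ≤ d * (5 / 4 * (4 * (η * h)) / 2) := by gcongr
      linarith
    have hbd : |polyVal (P (refl Q)) y - polyVal p y| ≤ C₂ * M * ω h := by
      refine hch₂ f M hM hf.meas hf.seminorm_lt a e ha hcone h hh hκh hhr p hp hpd' (refl Q)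
        (S.whitney.scale_two_subset S.isOpen S.hd hrefl.1.1) ?_ _ (hf.degree Q hQ hQR)
        (hf.near Q hQ hQR) y ?_
      · rw [hκh16]
        have h11 : ‖(refl Q).center - a‖ ≤ ‖(refl Q).center - Q.center‖ + ‖Q.center - a‖ := by
          simpa using norm_sub_le_norm_sub_add_norm_sub (refl Q).center Q.center a
        have h12 : 27 * (d : ℝ) ^ 2 * Q.side ≤ 27 * (d : ℝ) ^ 2 * (4 * (η * h)) := by gcongr
        have h13 : 32 * (d : ℝ) * Q.side ≤ 32 * (d : ℝ) * (4 * (η * h)) := by gcongr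
        linarith
      · have h11 : ‖y - (refl Q).center‖ ≤ ‖y - Q.center‖ + ‖(refl Q).center - Q.center‖ := by
          rw [norm_sub_rev (refl Q).center]
          simpa using norm_sub_le_norm_sub_add_norm_sub y Q.center (refl Q).center
        calc ‖y - (refl Q).center‖ ≤ (100 * (d : ℝ) ^ 2 + 27 * d ^ 2) * Q.side := by linarith
          _ ≤ (100 * (d : ℝ) ^ 2 + 27 * d ^ 2) * (24 * d / c * (refl Q).side) := by gcongr
          _ = K * (refl Q).side := by rw [hK]; ring
    refine hbd.trans ?_
    have : 0 ≤ ((1 + C₁) + C₄) * (M * ω h) := by positivity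
    nlinarith
  -- The mean of `p` on the vertex cube is at most that of `f` plus the deviation, and norm
  -- equivalence carries the bound over to the points within `h` of `a`.
  · intro L hL hfL x hx
    set Q : AxisCube d := ⟨a + h • e, κ * h, hκh⟩ with hQ
    have hQD : Q.carrier ⊆ D := (Q.carrier_subset_scale two_pos one_le_two).trans hSD
    have hB : (volume Q.carrier)⁻¹ * ∫⁻ x in Q.carrier, ‖polyVal p x‖ₑ ≤
        ENNReal.ofReal ((1 / κ) ^ d * (L / h ^ d + M * ω h)) := by
      have h1 : ∫⁻ x in Q.carrier, ‖polyVal p x‖ₑ ≤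
          ENNReal.ofReal (L + (κ * h) ^ d * (M * ω h)) := by
        calc ∫⁻ x in Q.carrier, ‖polyVal p x‖ₑ
            ≤ ∫⁻ x in Q.carrier, (‖f x‖ₑ + ‖f x - polyVal p x‖ₑ) := by
              refine lintegral_mono fun x => ?_
              have : polyVal p x = f x - (f x - polyVal p x) := by ring
              conv_lhs => rw [this]
              exact enorm_sub_le
          _ = (∫⁻ x in Q.carrier, ‖f x‖ₑ) + ∫⁻ x in Q.carrier, ‖f x - polyVal p x‖ₑ :=
              lintegral_add_left' (hf.meas.mono_set hQD).enorm _
          _ ≤ ENNReal.ofReal L + ENNReal.ofReal ((κ * h) ^ d * (M * ω h)) :=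
              add_le_add ((lintegral_mono_set hQD).trans hfL) (setLIntegral_le_of_meanDev_le hpd')
          _ = _ := (ENNReal.ofReal_add hL (by positivity)).symm
      have h2 := meanDev_le_of_setLIntegral_le (f := polyVal p) (P := 0) (Q := Q)
        (B := (1 / κ) ^ d * (L / h ^ d + M * ω h)) (by
          simp only [polyVal_zero, sub_zero]
          refine h1.trans (ENNReal.ofReal_le_ofReal ?_)
          simp only [hQ]
          have h3 : (κ * h) ^ d * ((1 / κ) ^ d * (L / h ^ d + M * ω h)) =
              L + h ^ d * (M * ω h) := by
            rw [mul_pow, one_div, inv_pow]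
            field_simp
          rw [h3, mul_pow]
          have h4 : κ ^ d ≤ 1 := pow_le_one₀ hκ0.le hκ1
          have h5 : 0 ≤ h ^ d * (M * ω h) := by positivity
          nlinarith)
      simpa only [meanDev, polyVal_zero, sub_zero] using h2
    refine (hmean p hp Q _ (by positivity) hB x).trans ?_
    have h3 : (1 + ‖x - Q.center‖ / Q.side) ^ n ≤ (1 + 2 / κ) ^ n := by
      have h4 : ‖x - Q.center‖ ≤ 2 * h := by
        have h5 : x - Q.center = (x - a) - h • e := by
          simp only [hQ]
          abel
        rw [h5]
        refine (norm_sub_le _ _).trans ?_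
        rw [norm_smul, hcone.1, Real.norm_of_nonneg hh.le, ← dist_eq_norm]
        linarith
      have h6 : ‖x - Q.center‖ / Q.side ≤ 2 / κ := by
        simp only [hQ] at h4 ⊢
        rw [div_le_div_iff₀ hκh hκ0]
        nlinarith
      have h7 : 0 ≤ ‖x - Q.center‖ / Q.side := div_nonneg (norm_nonneg _) Q.side_pos.le
      exact pow_le_pow_left₀ (by linarith) (by linarith) n
    have h8 : 0 ≤ L / h ^ d + M * ω h := by positivity
    calc _ ≤ C₃ * ((1 / κ) ^ d * (L / h ^ d + M * ω h)) * (1 + 2 / κ) ^ n := by gcongr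
      _ = C₄ * (L / h ^ d + M * ω h) := by rw [hC₄]; ring
      _ ≤ _ := by
        have : 0 ≤ ((1 + C₁) + C₂) * (L / h ^ d + M * ω h) := by positivity
        nlinarith

end Setup

/-! ### The extension outside of the closure: local finiteness, smoothness, boundedness. -/

section Exterior

variable {d n : ℕ} {D : Set (Euc d)} {W W' : Set (AxisCube d)}
  {ψ : AxisCube d → Euc d → ℝ} {refl : AxisCube d → AxisCube d} {ω : ℝ → ℝ}
  {R c r₀ Cω r : ℝ} {C₀ : ℝ≥0} {f : Euc d → ℝ} {P : AxisCube d → MvPolynomial (Fin d) ℝ} {M : ℝ}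

namespace IsWhitneyPartition

variable {G : Set (Euc d)}

lemma nonneg (h : IsWhitneyPartition G W ψ) {Q : AxisCube d} (hQ : Q ∈ W) (x : Euc d) :
    0 ≤ ψ Q x :=
  (indicator_nonneg (fun _ _ => zero_le_one) x).trans (h.lower Q hQ x)

lemma mem_of_ne_zero (h : IsWhitneyPartition G W ψ) {Q : AxisCube d} (hQ : Q ∈ W) {x : Euc d}
    (hx : ψ Q x ≠ 0) : x ∈ (Q.scale (5 / 4) (by norm_num)).carrier := by
  by_contra hmem
  have h1 := h.upper Q hQ x
  rw [indicator_of_notMem hmem] at h1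
  exact hx (le_antisymm h1 (h.nonneg hQ x))

end IsWhitneyPartition

/-- The cubes whose dilations come within `ρ / 2` of `x₀`. -/
def nearCubes (W : Set (AxisCube d)) (x₀ : Euc d) (ρ : ℝ) : Set (AxisCube d) :=
  {Q ∈ W | ∃ y ∈ (Q.scale (5 / 4) (by norm_num)).carrier, dist y x₀ ≤ ρ / 2}

/-- A connected set that meets `G` but not its boundary remains in `G`. -/
lemma closedBall_subset_of_lt_infDist {G : Set (Euc d)} (hG : IsOpen G) {x₀ : Euc d}
    (hx₀ : x₀ ∈ G) {s : ℝ} (hs : 0 ≤ s) (h : s < Metric.infDist x₀ (frontier G)) :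
    Metric.closedBall x₀ s ⊆ G := by
  refine (convex_closedBall x₀ s).isPreconnected.subset_of_closure_inter_subset hG
    ⟨x₀, Metric.mem_closedBall_self hs, hx₀⟩ ?_
  rintro w ⟨hwc, hw⟩
  by_contra hwG
  have hwf : w ∈ frontier G := by
    rw [hG.frontier_eq]
    exact ⟨hwc, hwG⟩
  have := Metric.infDist_le_dist_of_mem (x := x₀) hwf
  rw [Metric.mem_closedBall, dist_comm] at hw
  linarith

namespace ExtensionSetup

lemma infDist_pos (S : ExtensionSetup D W W' ψ refl ω n R c r₀ Cω r)
    {x : Euc d} (hx : x ∈ (closure D)ᶜ) :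
    0 < Metric.infDist x (frontier D) :=
  (isClosed_frontier.notMem_iff_infDist_pos S.frontier_nonempty).1
    fun h => hx (frontier_subset_closure h)

lemma closedBall_half_subset (S : ExtensionSetup D W W' ψ refl ω n R c r₀ Cω r)
    {x₀ : Euc d} (hx₀ : x₀ ∈ (closure D)ᶜ) :
    Metric.closedBall x₀ (Metric.infDist x₀ (frontier D) / 2) ⊆ (closure D)ᶜ := by
  have := S.infDist_pos hx₀
  apply closedBall_subset_of_lt_infDist isClosed_closure.isOpen_compl hx₀ (by linarith)
  rw [S.frontier_eq]
  linarith

lemma near_geometry (S : ExtensionSetup D W W' ψ refl ω n R c r₀ Cω r)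
    {x₀ : Euc d} (hx₀ : x₀ ∈ (closure D)ᶜ) :
    (∀ Q ∈ nearCubes W' x₀ (Metric.infDist x₀ (frontier D)),
      Metric.infDist x₀ (frontier D) ≤ 14 * d * Q.side ∧
      ‖Q.center - x₀‖ ≤ 5 * d * Metric.infDist x₀ (frontier D)) ∧
      (nearCubes W' x₀ (Metric.infDist x₀ (frontier D))).Finite ∧
      ((nearCubes W' x₀ (Metric.infDist x₀ (frontier D))).ncard : ℝ) ≤
        (14 * d * (16 * d)) ^ d := by
  obtain ⟨h1, h2, h3⟩ := S.whitney'.finite_near S.hd (S.infDist_pos hx₀)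
    (x₀ := x₀) (by rw [S.frontier_eq])
    (F := nearCubes W' x₀ (Metric.infDist x₀ (frontier D))) (fun Q hQ => hQ.1) (fun Q hQ => hQ.2)
  exact ⟨fun Q hQ => (h1 Q hQ).2, h2, h3⟩

/-- Supplies the range `100 d²` in which the attached polynomials are controlled: `d ρ + 5 d ρ ≤ 84
d² Q.side`. -/
lemma near_dist_le (S : ExtensionSetup D W W' ψ refl ω n R c r₀ Cω r)
    {x₀ : Euc d} (hx₀ : x₀ ∈ (closure D)ᶜ) {Q : AxisCube d}
    (hQ : Q ∈ nearCubes W' x₀ (Metric.infDist x₀ (frontier D))) {y : Euc d}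
    (hy : ‖y - x₀‖ ≤ d * Metric.infDist x₀ (frontier D)) :
    ‖y - Q.center‖ ≤ 100 * (d : ℝ) ^ 2 * Q.side := by
  obtain ⟨h1, h2⟩ := (S.near_geometry hx₀).1 Q hQ
  have h3 : ‖y - Q.center‖ ≤ ‖y - x₀‖ + ‖Q.center - x₀‖ := by
    rw [norm_sub_rev Q.center]
    simpa using norm_sub_le_norm_sub_add_norm_sub y x₀ Q.center
  have h4 : (d : ℝ) * Metric.infDist x₀ (frontier D) ≤ d * (14 * d * Q.side) := by gcongr
  nlinarith [mul_nonneg (sq_nonneg (d : ℝ)) Q.side_pos.le]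

lemma sum_near_eq_one (S : ExtensionSetup D W W' ψ refl ω n R c r₀ Cω r)
    {x₀ x : Euc d} (hx₀ : x₀ ∈ (closure D)ᶜ)
    (hx : dist x x₀ ≤ Metric.infDist x₀ (frontier D) / 2) :
    ∑ Q ∈ (S.near_geometry hx₀).2.1.toFinset, ψ Q x = 1 := by
  have h := S.partition.sum_eq x
  rw [indicator_of_mem (S.closedBall_half_subset hx₀ hx)] at h
  rw [← h]
  symm
  apply finsum_mem_eq_sum_of_subset
  · rintro Q ⟨hQ, hne⟩
    simp only [Finite.coe_toFinset]
    exact ⟨hQ, x, S.partition.mem_of_ne_zero hQ hne, hx⟩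
  · intro Q hQ
    simp only [Finite.coe_toFinset] at hQ
    exact hQ.1

open Classical in
-- The index set does not depend on `x` in the ball of radius half the distance to the boundary,
-- which gives smoothness and allows Taylor expansion.
lemma whitneyExt_eq_sum (S : ExtensionSetup D W W' ψ refl ω n R c r₀ Cω r)
    {x₀ x : Euc d} (hx₀ : x₀ ∈ (closure D)ᶜ)
    (hx : dist x x₀ ≤ Metric.infDist x₀ (frontier D) / 2) :
    whitneyExt D R W' ψ refl P f x =
      ∑ Q ∈ (S.near_geometry hx₀).2.1.toFinset with Q.side ≤ R,
        ψ Q x * polyVal (P (refl Q)) x := by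
  have hxD : x ∉ D := fun h => S.closedBall_half_subset hx₀ hx (subset_closure h)
  rw [whitneyExt, indicator_of_notMem hxD, zero_add]
  apply finsum_mem_eq_sum_of_subset
  · rintro Q ⟨hQ, hne⟩
    have hQ' : Q ∈ W' ∧ Q.side ≤ R := hQ
    simp only [Finset.coe_filter, Finite.mem_toFinset]
    exact ⟨⟨hQ'.1, x, S.partition.mem_of_ne_zero hQ'.1 (left_ne_zero_of_mul hne), hx⟩, hQ'.2⟩
  · intro Q hQ
    simp only [Finset.coe_filter, Finite.mem_toFinset] at hQ
    exact ⟨hQ.1.1, hQ.2⟩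

/-- When no nearby cube exceeds `R`, the full partition of unity is present, so a common polynomial
can be moved inside the sum and only differences remain. -/
lemma whitneyExt_sub_eq_sum (S : ExtensionSetup D W W' ψ refl ω n R c r₀ Cω r)
    {x₀ x : Euc d} (hx₀ : x₀ ∈ (closure D)ᶜ)
    (hx : dist x x₀ ≤ Metric.infDist x₀ (frontier D) / 2)
    (hR : ∀ Q ∈ nearCubes W' x₀ (Metric.infDist x₀ (frontier D)), Q.side ≤ R)
    (p : MvPolynomial (Fin d) ℝ) :
    whitneyExt D R W' ψ refl P f x - polyVal p x =
      ∑ Q ∈ (S.near_geometry hx₀).2.1.toFinset,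
        ψ Q x * (polyVal (P (refl Q)) x - polyVal p x) := by
  classical
  rw [S.whitneyExt_eq_sum hx₀ hx, Finset.filter_true_of_mem fun Q hQ => hR Q (by simpa using hQ)]
  simp only [mul_sub, Finset.sum_sub_distrib, ← Finset.sum_mul, S.sum_near_eq_one hx₀ hx, one_mul]

lemma contDiffOn_whitneyExt (S : ExtensionSetup D W W' ψ refl ω n R c r₀ Cω r) :
    ContDiffOn ℝ ((⊤ : ℕ∞) : WithTop ℕ∞) (whitneyExt D R W' ψ refl P f) (closure D)ᶜ := by
  classical
  intro x₀ hx₀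
  have hsm : ContDiff ℝ ((⊤ : ℕ∞) : WithTop ℕ∞) (fun x =>
      ∑ Q ∈ (S.near_geometry hx₀).2.1.toFinset with Q.side ≤ R,
        ψ Q x * polyVal (P (refl Q)) x) := by
    refine ContDiff.sum fun Q hQ => ?_
    simp only [Finset.mem_filter, Finite.mem_toFinset] at hQ
    exact (S.partition.smooth Q hQ.1.1).mul (contDiff_polyVal _)
  refine (hsm.contDiffAt.congr_of_eventuallyEq ?_).contDiffWithinAt
  filter_upwards [Metric.closedBall_mem_nhds x₀ (half_pos (S.infDist_pos hx₀))] with x hx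
  exact S.whitneyExt_eq_sum hx₀ hx

/-- The polynomials attached to the cubes that are not too small are under control. -/
lemma exists_refl_poly_bound (S : ExtensionSetup D W W' ψ refl ω n R c r₀ Cω r)
    (C₀ : ℝ≥0) {s₁ : ℝ} (hs₁ : 0 < s₁) :
    ∃ C : ℝ, 0 ≤ C ∧ ∀ f P M, ExtensionData D W' refl ω n R C₀ f P M → ∀ L : ℝ, 0 ≤ L →
      ∫⁻ x in D, ‖f x‖ₑ ≤ ENNReal.ofReal L → ∀ Q ∈ W', s₁ ≤ Q.side → Q.side ≤ R →
      ∀ y, ‖y - Q.center‖ ≤ 100 * (d : ℝ) ^ 2 * Q.side →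
        |polyVal (P (refl Q)) y| ≤ C * (M + L) := by
  have hd' : (1 : ℝ) ≤ d := by exact_mod_cast S.hd
  have hc := S.c_pos
  have hr₀ := S.r₀_pos
  have hR := S.R_pos
  obtain ⟨C₁, hC₁, hmean⟩ := exists_polyVal_le_mean d n
  -- The lower bound that `IsReflective.lower_bound` gives for the reflective cubes of cubes of side
  -- at least `s₁`.
  set s₂ : ℝ := c * min (s₁ / 4) r₀ / (6 * d) with hs₂
  have hs₂0 : 0 < s₂ := by positivity
  have hωR := S.modulus.pos (32 * d * R) (by positivity)
  set B : ℝ := 1 / s₂ ^ d + C₀ * ω (32 * d * R) with hB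
  have hB0 : 0 ≤ B := by positivity
  refine ⟨C₁ * B * (1 + 127 * (d : ℝ) ^ 2 * R / s₂) ^ n, by positivity, ?_⟩
  intro f P M hf L hL hfL Q hQ hs hQR y hy
  have hM := hf.nonneg
  have hrefl := S.reflective Q hQ hQR
  obtain ⟨h3, h4⟩ := hrefl.upper_bounds S.hd S.whitney S.whitney' S.frontier_eq hQ
  have h5 := hrefl.lower_bound S.hd S.isOpen hc hr₀ S.cones S.whitney S.whitney' S.frontier_eq hQ
  set T := refl Q with hT
  have h6 : s₂ ≤ T.side := by
    rw [hs₂, div_le_iff₀ (by positivity)]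
    have : c * min (s₁ / 4) r₀ ≤ c * min (Q.side / 4) r₀ :=
      mul_le_mul_of_nonneg_left (min_le_min_right _ (by linarith)) hc.le
    linarith
  have hTs := T.side_pos
  have hωT : ω T.side ≤ ω (32 * d * R) := by
    refine S.modulus.mono _ _ hTs.le (h3.trans ?_)
    gcongr
  have hTD : T.carrier ⊆ D := S.whitney.carrier_subset hrefl.1.1
  have hpd := hf.near Q hQ hQR
  rw [← hT] at hpd
  have hI : ∫⁻ x in T.carrier, ‖polyVal (P T) x‖ₑ ≤
      ENNReal.ofReal (T.side ^ d * (B * (M + L))) := by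
    calc ∫⁻ x in T.carrier, ‖polyVal (P T) x‖ₑ
        ≤ ∫⁻ x in T.carrier, (‖f x‖ₑ + ‖f x - polyVal (P T) x‖ₑ) := by
          refine lintegral_mono fun x => ?_
          have : polyVal (P T) x = f x - (f x - polyVal (P T) x) := by ring
          conv_lhs => rw [this]
          exact enorm_sub_le
      _ = (∫⁻ x in T.carrier, ‖f x‖ₑ) + ∫⁻ x in T.carrier, ‖f x - polyVal (P T) x‖ₑ :=
          lintegral_add_left' (hf.meas.mono_set hTD).enorm _
      _ ≤ ENNReal.ofReal L + ENNReal.ofReal (T.side ^ d * (C₀ * M * ω T.side)) :=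
          add_le_add ((lintegral_mono_set hTD).trans hfL) (setLIntegral_le_of_meanDev_le hpd)
      _ = ENNReal.ofReal (L + T.side ^ d * (C₀ * M * ω T.side)) := by
          have := (S.modulus.pos _ hTs).le
          exact (ENNReal.ofReal_add hL (by positivity)).symm
      _ ≤ _ := by
          apply ENNReal.ofReal_le_ofReal
          have h7 : L ≤ T.side ^ d * (1 / s₂ ^ d * L) := by
            have : s₂ ^ d ≤ T.side ^ d := pow_le_pow_left₀ hs₂0.le h6 d
            rw [← mul_assoc, mul_one_div]
            exact le_mul_of_one_le_left hL ((one_le_div (by positivity)).2 this)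
          have h8 : T.side ^ d * (C₀ * M * ω T.side) ≤
              T.side ^ d * (C₀ * M * ω (32 * d * R)) := by gcongr
          have h9 : T.side ^ d * (B * (M + L)) = T.side ^ d * (1 / s₂ ^ d * L) +
              T.side ^ d * (C₀ * M * ω (32 * d * R)) +
              T.side ^ d * (1 / s₂ ^ d * M + C₀ * ω (32 * d * R) * L) := by
            rw [hB]
            ring
          have h10 : 0 ≤ T.side ^ d * (1 / s₂ ^ d * M + C₀ * ω (32 * d * R) * L) := by positivity
          linarith
  have hmean' := meanDev_le_of_setLIntegral_le (f := polyVal (P T)) (P := 0) (Q := T)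
    (B := B * (M + L)) (by simpa only [polyVal_zero, sub_zero] using hI)
  refine (hmean (P T) (hf.degree Q hQ hQR) T (B * (M + L)) (by positivity)
    (by simpa only [meanDev, polyVal_zero, sub_zero] using hmean') y).trans ?_
  have h11 : ‖y - T.center‖ ≤ ‖y - Q.center‖ + ‖T.center - Q.center‖ := by
    rw [norm_sub_rev T.center]
    simpa using norm_sub_le_norm_sub_add_norm_sub y Q.center T.center
  have h12 : ‖y - T.center‖ ≤ 127 * (d : ℝ) ^ 2 * R := by
    have : 127 * (d : ℝ) ^ 2 * Q.side ≤ 127 * (d : ℝ) ^ 2 * R := by gcongr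
    linarith
  have h13 : ‖y - T.center‖ / T.side ≤ 127 * (d : ℝ) ^ 2 * R / s₂ :=
    div_le_div₀ (by positivity) h12 hs₂0 h6
  have h14 : (1 + ‖y - T.center‖ / T.side) ^ n ≤ (1 + 127 * (d : ℝ) ^ 2 * R / s₂) ^ n :=
    pow_le_pow_left₀ (by positivity) (by linarith) n
  calc _ ≤ C₁ * (B * (M + L)) * (1 + 127 * (d : ℝ) ^ 2 * R / s₂) ^ n := by gcongr
    _ = _ := by ring

/-- Weighted sums over the cubes near a point. -/
lemma abs_sum_near_le (S : ExtensionSetup D W W' ψ refl ω n R c r₀ Cω r)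
    {x₀ x : Euc d} (hx₀ : x₀ ∈ (closure D)ᶜ)
    (hx : dist x x₀ ≤ Metric.infDist x₀ (frontier D) / 2) {F : Finset (AxisCube d)}
    (hF : F ⊆ (S.near_geometry hx₀).2.1.toFinset) {g : AxisCube d → ℝ} {B : ℝ} (hB : 0 ≤ B)
    (hg : ∀ Q ∈ F, |g Q| ≤ B) : |∑ Q ∈ F, ψ Q x * g Q| ≤ B := by
  have hnn : ∀ Q ∈ (S.near_geometry hx₀).2.1.toFinset, 0 ≤ ψ Q x := fun Q hQ => by
    simp only [Finite.mem_toFinset] at hQ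
    exact S.partition.nonneg hQ.1 x
  calc |∑ Q ∈ F, ψ Q x * g Q| ≤ ∑ Q ∈ F, ψ Q x * B := by
        refine (Finset.abs_sum_le_sum_abs _ _).trans (Finset.sum_le_sum fun Q hQ => ?_)
        rw [abs_mul, abs_of_nonneg (hnn Q (hF hQ))]
        exact mul_le_mul_of_nonneg_left (hg Q hQ) (hnn Q (hF hQ))
    _ = (∑ Q ∈ F, ψ Q x) * B := (Finset.sum_mul _ _ _).symm
    _ ≤ 1 * B := by
        refine mul_le_mul_of_nonneg_right ?_ hB
        rw [← S.sum_near_eq_one hx₀ hx]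
        exact Finset.sum_le_sum_of_subset_of_nonneg hF fun Q hQ _ => hnn Q hQ
    _ = B := one_mul B

lemma exists_infDist_eq (S : ExtensionSetup D W W' ψ refl ω n R c r₀ Cω r)
    (x : Euc d) :
    ∃ a ∈ frontier D, Metric.infDist x (frontier D) = dist x a :=
  isClosed_frontier.exists_infDist_eq_dist S.frontier_nonempty x

/-- The extension is bounded outside of `D`. -/
lemma exists_exterior_bound (S : ExtensionSetup D W W' ψ refl ω n R c r₀ Cω r)
    (C₀ : ℝ≥0) :
    ∃ C : ℝ, 0 ≤ C ∧ ∀ f P M, ExtensionData D W' refl ω n R C₀ f P M → ∀ L : ℝ, 0 ≤ L →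
      ∫⁻ x in D, ‖f x‖ₑ ≤ ENNReal.ofReal L → ∀ x ∈ (closure D)ᶜ,
        |whitneyExt D R W' ψ refl P f x| ≤ C * (M + L) := by
  classical
  have hd' : (1 : ℝ) ≤ d := by exact_mod_cast S.hd
  obtain ⟨η, ε, C₁, hη, hη1, hε, hC₁, hloc⟩ := S.exists_local_poly C₀
  obtain ⟨C₂, hC₂, hdeep⟩ := S.exists_refl_poly_bound C₀ (s₁ := η * ε / (28 * d)) (by positivity)
  have hωε := S.modulus.pos ε hε
  refine ⟨C₁ * ω ε + C₁ * (1 / ε ^ d + ω ε) + C₂, by positivity, ?_⟩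
  intro f P M hf L hL hfL x hx
  have hM := hf.nonneg
  have hρ := S.infDist_pos hx
  set ρ := Metric.infDist x (frontier D) with hρdef
  have hxx : dist x x ≤ ρ / 2 := by rw [dist_self]; linarith
  have hadd : 0 ≤ M + L := by positivity
  -- Below the threshold, all nearby cubes come within `3 ρ / 2 ≤ η ε` of `a`, and the local
  -- polynomial at the fixed scale `ε` serves. Above it, all nearby cubes have side at least `η ε /
  -- (28 d)`.
  rcases le_or_gt ρ (η * ε / 2) with hle | hgt
  · obtain ⟨a, ha, hxa⟩ := S.exists_infDist_eq x
    rw [← hρdef] at hxa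
    obtain ⟨p, -, -, h2, h3⟩ := hloc f P M hf a ha ε hε le_rfl
    have hnear : ∀ Q ∈ nearCubes W' x ρ, Q.side ≤ R ∧
        |polyVal (P (refl Q)) x - polyVal p x| ≤ C₁ * M * ω ε := by
      rintro Q hQ
      have hQ' := hQ
      obtain ⟨hQW, y, hy, hyx⟩ := hQ
      have h4 := h2 Q hQW y hy ((dist_triangle y x a).trans (by rw [← hxa]; linarith))
      refine ⟨h4.1, h4.2 x (S.near_dist_le hx hQ' ?_)⟩
      rw [sub_self, norm_zero]
      positivity
    have h5 := S.abs_sum_near_le hx hxx (F := (S.near_geometry hx).2.1.toFinset) subset_rfl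
      (g := fun Q => polyVal (P (refl Q)) x - polyVal p x) (B := C₁ * M * ω ε) (by positivity)
      (fun Q hQ => (hnear Q (by simpa using hQ)).2)
    rw [← S.whitneyExt_sub_eq_sum (f := f) hx hxx (fun Q hQ => (hnear Q hQ).1)] at h5
    have h6 := h3 L hL hfL x (by rw [← hxa]; nlinarith)
    have h7 : |whitneyExt D R W' ψ refl P f x| ≤
        |whitneyExt D R W' ψ refl P f x - polyVal p x| + |polyVal p x| := by
      simpa using abs_add_le (whitneyExt D R W' ψ refl P f x - polyVal p x) (polyVal p x)
    calc _ ≤ C₁ * M * ω ε + C₁ * (L / ε ^ d + M * ω ε) := h7.trans (add_le_add h5 h6)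
      _ ≤ _ := by
        have e1 : 0 ≤ C₁ * ω ε * L + C₁ * (1 / ε ^ d * M + ω ε * L) + C₂ * (M + L) := by
          positivity
        have e2 : (C₁ * ω ε + C₁ * (1 / ε ^ d + ω ε) + C₂) * (M + L) =
          C₁ * M * ω ε + C₁ * (L / ε ^ d + M * ω ε) +
          (C₁ * ω ε * L + C₁ * (1 / ε ^ d * M + ω ε * L) + C₂ * (M + L)) := by ring
        linarith
  · rw [S.whitneyExt_eq_sum hx hxx]
    refine (S.abs_sum_near_le hx hxx (Finset.filter_subset _ _)
      (g := fun Q => polyVal (P (refl Q)) x) (B := C₂ * (M + L)) (by positivity) ?_).trans ?_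
    · intro Q hQ
      simp only [Finset.mem_filter, Finite.mem_toFinset] at hQ
      have h1 := ((S.near_geometry hx).1 Q hQ.1).1
      rw [← hρdef] at h1
      refine hdeep f P M hf L hL hfL Q hQ.1.1 ?_ hQ.2 x (S.near_dist_le hx hQ.1 ?_)
      · rw [div_le_iff₀ (by positivity)]
        linarith
      · rw [sub_self, norm_zero]
        positivity
    · have : 0 ≤ (C₁ * ω ε + C₁ * (1 / ε ^ d + ω ε)) * (M + L) := by positivity
      nlinarith

end ExtensionSetup

end Exterior

/-! ### Approximation on all cubes and the resulting norm bounds. -/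

section Estimates

variable {d n : ℕ} {D : Set (Euc d)} {W W' : Set (AxisCube d)}
  {ψ : AxisCube d → Euc d → ℝ} {refl : AxisCube d → AxisCube d} {ω : ℝ → ℝ}
  {R c r₀ Cω r : ℝ} {C₀ : ℝ≥0} {f : Euc d → ℝ} {P : AxisCube d → MvPolynomial (Fin d) ℝ} {M : ℝ}

/-- Approximation of a sum of products of cut-off functions and polynomials. -/
lemma exists_poly_approx_cutoff_sum (d n : ℕ) :
    ∃ C : ℝ, 0 ≤ C ∧ ∀ (F : Finset (AxisCube d)) (N A B ρ : ℝ) (hρ : 0 < ρ) (x₀ : Euc d)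
      (ψ : AxisCube d → Euc d → ℝ) (g : AxisCube d → MvPolynomial (Fin d) ℝ),
      (F.card : ℝ) ≤ N → 0 ≤ A → 0 ≤ B →
      (∀ Q ∈ F, ContDiff ℝ ((⊤ : ℕ∞) : WithTop ℕ∞) (ψ Q)) →
      (∀ Q ∈ F, ∀ k ≤ n + 1, ∀ x, ‖iteratedFDeriv ℝ k (ψ Q) x‖ ≤ A / ρ ^ k) →
      (∀ Q ∈ F, (g Q).totalDegree ≤ n) →
      (∀ Q ∈ F, ∀ x ∈ (AxisCube.mk x₀ ρ hρ).carrier, |polyVal (g Q) x| ≤ B) →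
      ∃ p : MvPolynomial (Fin d) ℝ, p.totalDegree ≤ n ∧ ∀ x, ‖x - x₀‖ ≤ ρ →
        |∑ Q ∈ F, ψ Q x * polyVal (g Q) x - polyVal p x| ≤
          N * (C * A * B * (‖x - x₀‖ / ρ) ^ (n + 1)) := by
  obtain ⟨C, hC, h⟩ := exists_poly_approx_cutoff_mul d n
  refine ⟨C, hC, fun F N A B ρ hρ x₀ ψ g hN hA hB hsm hder hdeg hg => ?_⟩
  have hex : ∀ Q, ∃ p : MvPolynomial (Fin d) ℝ, p.totalDegree ≤ n ∧ (Q ∈ F → ∀ x, ‖x - x₀‖ ≤ ρ →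
      |ψ Q x * polyVal (g Q) x - polyVal p x| ≤ C * A * B * (‖x - x₀‖ / ρ) ^ (n + 1)) := by
    intro Q
    by_cases hQ : Q ∈ F
    · obtain ⟨p, hp, hpv⟩ := h A B ρ hρ x₀ (ψ Q) (g Q) (hsm Q hQ) (hder Q hQ) (hdeg Q hQ) (hg Q hQ)
      exact ⟨p, hp, fun _ => hpv⟩
    · exact ⟨0, by simp, fun h => absurd h hQ⟩
  choose p hp hpv using hex
  refine ⟨∑ Q ∈ F, p Q, MvPolynomial.totalDegree_finsetSum_le fun Q _ => hp Q, fun x hx => ?_⟩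
  rw [polyVal_sum, ← Finset.sum_sub_distrib]
  refine (Finset.abs_sum_le_sum_abs _ _).trans ?_
  refine (Finset.sum_le_sum fun Q hQ => hpv Q hQ x hx).trans ?_
  rw [Finset.sum_const, nsmul_eq_mul]
  exact mul_le_mul_of_nonneg_right hN (by positivity)

lemma cubeOsc_le_of_meanDev_le {p : MvPolynomial (Fin d) ℝ} {Q : AxisCube d} {B : ℝ}
    (hp : p.totalDegree ≤ n) (hω : 0 < ω Q.side)
    (h : meanDev f p Q ≤ ENNReal.ofReal (B * ω Q.side)) :
    cubeOsc ω n f Q ≤ ENNReal.ofReal B := by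
  refine (iInf₂_le p hp).trans ?_
  have hω0 : ENNReal.ofReal (ω Q.side) ≠ 0 := by simpa using hω
  rw [ENNReal.ofReal_mul' hω.le] at h
  calc _ ≤ (ENNReal.ofReal (ω Q.side))⁻¹ * (ENNReal.ofReal B * ENNReal.ofReal (ω Q.side)) := by
        gcongr
    _ = ENNReal.ofReal B := by
        rw [mul_comm (ENNReal.ofReal B), ← mul_assoc,
          ENNReal.inv_mul_cancel hω0 ENNReal.ofReal_ne_top, one_mul]

lemma meanDev_le_of_forall_le {p : MvPolynomial (Fin d) ℝ} {Q : AxisCube d} {B : ℝ}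
    (h : ∀ x ∈ Q.carrier, |f x - polyVal p x| ≤ B) : meanDev f p Q ≤ ENNReal.ofReal B := by
  apply meanDev_le_of_setLIntegral_le
  calc ∫⁻ x in Q.carrier, ‖f x - polyVal p x‖ₑ ≤ ∫⁻ _ in Q.carrier, ENNReal.ofReal B := by
        refine setLIntegral_mono' Q.measurableSet_carrier fun x hx => ?_
        rw [Real.enorm_eq_ofReal_abs]
        exact ENNReal.ofReal_le_ofReal (h x hx)
    _ = _ := by
        rw [setLIntegral_const, Q.volume_carrier, mul_comm,
          ENNReal.ofReal_mul (pow_nonneg Q.side_pos.le d)]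

namespace ExtensionSetup

/-- Uniform derivative bounds of the partition of unity at the scale of the distance to the
boundary. -/
lemma exists_deriv_bound (S : ExtensionSetup D W W' ψ refl ω n R c r₀ Cω r) :
    ∃ A : ℝ, 0 ≤ A ∧ ∀ Q ∈ W', ∀ ρ : ℝ, 0 < ρ → ρ ≤ 14 * d * Q.side →
      ∀ k ≤ n + 1, ∀ x, ‖iteratedFDeriv ℝ k (ψ Q) x‖ ≤ A / ρ ^ k := by
  choose C hC using S.partition.deriv_le
  refine ⟨∑ k ∈ Finset.range (n + 2), |C k| * (14 * d) ^ k,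
    Finset.sum_nonneg fun k _ => by positivity, fun Q hQ ρ hρ hρQ k hk x => ?_⟩
  have hs := Q.side_pos
  have h1 : |C k| * (14 * (d : ℝ)) ^ k ≤ ∑ k ∈ Finset.range (n + 2), |C k| * (14 * (d : ℝ)) ^ k :=
    Finset.single_le_sum (f := fun k => |C k| * (14 * (d : ℝ)) ^ k) (fun k _ => by positivity)
      (Finset.mem_range.2 (by omega))
  calc ‖iteratedFDeriv ℝ k (ψ Q) x‖ ≤ C k / Q.side ^ k := hC k Q hQ x
    _ ≤ |C k| / Q.side ^ k := by gcongr; exact le_abs_self _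
    _ ≤ |C k| * (14 * d) ^ k / ρ ^ k := by
        rw [div_le_div_iff₀ (by positivity) (by positivity), mul_assoc, ← mul_pow]
        gcongr
    _ ≤ _ := by gcongr

/-- Approximation of the extension on cubes far away from the boundary, compared to their size. -/
lemma exists_far_approx (S : ExtensionSetup D W W' ψ refl ω n R c r₀ Cω r)
    (C₀ : ℝ≥0) :
    ∃ ℓ₁ C : ℝ, 0 < ℓ₁ ∧ 0 ≤ C ∧ ∀ f P M, ExtensionData D W' refl ω n R C₀ f P M →
      ∀ L : ℝ, 0 ≤ L → ∫⁻ x in D, ‖f x‖ₑ ≤ ENNReal.ofReal L → ∀ Q : AxisCube d,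
      Q.side ≤ ℓ₁ → Q.center ∈ (closure D)ᶜ →
      2 * d * Q.side < Metric.infDist Q.center (frontier D) →
      ∃ p : MvPolynomial (Fin d) ℝ, p.totalDegree ≤ n ∧ ∀ x ∈ Q.carrier,
        |whitneyExt D R W' ψ refl P f x - polyVal p x| ≤ C * (M + L) * ω Q.side := by
  classical
  have hd' : (1 : ℝ) ≤ d := by exact_mod_cast S.hd
  obtain ⟨η, ε, C₁, hη, hη1, hε, hC₁, hloc⟩ := S.exists_local_poly C₀
  set ρ₁ : ℝ := η * ε / 2 with hρ₁
  have hρ₁0 : 0 < ρ₁ := by positivity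
  obtain ⟨C₂, hC₂, hdeep⟩ := S.exists_refl_poly_bound C₀ (s₁ := ρ₁ / (14 * d)) (by positivity)
  obtain ⟨A, hA, hder⟩ := S.exists_deriv_bound
  obtain ⟨C₃, hC₃, happ⟩ := exists_poly_approx_cutoff_sum d n
  have hCω : 0 ≤ Cω := by linarith [S.modulus.one_le]
  have hωρ := S.modulus.pos ρ₁ hρ₁0
  set N : ℝ := (14 * d * (16 * d)) ^ d with hN
  have hN0 : 0 ≤ N := by positivity
  set B₁ : ℝ := N * (C₃ * A * C₁ * (Cω * (2 * d / η) ^ (n + 1))) with hB₁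
  set B₂ : ℝ := N * (C₃ * A * C₂ * (Cω * d ^ (n + 1) / ω ρ₁)) with hB₂
  have hB₁0 : 0 ≤ B₁ := by positivity
  have hB₂0 : 0 ≤ B₂ := by positivity
  refine ⟨ρ₁ / d, B₁ + B₂, by positivity, by positivity, ?_⟩
  intro f P M hf L hL hfL Q hQℓ hx₀ hfar
  have hM := hf.nonneg
  have hℓ := Q.side_pos
  set x₀ := Q.center with hx₀def
  set ℓ := Q.side with hℓdef
  have hωℓ := S.modulus.pos ℓ hℓ
  have hgeo := S.near_geometry hx₀
  have hρ := S.infDist_pos hx₀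
  have hcard : ((hgeo.2.1.toFinset.card : ℕ) : ℝ) ≤ N := by
    have := hgeo.2.2
    rwa [Set.ncard_eq_toFinset_card _ hgeo.2.1] at this
  set ρ := Metric.infDist x₀ (frontier D) with hρdef
  have hℓd : ℓ * d ≤ ρ₁ := by rwa [le_div_iff₀ (by positivity)] at hQℓ
  have hxQ : ∀ x ∈ Q.carrier, ‖x - x₀‖ ≤ d * ℓ / 2 := fun x hx =>
    (AxisCube.norm_sub_center_le hx).trans_eq (by ring)
  have hxρ : ∀ x ∈ Q.carrier, dist x x₀ ≤ ρ / 2 := fun x hx => by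
    rw [dist_eq_norm]
    linarith [hxQ x hx]
  have hcube : ∀ s (hs : 0 < s), s ≤ ρ → ∀ y ∈ (AxisCube.mk x₀ s hs).carrier, ‖y - x₀‖ ≤ d * ρ := by
    intro s hs hsρ y hy
    refine (AxisCube.norm_sub_center_le hy).trans ?_
    simp only
    gcongr
    linarith
  -- Close to the boundary a common polynomial is subtracted so that the coefficients are `O(ω h)`.
  -- Farther away cubes larger than `R` may be missing, and the crude bound `O(M + L)` is used at
  -- the fixed scale `ρ₁`.
  rcases le_or_gt ρ ρ₁ with hle | hgt
  · obtain ⟨a, ha, hxa⟩ := S.exists_infDist_eq x₀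
    rw [← hρdef] at hxa
    -- Then `η h = 2 ρ`, which exceeds the distance `3 ρ / 2` from `a` within which each nearby
    -- dilated cube has a point.
    set h : ℝ := 2 * ρ / η with hh
    have hh0 : 0 < h := by positivity
    have hηh : η * h = 2 * ρ := by rw [hh]; field_simp
    have hhε : h ≤ ε := by
      rw [hh, div_le_iff₀ hη]
      linarith
    have hωh := S.modulus.pos h hh0
    obtain ⟨p, hp, -, h2, -⟩ := hloc f P M hf a ha h hh0 hhε
    have hnear : ∀ T ∈ nearCubes W' x₀ ρ, T.side ≤ R ∧ ∀ y, ‖y - x₀‖ ≤ d * ρ →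
        |polyVal (P (refl T)) y - polyVal p y| ≤ C₁ * M * ω h := by
      intro T hT
      have hT' := hT
      obtain ⟨hTW, y, hy, hyx⟩ := hT
      have h4 := h2 T hTW y hy ((dist_triangle y x₀ a).trans (by rw [← hxa, hηh]; linarith))
      exact ⟨h4.1, fun y hy => h4.2 y (S.near_dist_le hx₀ hT' hy)⟩
    obtain ⟨q, hq, hqv⟩ := happ hgeo.2.1.toFinset N A (C₁ * M * ω h) ρ hρ x₀ ψ
      (fun T => P (refl T) - p) hcard hA (by positivity)
      (fun T hT => S.partition.smooth T (by simp only [Finite.mem_toFinset] at hT; exact hT.1))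
      (fun T hT => by
        simp only [Finite.mem_toFinset] at hT
        exact hder T hT.1 ρ hρ (hgeo.1 T hT).1)
      (fun T hT => by
        simp only [Finite.mem_toFinset] at hT
        exact totalDegree_sub_le_of_le (hf.degree T hT.1 (hnear T hT).1) hp)
      (fun T hT y hy => by
        simp only [Finite.mem_toFinset] at hT
        rw [polyVal_sub]
        exact (hnear T hT).2 y (hcube ρ hρ le_rfl y hy))
    refine ⟨p + q, (MvPolynomial.totalDegree_add _ _).trans (max_le hp hq), fun x hx => ?_⟩
    have hxq := hqv x (by linarith [hxQ x hx])
    simp only [polyVal_sub] at hxq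
    rw [← S.whitneyExt_sub_eq_sum (f := f) hx₀ (hxρ x hx) (fun T hT => (hnear T hT).1) p] at hxq
    rw [polyVal_add, ← sub_sub]
    refine hxq.trans ?_
    have hgrow : ω h ≤ Cω * (h / ℓ) ^ (n + 1) * ω ℓ := by
      have h1ℓ : 1 ≤ h / ℓ := by
        rw [one_le_div hℓ, hh, le_div_iff₀ hη]
        nlinarith
      have := S.modulus.growth (h / ℓ) ℓ h1ℓ hℓ
      rwa [div_mul_cancel₀ _ hℓ.ne'] at this
    calc N * (C₃ * A * (C₁ * M * ω h) * (‖x - x₀‖ / ρ) ^ (n + 1))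
        ≤ N * (C₃ * A * (C₁ * M * (Cω * (h / ℓ) ^ (n + 1) * ω ℓ)) * (d * ℓ / ρ) ^ (n + 1)) := by
          have : ‖x - x₀‖ ≤ d * ℓ := by linarith [hxQ x hx, norm_nonneg (x - x₀)]
          gcongr
      _ = N * (C₃ * A * (C₁ * M * (Cω * ((h / ℓ) * (d * ℓ / ρ)) ^ (n + 1) * ω ℓ))) := by
          rw [mul_pow]
          ring
      _ = B₁ * M * ω ℓ := by
          -- The growth of `ω` from `ℓ` to `h` cancels against the Taylor factor, leaving a constant
          -- independent of `ρ` and `ℓ`.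
          have : (h / ℓ) * (d * ℓ / ρ) = 2 * d / η := by
            rw [hh]
            field_simp
          rw [this, hB₁]
          ring
      _ ≤ (B₁ + B₂) * (M + L) * ω ℓ := by
          have : B₁ * M ≤ (B₁ + B₂) * (M + L) :=
            mul_le_mul (by linarith) (by linarith) hM (by linarith)
          gcongr
  · have hsub : ∀ T ∈ hgeo.2.1.toFinset.filter (fun T => T.side ≤ R), T ∈ nearCubes W' x₀ ρ ∧
        T.side ≤ R := fun T hT => by
      simpa only [Finset.mem_filter, Finite.mem_toFinset] using hT
    obtain ⟨q, hq, hqv⟩ := happ (hgeo.2.1.toFinset.filter (fun T => T.side ≤ R)) N A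
      (C₂ * (M + L)) ρ₁ hρ₁0 x₀ ψ (fun T => P (refl T))
      (le_trans (by exact_mod_cast Finset.card_filter_le _ _) hcard) hA (by positivity)
      (fun T hT => S.partition.smooth T (hsub T hT).1.1)
      (fun T hT => hder T (hsub T hT).1.1 ρ₁ hρ₁0 (hgt.le.trans (hgeo.1 T (hsub T hT).1).1))
      (fun T hT => hf.degree T (hsub T hT).1.1 (hsub T hT).2)
      (fun T hT y hy => by
        have h1 := (hgeo.1 T (hsub T hT).1).1
        refine hdeep f P M hf L hL hfL T (hsub T hT).1.1 ?_ (hsub T hT).2 y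
          (S.near_dist_le hx₀ (hsub T hT).1 (hcube ρ₁ hρ₁0 hgt.le y hy))
        rw [div_le_iff₀ (by positivity)]
        linarith)
    refine ⟨q, hq, fun x hx => ?_⟩
    rw [S.whitneyExt_eq_sum hx₀ (hxρ x hx)]
    have hx1 := hxQ x hx
    have hdℓ : 0 < (d : ℝ) * ℓ := by positivity
    refine (hqv x (by linarith)).trans ?_
    have hgrow : ω ρ₁ ≤ Cω * (ρ₁ / ℓ) ^ (n + 1) * ω ℓ := by
      have h1ℓ : 1 ≤ ρ₁ / ℓ := by
        rw [one_le_div hℓ]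
        nlinarith
      have := S.modulus.growth (ρ₁ / ℓ) ℓ h1ℓ hℓ
      rwa [div_mul_cancel₀ _ hℓ.ne'] at this
    have hpow : (d * ℓ / ρ₁) ^ (n + 1) ≤ Cω * d ^ (n + 1) / ω ρ₁ * ω ℓ := by
      rw [div_mul_eq_mul_div, le_div_iff₀ hωρ]
      calc (d * ℓ / ρ₁) ^ (n + 1) * ω ρ₁
          ≤ (d * ℓ / ρ₁) ^ (n + 1) * (Cω * (ρ₁ / ℓ) ^ (n + 1) * ω ℓ) := by gcongr
        _ = Cω * ((d * ℓ / ρ₁) * (ρ₁ / ℓ)) ^ (n + 1) * ω ℓ := by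
            rw [mul_pow]
            ring
        _ = Cω * d ^ (n + 1) * ω ℓ := by
            congr 3
            field_simp
    calc N * (C₃ * A * (C₂ * (M + L)) * (‖x - x₀‖ / ρ₁) ^ (n + 1))
        ≤ N * (C₃ * A * (C₂ * (M + L)) * (d * ℓ / ρ₁) ^ (n + 1)) := by
          have : ‖x - x₀‖ ≤ d * ℓ := by linarith
          gcongr
      _ ≤ N * (C₃ * A * (C₂ * (M + L)) * (Cω * d ^ (n + 1) / ω ρ₁ * ω ℓ)) := by gcongr
      _ = B₂ * (M + L) * ω ℓ := by rw [hB₂]; ring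
      _ ≤ _ := by
          gcongr
          linarith

/-- The dilated exterior cubes lie in the doubled ones, which do not meet the closure of `D`. -/
lemma whitneyExt_of_mem_closure (S : ExtensionSetup D W W' ψ refl ω n R c r₀ Cω r)
    {x : Euc d} (hx : x ∈ closure D) :
    whitneyExt D R W' ψ refl P f x = D.indicator f x := by
  rw [whitneyExt, finsum_mem_of_eqOn_zero, add_zero]
  intro Q hQ
  have hQ' : Q ∈ W' ∧ Q.side ≤ R := hQ
  simp only
  by_cases hne : ψ Q x = 0
  · rw [hne, zero_mul]
    rfl
  · exfalso
    have h1 := S.partition.mem_of_ne_zero hQ'.1 hne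
    refine S.whitney'.scale_two_subset isClosed_closure.isOpen_compl S.hd hQ'.1 ?_ hx
    refine AxisCube.carrier_subset_of_abs_le (fun i => ?_) h1
    simp only [AxisCube.scale, sub_self, abs_zero]
    linarith [Q.side_pos]

/-- Cubes of side at most `R` contribute only within `7 d R` of the boundary, so the radius works
for all `f` and `P` at once. -/
lemma exists_support_bound (S : ExtensionSetup D W W' ψ refl ω n R c r₀ Cω r) :
    ∃ R₂ : ℝ, D ⊆ Metric.closedBall 0 R₂ ∧
      ∀ (f : Euc d → ℝ) (P : AxisCube d → MvPolynomial (Fin d) ℝ) (x : Euc d),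
      x ∉ Metric.closedBall (0 : Euc d) R₂ → whitneyExt D R W' ψ refl P f x = 0 := by
  obtain ⟨R₁, hR₁⟩ := S.bounded.closure.subset_closedBall (0 : Euc d)
  have hR := S.R_pos
  have hsub : Metric.closedBall (0 : Euc d) R₁ ⊆ Metric.closedBall 0 (R₁ + 7 * d * R) :=
    Metric.closedBall_subset_closedBall (by
      have : 0 ≤ 7 * (d : ℝ) * R := by positivity
      linarith)
  refine ⟨R₁ + 7 * d * R, (subset_closure.trans hR₁).trans hsub, fun f P x hx => ?_⟩
  have hxD : x ∉ D := fun h => hx (hsub (hR₁ (subset_closure h)))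
  rw [whitneyExt, indicator_of_notMem hxD, zero_add]
  apply finsum_mem_of_eqOn_zero
  intro Q hQ
  have hQ' : Q ∈ W' ∧ Q.side ≤ R := hQ
  simp only
  by_cases hne : ψ Q x = 0
  · rw [hne, zero_mul]
    rfl
  · exfalso
    have h1 := (S.whitney'.infDist_bounds S.hd hQ'.1 (S.partition.mem_of_ne_zero hQ'.1 hne)).2
    rw [S.frontier_eq] at h1
    obtain ⟨a, ha, hxa⟩ := S.exists_infDist_eq x
    refine hx ?_
    have h2 := hR₁ (frontier_subset_closure ha)
    rw [Metric.mem_closedBall] at h2 ⊢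
    have h3 := dist_triangle x a 0
    have h4 : 7 * (d : ℝ) * Q.side ≤ 7 * d * R := by
      have := hQ'.2
      gcongr
    linarith

/-- Approximation of the extension on cubes close to the boundary, compared to their size. -/
lemma exists_near_approx (S : ExtensionSetup D W W' ψ refl ω n R c r₀ Cω r)
    (C₀ : ℝ≥0) :
    ∃ ℓ₂ C : ℝ, 0 < ℓ₂ ∧ 0 ≤ C ∧ ∀ f P M, ExtensionData D W' refl ω n R C₀ f P M →
      ∀ Q : AxisCube d, Q.side ≤ ℓ₂ → Metric.infDist Q.center (frontier D) ≤ 2 * d * Q.side →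
      ∃ p : MvPolynomial (Fin d) ℝ, p.totalDegree ≤ n ∧
        meanDev (whitneyExt D R W' ψ refl P f) p Q ≤ ENNReal.ofReal (C * M * ω Q.side) := by
  have hd' : (1 : ℝ) ≤ d := by exact_mod_cast S.hd
  obtain ⟨η, ε, C₁, hη, hη1, hε, hC₁, hloc⟩ := S.exists_local_poly C₀
  have hCω : 0 ≤ Cω := by linarith [S.modulus.one_le]
  -- With `h = τ ℓ` one has `η h = 6 d ℓ`. The cube lies within `3 d ℓ` of `a`, and the exterior
  -- cubes near its points come within `9 d ℓ / 2`.
  set τ : ℝ := 6 * d / η with hτ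
  have hτ0 : 0 < τ := by positivity
  have hτ1 : 1 ≤ τ := by
    rw [hτ, le_div_iff₀ hη]
    linarith
  refine ⟨ε / τ, C₁ * (τ ^ d + 1) * (Cω * τ ^ (n + 1)), by positivity, by positivity, ?_⟩
  intro f P M hf Q hQℓ hQa
  have hM := hf.nonneg
  have hℓ := Q.side_pos
  set ℓ := Q.side with hℓdef
  have hωℓ := S.modulus.pos ℓ hℓ
  obtain ⟨a, ha, hxa⟩ := S.exists_infDist_eq Q.center
  set h : ℝ := τ * ℓ with hh
  have hh0 : 0 < h := by positivity
  have hhε : h ≤ ε := by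
    rw [le_div_iff₀ hτ0] at hQℓ
    linarith
  have hηh : η * h = 6 * d * ℓ := by
    rw [hh, hτ]
    field_simp
  have hωh := S.modulus.pos h hh0
  have hgrow : ω h ≤ Cω * τ ^ (n + 1) * ω ℓ := S.modulus.growth τ ℓ hτ1 hℓ
  obtain ⟨p, hp, h1, h2, -⟩ := hloc f P M hf a ha h hh0 hhε
  refine ⟨p, hp, ?_⟩
  have hdℓ : 0 < (d : ℝ) * ℓ := by positivity
  have hQball : ∀ x ∈ Q.carrier, dist x a ≤ 3 * d * ℓ := by
    intro x hx
    have h3 := AxisCube.norm_sub_center_le hx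
    rw [← dist_eq_norm, ← hℓdef] at h3
    have h4 := dist_triangle x Q.center a
    linarith
  have hext : ∀ x ∈ Q.carrier, x ∈ (closure D)ᶜ →
      |whitneyExt D R W' ψ refl P f x - polyVal p x| ≤ C₁ * M * ω h := by
    intro x hx hxD
    have hρ := S.infDist_pos hxD
    have hxx : dist x x ≤ Metric.infDist x (frontier D) / 2 := by rw [dist_self]; linarith
    have hρa := Metric.infDist_le_dist_of_mem (x := x) ha
    have hxa' := hQball x hx
    have hnear : ∀ T ∈ nearCubes W' x (Metric.infDist x (frontier D)), T.side ≤ R ∧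
        |polyVal (P (refl T)) x - polyVal p x| ≤ C₁ * M * ω h := by
      intro T hT
      have hT' := hT
      obtain ⟨hTW, y, hy, hyx⟩ := hT
      have h4 := h2 T hTW y hy ((dist_triangle y x a).trans (by rw [hηh]; linarith))
      refine ⟨h4.1, h4.2 x (S.near_dist_le hxD hT' ?_)⟩
      rw [sub_self, norm_zero]
      positivity
    rw [S.whitneyExt_sub_eq_sum hxD hxx (fun T hT => (hnear T hT).1)]
    exact S.abs_sum_near_le hxD hxx subset_rfl (by positivity)
      fun T hT => (hnear T (by simpa using hT)).2
  apply meanDev_le_of_setLIntegral_le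
  -- In `D` the deviation is bounded in mean, outside the closure pointwise, and the boundary is a
  -- null set.
  have hcover : Q.carrier ⊆ (D ∩ Metric.closedBall a (η * h)) ∪
      ((Q.carrier ∩ (closure D)ᶜ) ∪ frontier D) := by
    intro x hx
    by_cases hxD : x ∈ D
    · refine Or.inl ⟨hxD, ?_⟩
      rw [Metric.mem_closedBall, hηh]
      linarith [hQball x hx]
    · by_cases hxc : x ∈ closure D
      · refine Or.inr (Or.inr ?_)
        rw [S.isOpen.frontier_eq]
        exact ⟨hxc, hxD⟩
      · exact Or.inr (Or.inl ⟨hx, hxc⟩)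
  have hmeas : MeasurableSet (Q.carrier ∩ (closure D)ᶜ) :=
    Q.measurableSet_carrier.inter isClosed_closure.measurableSet.compl
  calc ∫⁻ x in Q.carrier, ‖whitneyExt D R W' ψ refl P f x - polyVal p x‖ₑ
      ≤ (∫⁻ x in D ∩ Metric.closedBall a (η * h),
          ‖whitneyExt D R W' ψ refl P f x - polyVal p x‖ₑ) +
        ((∫⁻ x in Q.carrier ∩ (closure D)ᶜ, ‖whitneyExt D R W' ψ refl P f x - polyVal p x‖ₑ) +
          ∫⁻ x in frontier D, ‖whitneyExt D R W' ψ refl P f x - polyVal p x‖ₑ) := by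
        refine (lintegral_mono_set hcover).trans ((lintegral_union_le _ _ _).trans ?_)
        gcongr
        exact lintegral_union_le _ _ _
    _ ≤ ENNReal.ofReal (C₁ * M * ω h * h ^ d) +
          (ENNReal.ofReal (C₁ * M * ω h * ℓ ^ d) + 0) := by
        refine add_le_add ?_ (add_le_add ?_ ?_)
        · refine le_trans (le_of_eq ?_) h1
          refine setLIntegral_congr_fun (S.isOpen.measurableSet.inter
            Metric.isClosed_closedBall.measurableSet) fun x hx => ?_
          rw [S.whitneyExt_of_mem_closure (subset_closure hx.1), indicator_of_mem hx.1]
        · calc _ ≤ ∫⁻ _ in Q.carrier ∩ (closure D)ᶜ, ENNReal.ofReal (C₁ * M * ω h) := by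
                refine setLIntegral_mono' hmeas fun x hx => ?_
                rw [Real.enorm_eq_ofReal_abs]
                exact ENNReal.ofReal_le_ofReal (hext x hx.1 hx.2)
            _ ≤ ENNReal.ofReal (C₁ * M * ω h) * volume Q.carrier := by
                rw [setLIntegral_const]
                gcongr
                exact inter_subset_left
            _ = _ := by rw [Q.volume_carrier, ← ENNReal.ofReal_mul (by positivity)]
        · rw [setLIntegral_measure_zero _ _ S.volume_frontier]
    _ = ENNReal.ofReal (ℓ ^ d * (C₁ * (τ ^ d + 1) * M * ω h)) := by
        rw [add_zero, ← ENNReal.ofReal_add (by positivity) (by positivity), hh, mul_pow]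
        congr 1
        ring
    _ ≤ _ := by
        apply ENNReal.ofReal_le_ofReal
        have : C₁ * (τ ^ d + 1) * M * ω h ≤
            C₁ * (τ ^ d + 1) * M * (Cω * τ ^ (n + 1) * ω ℓ) := by gcongr
        calc _ ≤ ℓ ^ d * (C₁ * (τ ^ d + 1) * M * (Cω * τ ^ (n + 1) * ω ℓ)) := by gcongr
          _ = _ := by ring

/-- A function of the interior space is integrable up to the boundary. -/
lemma integrableOn_of_data (S : ExtensionSetup D W W' ψ refl ω n R c r₀ Cω r)
    (hf : ExtensionData D W' refl ω n R C₀ f P M)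
    (hloc : LocallyIntegrableOn f D) : IntegrableOn f D := by
  obtain ⟨η, ε, C₁, hη, hη1, hε, hC₁, hpoly⟩ := S.exists_local_poly C₀
  have hcl : IntegrableOn (D.indicator f) (closure D) := by
    refine LocallyIntegrableOn.integrableOn_isCompact (fun x hx => ?_) S.bounded.isCompact_closure
    by_cases hxD : x ∈ D
    · obtain ⟨s, hs, hfs⟩ := hloc x hxD
      rw [S.isOpen.nhdsWithin_eq hxD] at hs
      refine ⟨s, mem_nhdsWithin_of_mem_nhds hs, ?_⟩
      exact hfs.indicator S.isOpen.measurableSet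
    · have hxf : x ∈ frontier D := by
        rw [S.isOpen.frontier_eq]
        exact ⟨hx, hxD⟩
      -- Local integrability on `D` says nothing at a boundary point; there `f` differs from a
      -- polynomial by a function of finite integral. Compactness of the closure then gives
      -- integrability on `D`.
      obtain ⟨p, -, h1, -⟩ := hpoly f P M hf x hxf ε hε le_rfl
      refine ⟨Metric.closedBall x (η * ε), mem_nhdsWithin_of_mem_nhds
        (Metric.closedBall_mem_nhds x (by positivity)), ?_⟩
      rw [IntegrableOn, integrable_indicator_iff S.isOpen.measurableSet, IntegrableOn,
        Measure.restrict_restrict S.isOpen.measurableSet]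
      have hpi : IntegrableOn (polyVal p) (D ∩ Metric.closedBall x (η * ε)) :=
        ((continuous_polyVal p).locallyIntegrable.integrableOn_isCompact
          (isCompact_closedBall x (η * ε))).mono_set inter_subset_right
      have hsub : IntegrableOn (fun y => f y - polyVal p y)
          (D ∩ Metric.closedBall x (η * ε)) := by
        refine ⟨(hf.meas.mono_set inter_subset_left).sub
          (continuous_polyVal p).aestronglyMeasurable, ?_⟩
        exact h1.trans_lt ENNReal.ofReal_lt_top
      have := hsub.add hpi
      refine this.congr (Filter.Eventually.of_forall fun y => ?_)
      simp
  have h2 := hcl.mono_set (subset_closure (s := D))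
  exact h2.congr_fun (fun x hx => indicator_of_mem hx f) S.isOpen.measurableSet

lemma aestronglyMeasurable_whitneyExt (S : ExtensionSetup D W W' ψ refl ω n R c r₀ Cω r)
    (hf : AEStronglyMeasurable f (volume.restrict D)) :
    AEStronglyMeasurable (whitneyExt D R W' ψ refl P f) volume := by
  have hmeas : MeasurableSet (closure D)ᶜ := isClosed_closure.measurableSet.compl
  have heq : whitneyExt D R W' ψ refl P f = fun x =>
      D.indicator f x + (closure D)ᶜ.indicator (whitneyExt D R W' ψ refl P f) x := by
    ext x
    by_cases hx : x ∈ closure D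
    · rw [S.whitneyExt_of_mem_closure hx, indicator_of_notMem (notMem_compl_iff.2 hx), add_zero]
    · rw [indicator_of_notMem (fun h => hx (subset_closure h)),
        indicator_of_mem (show x ∈ (closure D)ᶜ from hx), zero_add]
  rw [heq]
  refine ((aestronglyMeasurable_indicator_iff S.isOpen.measurableSet).2 hf).add
    ((aestronglyMeasurable_indicator_iff hmeas).2 ?_)
  exact S.contDiffOn_whitneyExt.continuousOn.aestronglyMeasurable hmeas

/-- The bound of the `L¹` norm of the extension. -/
lemma exists_lintegral_bound (S : ExtensionSetup D W W' ψ refl ω n R c r₀ Cω r)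
    (C₀ : ℝ≥0) :
    ∃ C : ℝ, 0 ≤ C ∧ ∀ f P M, ExtensionData D W' refl ω n R C₀ f P M → ∀ L : ℝ, 0 ≤ L →
      ∫⁻ x in D, ‖f x‖ₑ ≤ ENNReal.ofReal L →
      ∫⁻ x, ‖whitneyExt D R W' ψ refl P f x‖ₑ ≤ ENNReal.ofReal (C * (M + L)) := by
  obtain ⟨C₁, hC₁, hext⟩ := S.exists_exterior_bound C₀
  obtain ⟨R₂, -, hsupp⟩ := S.exists_support_bound
  set V : ℝ := (volume (Metric.closedBall (0 : Euc d) R₂)).toReal with hV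
  have hV0 : 0 ≤ V := ENNReal.toReal_nonneg
  have hVE : volume (Metric.closedBall (0 : Euc d) R₂) = ENNReal.ofReal V :=
    (ENNReal.ofReal_toReal (measure_closedBall_lt_top.ne)).symm
  refine ⟨1 + C₁ * V, by positivity, fun f P M hf L hL hfL => ?_⟩
  have hM := hf.nonneg
  calc ∫⁻ x, ‖whitneyExt D R W' ψ refl P f x‖ₑ
      ≤ ∫⁻ x, (D.indicator (fun x => ‖f x‖ₑ) x +
          (Metric.closedBall (0 : Euc d) R₂).indicator
            (fun _ => ENNReal.ofReal (C₁ * (M + L))) x) := by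
        refine lintegral_mono fun x => ?_
        by_cases hx : x ∈ closure D
        · rw [S.whitneyExt_of_mem_closure hx, enorm_indicator_eq_indicator_enorm]
          exact le_self_add
        · by_cases hxR : x ∈ Metric.closedBall (0 : Euc d) R₂
          · rw [indicator_of_mem hxR, Real.enorm_eq_ofReal_abs]
            exact (ENNReal.ofReal_le_ofReal (hext f P M hf L hL hfL x hx)).trans le_add_self
          · rw [hsupp f P x hxR]
            simp
    _ = (∫⁻ x in D, ‖f x‖ₑ) + ENNReal.ofReal (C₁ * (M + L)) * ENNReal.ofReal V := by
        rw [lintegral_add_right _ (measurable_const.indicator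
          Metric.isClosed_closedBall.measurableSet), lintegral_indicator S.isOpen.measurableSet,
          lintegral_indicator Metric.isClosed_closedBall.measurableSet, setLIntegral_const, hVE]
    _ ≤ ENNReal.ofReal L + ENNReal.ofReal (C₁ * (M + L)) * ENNReal.ofReal V := by gcongr
    _ = ENNReal.ofReal (L + C₁ * (M + L) * V) := by
        rw [← ENNReal.ofReal_mul (by positivity), ← ENNReal.ofReal_add hL (by positivity)]
    _ ≤ _ := by
        apply ENNReal.ofReal_le_ofReal
        nlinarith

/-- The bound of the seminorm of the extension. -/
lemma exists_seminorm_bound (S : ExtensionSetup D W W' ψ refl ω n R c r₀ Cω r)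
    (C₀ : ℝ≥0) :
    ∃ C : ℝ, 0 ≤ C ∧ ∀ f P M, ExtensionData D W' refl ω n R C₀ f P M → ∀ L : ℝ, 0 ≤ L →
      ∫⁻ x in D, ‖f x‖ₑ ≤ ENNReal.ofReal L →
      zygSeminorm ω n univ (whitneyExt D R W' ψ refl P f) ≤ ENNReal.ofReal (C * (M + L)) := by
  have hd' : (1 : ℝ) ≤ d := by exact_mod_cast S.hd
  obtain ⟨ℓ₁, C₁, hℓ₁, hC₁, hfar⟩ := S.exists_far_approx C₀
  obtain ⟨ℓ₂, C₂, hℓ₂, hC₂, hnear⟩ := S.exists_near_approx C₀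
  obtain ⟨C₃, hC₃, hbd⟩ := S.exists_lintegral_bound C₀
  set ℓ₀ : ℝ := min ℓ₁ ℓ₂ with hℓ₀
  have hℓ₀0 : 0 < ℓ₀ := by positivity
  have hω₀ := S.modulus.pos ℓ₀ hℓ₀0
  set C₄ : ℝ := C₃ / (ℓ₀ ^ d * ω ℓ₀) with hC₄
  have hC₄0 : 0 ≤ C₄ := by positivity
  refine ⟨1 + C₁ + C₂ + C₄, by positivity, fun f P M hf L hL hfL => ?_⟩
  have hM := hf.nonneg
  refine iSup₂_le fun Q _ => ?_
  have hℓ := Q.side_pos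
  have hωQ := S.modulus.pos Q.side hℓ
  have hfin : ∀ B : ℝ, B ≤ (1 + C₁ + C₂ + C₄) * (M + L) →
      cubeOsc ω n (whitneyExt D R W' ψ refl P f) Q ≤ ENNReal.ofReal B →
      cubeOsc ω n (whitneyExt D R W' ψ refl P f) Q ≤
        ENNReal.ofReal ((1 + C₁ + C₂ + C₄) * (M + L)) :=
    fun B hB h => h.trans (ENNReal.ofReal_le_ofReal hB)
  rcases le_or_gt Q.side ℓ₀ with hsmall | hlarge
  · rcases le_or_gt (Metric.infDist Q.center (frontier D)) (2 * d * Q.side) with hcl | hdist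
    · obtain ⟨p, hp, hpd⟩ := hnear f P M hf Q (hsmall.trans (min_le_right _ _)) hcl
      refine hfin (C₂ * M) ?_ (cubeOsc_le_of_meanDev_le hp hωQ hpd)
      exact mul_le_mul (by linarith) (by linarith) hM (by positivity)
    · by_cases hxc : Q.center ∈ closure D
      · have hxD : Q.center ∈ D := by
          by_contra hxD
          have : Q.center ∈ frontier D := by
            rw [S.isOpen.frontier_eq]
            exact ⟨hxc, hxD⟩
          rw [Metric.infDist_zero_of_mem this] at hdist
          have : 0 < 2 * (d : ℝ) * Q.side := by positivity
          linarith
        have h2Q : (Q.scale 2 two_pos).carrier ⊆ D := by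
          refine Subset.trans ?_ (closedBall_subset_of_lt_infDist S.isOpen hxD
            (by positivity : 0 ≤ 2 * (d : ℝ) * Q.side) hdist)
          intro y hy
          have h1 := AxisCube.norm_sub_center_le hy
          simp only [AxisCube.scale] at h1
          rw [Metric.mem_closedBall, dist_eq_norm]
          have : 0 < (d : ℝ) * Q.side := by positivity
          linarith
        obtain ⟨p, hp, hpd⟩ := exists_meanDev_le S.modulus.pos hf.seminorm_lt h2Q
        refine hfin M ?_ (cubeOsc_le_of_meanDev_le hp hωQ (le_trans (le_of_eq ?_) hpd))
        · have : 0 ≤ (C₁ + C₂ + C₄) * (M + L) := by positivity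
          nlinarith
        · unfold meanDev
          congr 1
          refine setLIntegral_congr_fun Q.measurableSet_carrier fun x hx => ?_
          have hxD : x ∈ D := h2Q (Q.carrier_subset_scale two_pos one_le_two hx)
          rw [S.whitneyExt_of_mem_closure (subset_closure hxD), indicator_of_mem hxD]
      · obtain ⟨p, hp, hpd⟩ := hfar f P M hf L hL hfL Q (hsmall.trans (min_le_left _ _)) hxc hdist
        refine hfin (C₁ * (M + L)) ?_ (cubeOsc_le_of_meanDev_le hp hωQ
          (meanDev_le_of_forall_le hpd))
        gcongr
        linarith
  -- On large cubes the zero polynomial suffices: the mean is at most the `L¹` norm over the volume,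
  -- and both the volume and `ω` are bounded below.
  · refine hfin (C₄ * (M + L)) ?_ (cubeOsc_le_of_meanDev_le (p := 0) (by simp) hωQ
      (meanDev_le_of_setLIntegral_le ?_))
    · gcongr
      linarith
    · simp only [polyVal_zero, sub_zero]
      refine (setLIntegral_le_lintegral _ _).trans ((hbd f P M hf L hL hfL).trans ?_)
      apply ENNReal.ofReal_le_ofReal
      have h1 : ℓ₀ ^ d * ω ℓ₀ ≤ Q.side ^ d * ω Q.side :=
        mul_le_mul (pow_le_pow_left₀ hℓ₀0.le hlarge.le d) (S.modulus.mono _ _ hℓ₀0.le hlarge.le)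
          hω₀.le (by positivity)
      calc C₃ * (M + L) = C₄ * (M + L) * (ℓ₀ ^ d * ω ℓ₀) := by
            rw [hC₄]
            field_simp
        _ ≤ C₄ * (M + L) * (Q.side ^ d * ω Q.side) := by gcongr
        _ = _ := by ring

end ExtensionSetup

end Estimates

/-! ### Assembly of the geometric data and conclusion. -/

lemma IsLipschitzDomain.exists_extensionSetup {d : ℕ} (hd : 0 < d) {δ : ℝ≥0} {R : ℝ}
    {D : Set (Euc d)} (hD : IsLipschitzDomain δ R D) {n : ℕ} {ω : ℝ → ℝ}
    (hω : IsModulusOfOrder ω n) {W W' : Set (AxisCube d)} (hW : IsWhitneyCovering D W)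
    (hW' : IsWhitneyCovering (closure D)ᶜ W') {ψ : AxisCube d → Euc d → ℝ}
    (hψ : IsWhitneyPartition (closure D)ᶜ W' ψ) {refl : AxisCube d → AxisCube d}
    (hrefl : ∀ Q ∈ W', Q.side ≤ R → IsReflective D W Q (refl Q)) :
    ∃ c r₀ Cω r, ExtensionSetup D W W' ψ refl ω n R c r₀ Cω r := by
  obtain ⟨c, r₀, hc, hc1, hr₀, hcones⟩ := hD.exists_cones
  obtain ⟨Cω, r, hmod⟩ := hω.exists_bounds
  obtain ⟨hopen, hconn, hbdd, hR, -⟩ := hD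
  have : Nonempty (Fin d) := ⟨⟨0, hd⟩⟩
  refine ⟨c, r₀, Cω, r, hd, hopen, hbdd, hR, hc, hc1, hr₀, hcones, ?_, ?_, ?_, hmod, hW, hW', hψ,
    hrefl⟩
  · rw [nonempty_frontier_iff]
    refine ⟨hconn.nonempty, fun h => ?_⟩
    rw [h] at hbdd
    exact NormedSpace.unbounded_univ ℝ (Euc d) hbdd
  · rw [frontier_compl]
    exact hcones.frontier_closure_eq hopen hc hr₀
  · exact hcones.volume_frontier hopen hc hr₀

theorem proposition3 {d : ℕ} (hd : 0 < d) (δ : ℝ≥0) (R : ℝ) (D : Set (Euc d))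
    (hD : IsLipschitzDomain δ R D)
    (n : ℕ) (ω : ℝ → ℝ) (hω : IsModulusOfOrder ω n)
    (W W' : Set (AxisCube d))
    (hW : IsWhitneyCovering D W) (hW' : IsWhitneyCovering (closure D)ᶜ W')
    (ψ : AxisCube d → Euc d → ℝ) (hψ : IsWhitneyPartition (closure D)ᶜ W' ψ)
    (refl : AxisCube d → AxisCube d)
    (hrefl : ∀ Q ∈ W', Q.side ≤ R → IsReflective D W Q (refl Q))
    (C₀ : ℝ≥0) :
    ∃ C : ℝ≥0, ∀ (f : Euc d → ℝ) (P : AxisCube d → MvPolynomial (Fin d) ℝ),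
      MemZygInt ω n D f →
      (∀ Q ∈ W', Q.side ≤ R → IsNearBest ω n D C₀ f (refl Q) (P (refl Q))) →
      HasCompactSupport (whitneyExt D R W' ψ refl P f) ∧
      ContDiffOn ℝ ((⊤ : ℕ∞) : WithTop ℕ∞) (whitneyExt D R W' ψ refl P f) (closure D)ᶜ ∧
      Integrable (whitneyExt D R W' ψ refl P f) ∧
      MemZyg ω n univ (whitneyExt D R W' ψ refl P f) ∧
      zygSeminorm ω n univ (whitneyExt D R W' ψ refl P f)
          + ∫⁻ x, ‖whitneyExt D R W' ψ refl P f x‖ₑ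
        ≤ C * (zygIntSeminorm ω n D f + ∫⁻ x in D, ‖f x‖ₑ) := by
  obtain ⟨c, r₀, Cω, r, S⟩ := hD.exists_extensionSetup hd hω hW hW' hψ hrefl
  obtain ⟨C₁, hC₁, hsemi⟩ := S.exists_seminorm_bound C₀
  obtain ⟨C₂, hC₂, hbd⟩ := S.exists_lintegral_bound C₀
  obtain ⟨R₂, -, hsupp⟩ := S.exists_support_bound
  set C : ℝ := C₁ + C₂ + 1 with hC
  have hC0 : 0 < C := by positivity
  refine ⟨C.toNNReal, fun f P hf hP => ?_⟩
  set N : ℝ := (zygIntSeminorm ω n D f).toReal with hN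
  have hNE : zygIntSeminorm ω n D f = ENNReal.ofReal N := (ENNReal.ofReal_toReal hf.2.ne).symm
  have hN0 : 0 ≤ N := ENNReal.toReal_nonneg
  -- The estimates need a strict upper bound for the seminorm, which may vanish. Hence `N + t` is
  -- used, with `t` sent to zero at the end.
  have hdata : ∀ t : ℝ, 0 < t → ExtensionData D W' refl ω n R C₀ f P (N + t) := by
    intro t ht
    have hlt : zygIntSeminorm ω n D f < ENNReal.ofReal (N + t) := by
      rw [hNE]
      exact (ENNReal.ofReal_lt_ofReal_iff (by linarith)).2 (by linarith)
    exact ⟨by positivity, hf.1.aestronglyMeasurable, hlt, fun Q hQ hQR => (hP Q hQ hQR).1,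
      fun Q hQ hQR => (hP Q hQ hQR).meanDev_le_ofReal hlt.le
        (S.modulus.pos _ (refl Q).side_pos).le⟩
  have hfint := S.integrableOn_of_data (hdata 1 one_pos) hf.1
  have hLtop : ∫⁻ x in D, ‖f x‖ₑ < ∞ := hfint.2
  set L : ℝ := (∫⁻ x in D, ‖f x‖ₑ).toReal with hL
  have hLE : ∫⁻ x in D, ‖f x‖ₑ = ENNReal.ofReal L := (ENNReal.ofReal_toReal hLtop.ne).symm
  have hL0 : 0 ≤ L := ENNReal.toReal_nonneg
  have hmain : ∀ t : ℝ, 0 < t → zygSeminorm ω n univ (whitneyExt D R W' ψ refl P f)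
      + ∫⁻ x, ‖whitneyExt D R W' ψ refl P f x‖ₑ ≤ ENNReal.ofReal (C * (N + t + L)) := by
    intro t ht
    refine (add_le_add (hsemi f P _ (hdata t ht) L hL0 hLE.le)
      (hbd f P _ (hdata t ht) L hL0 hLE.le)).trans ?_
    rw [← ENNReal.ofReal_add (by positivity) (by positivity)]
    apply ENNReal.ofReal_le_ofReal
    nlinarith
  have hone := (hmain 1 one_pos).trans_lt ENNReal.ofReal_lt_top
  have hfi : Integrable (whitneyExt D R W' ψ refl P f) :=
    ⟨S.aestronglyMeasurable_whitneyExt hf.1.aestronglyMeasurable, le_add_self.trans_lt hone⟩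
  refine ⟨HasCompactSupport.intro (isCompact_closedBall (0 : Euc d) R₂) fun x hx => hsupp f P x hx,
    S.contDiffOn_whitneyExt, hfi, ⟨hfi.locallyIntegrable.locallyIntegrableOn _,
      le_self_add.trans_lt hone⟩, ?_⟩
  refine ENNReal.le_of_forall_pos_le_add fun t ht _ => ?_
  -- The choice `t / C` makes the excess exactly `t`; the constants do not depend on this parameter.
  refine (hmain (t / C) (by positivity)).trans (le_of_eq ?_)
  have hcoe : ((C.toNNReal : ℝ≥0) : ℝ≥0∞) = ENNReal.ofReal C := rfl
  rw [hNE, hLE, hcoe, ← ENNReal.ofReal_add hN0 hL0, ← ENNReal.ofReal_mul hC0.le,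
    ← ENNReal.ofReal_coe_nnreal, ← ENNReal.ofReal_add (by positivity) t.coe_nonneg]
  congr 1
  field_simp
  ring
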